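/- Let $p$ be a prime number and let $K$ be a complete discretely valued field of mixed characteristic $(0,p)$, i.e. $K$ is the fraction field of a complete discrete valuation ring, $\operatorname{char} K = 0$ and the residue field (not assumed perfect) has characteristic $p$. Assume that $K$ contains a primitive $p$-th root of unity. Let $K^{nr}$ be the maximal unramified extension of $K$ in a separable closure of $K$ (the compositum of the finite subextensions with ramification index one and separable residue field extension), and let $\mathrm{Br}(K^{nr}/K)=\ker(\mathrm{Br}\,K\to \mathrm{Br}\,K^{nr})$. Recall that a cyclic algebra over $K$ is a central simple algebra of the form $(E/K,\sigma,b)=\bigoplus_{i=0}^{n-1}E\,y^i$ with $y^n=b$ and $y e=\sigma(e)y$ for $e\in E$, where $E/K$ is a finite cyclic Galois extension of degree $n\ge 1$, $\sigma$ is a generator of $\mathrm{Gal}(E/K)$ and $b\in K^\times$. Then the $p$-torsion subgroup ${}_p\mathrm{Br}(K^{nr}/K)=\{x\in \mathrm{Br}(K^{nr}/K) : px=0\}$ is generated by those of its elements that are Brauer classes of cyclic algebras over $K$. Moreover, every element of ${}_p\mathrm{Br}(K^{nr}/K)$ is a sum of at most two classes of cyclic algebras over $K$, which can themselves be taken in ${}_p\mathrm{Br}(K^{nr}/K)$.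 -/

import Mathlib

open scoped TensorProduct

universe u

section TensorCSA

/-- For a finite-dimensional central simple algebra `A` over a field, the canonical map
`A ⊗ Aᵐᵒᵖ → End A` is surjective. -/
theorem csa_mulLeftRight_surjective (K A : Type*) [Field K] [Ring A] [Algebra K A]
    [Algebra.IsCentral K A] [IsSimpleRing A] [FiniteDimensional K A] :
    Function.Surjective (AlgHom.mulLeftRight K A) := by
  let _ : Module (A ⊗[K] Aᵐᵒᵖ) A := TensorProduct.Algebra.module
  have hsmul : ∀ (r : A ⊗[K] Aᵐᵒᵖ) (x : A), r • x = AlgHom.mulLeftRight K A r x :=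
    fun _ _ => rfl
  have hsimple : IsSimpleModule (A ⊗[K] Aᵐᵒᵖ) A := by
    rw [isSimpleModule_iff]
    refine { eq_bot_or_eq_top := fun N => ?_ }
    let I : TwoSidedIdeal A := TwoSidedIdeal.mk' (N : Set A) N.zero_mem N.add_mem N.neg_mem
      (fun {x y} hy => by
        have := N.smul_mem (x ⊗ₜ[K] (1 : Aᵐᵒᵖ)) hy
        simpa [hsmul] using this)
      (fun {x y} hx => by
        have := N.smul_mem ((1 : A) ⊗ₜ[K] (MulOpposite.op y)) hx
        simpa [hsmul] using this)
    have hI : ∀ x, x ∈ I ↔ x ∈ N := fun x => by simp [I]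
    rcases eq_bot_or_eq_top I with h | h
    · left
      rw [eq_bot_iff]
      intro x hx
      have := (hI x).2 hx
      rw [h] at this
      simpa using this
    · right
      rw [eq_top_iff]
      intro x _
      rw [← hI, h]
      trivial
  intro f
  have hend : ∀ φ : Module.End (A ⊗[K] Aᵐᵒᵖ) A, ∃ k : K, ∀ x, φ x = k • x := by
    intro φ
    have h1 : ∀ x, φ x = x * φ 1 := fun x => by
      have := φ.map_smul (x ⊗ₜ[K] (1 : Aᵐᵒᵖ)) 1
      simpa [hsmul] using this
    have h2 : ∀ x, φ x = φ 1 * x := fun x => by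
      have := φ.map_smul ((1 : A) ⊗ₜ[K] (MulOpposite.op x)) 1
      simpa [hsmul] using this
    have hc : φ 1 ∈ Subalgebra.center K A := by
      rw [Subalgebra.mem_center_iff]
      intro b
      rw [← h1, ← h2]
    obtain ⟨k, hk⟩ := (Algebra.IsCentral.mem_center_iff K).1 hc
    exact ⟨k, fun x => by rw [h2, hk, Algebra.smul_def]⟩
  let g : Module.End (Module.End (A ⊗[K] Aᵐᵒᵖ) A) A :=
    { toFun := f
      map_add' := f.map_add
      map_smul' := fun φ x => by
        obtain ⟨k, hk⟩ := hend φ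
        simp [hk] }
  let b := Module.finBasis K A
  classical
  obtain ⟨r, hr⟩ := jacobson_density g (Finset.univ.image b)
  refine ⟨r, b.ext fun i => ?_⟩
  have := hr (b i) (by simp)
  rw [← hsmul, ← this]
  rfl

/-- The tensor product of a finite-dimensional central simple algebra and a simple algebra
is simple. -/
theorem isSimpleRing_tensor_left (K A B : Type*) [Field K] [Ring A] [Algebra K A]
    [Algebra.IsCentral K A] [IsSimpleRing A] [FiniteDimensional K A]
    [Ring B] [Algebra K B] [IsSimpleRing B] : IsSimpleRing (A ⊗[K] B) := by
  have hmem : ∀ (I : TwoSidedIdeal (A ⊗[K] B)) (f : Module.End K A) (x : A ⊗[K] B), x ∈ I →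
      f.rTensor B x ∈ I := by
    intro I f x hx
    obtain ⟨t, rfl⟩ := csa_mulLeftRight_surjective K A f
    induction t with
    | zero => simp
    | add s t hs ht =>
      rw [map_add, LinearMap.rTensor_add]
      exact I.add_mem hs ht
    | tmul a c =>
      have : (AlgHom.mulLeftRight K A (a ⊗ₜ c)).rTensor B x =
          (a ⊗ₜ[K] (1 : B)) * x * (c.unop ⊗ₜ[K] (1 : B)) := by
        clear hx
        induction x with
        | zero => simp
        | add y z hy hz => rw [map_add, hy, hz, mul_add, add_mul]
        | tmul y z => simp
      rw [this]
      exact I.mul_mem_right _ _ (I.mul_mem_left _ _ hx)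
  refine IsSimpleRing.of_eq_bot_or_eq_top fun I => ?_
  rw [or_iff_not_imp_left, ← I.one_mem_iff]
  intro hI
  obtain ⟨x, hxI, hx0⟩ := SetLike.exists_of_lt (bot_lt_iff_ne_bot.mpr hI : ⊥ < I)
  replace hx0 : x ≠ 0 := by simpa using hx0
  let b := Module.finBasis K A
  obtain ⟨j, hj⟩ : ∃ j, TensorProduct.equivFinsuppOfBasisLeft (N := B) b x j ≠ 0 := by
    by_contra! h
    exact hx0 ((TensorProduct.equivFinsuppOfBasisLeft (N := B) b).map_eq_zero_iff.1
      (Finsupp.ext h))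
  let f : Module.End K A := (LinearMap.toSpanSingleton K A 1).comp (b.coord j)
  have hf : f.rTensor B x =
      (1 : A) ⊗ₜ[K] (TensorProduct.equivFinsuppOfBasisLeft (N := B) b x j) := by
    clear hj hx0 hxI
    induction x with
    | zero => simp
    | add y z hy hz => simp [map_add, hy, hz, TensorProduct.tmul_add]
    | tmul y z => simp [f, TensorProduct.smul_tmul]
  have h1 := hmem I f x hxI
  rw [hf] at h1
  let J : TwoSidedIdeal B := I.comap (Algebra.TensorProduct.includeRight : B →ₐ[K] A ⊗[K] B)
  have h2 : (1 : B) ∈ J := IsSimpleRing.one_mem_of_ne_zero_mem J hj (by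
    rw [TwoSidedIdeal.mem_comap]; exact h1)
  rw [TwoSidedIdeal.mem_comap] at h2
  simpa [Algebra.TensorProduct.one_def] using h2

instance isSimpleRing_tensor (K B A : Type*) [Field K] [Ring A] [Algebra K A]
    [Algebra.IsCentral K A] [IsSimpleRing A] [FiniteDimensional K A]
    [Ring B] [Algebra K B] [IsSimpleRing B] : IsSimpleRing (B ⊗[K] A) :=
  IsSimpleRing.of_ringEquiv (Algebra.TensorProduct.comm K A B).toRingEquiv
    (isSimpleRing_tensor_left K A B)

/-- An element of `B ⊗ A`, with `A` central, commuting with `1 ⊗ A` lies in `B ⊗ 1`. -/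
theorem exists_tmul_one_of_commute (K B A : Type*) [Field K] [Ring A] [Algebra K A]
    [Algebra.IsCentral K A] [Ring B] [Algebra K B] (z : B ⊗[K] A)
    (hz : ∀ a : A, (1 : B) ⊗ₜ[K] a * z = z * (1 : B) ⊗ₜ[K] a) :
    ∃ c : B, z = c ⊗ₜ[K] (1 : A) := by
  have h : z ∈ Subalgebra.centralizer K
      ((Algebra.TensorProduct.includeRight : A →ₐ[K] B ⊗[K] A).range : Set (B ⊗[K] A)) := by
    rw [Subalgebra.mem_centralizer_iff]
    rintro _ ⟨a, rfl⟩
    exact hz a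
  rw [Subalgebra.centralizer_range_includeRight_eq_center_tensorProduct] at h
  obtain ⟨w, rfl⟩ := h
  clear hz
  induction w with
  | zero => exact ⟨0, by simp⟩
  | tmul x y =>
    obtain ⟨k, hk⟩ := (Algebra.IsCentral.mem_center_iff K).1 y.2
    refine ⟨k • x, ?_⟩
    simp [hk, Algebra.algebraMap_eq_smul_one, TensorProduct.smul_tmul]
  | add x y hx hy =>
    obtain ⟨c, hc⟩ := hx
    obtain ⟨d, hd⟩ := hy
    exact ⟨c + d, by rw [map_add, hc, hd, TensorProduct.add_tmul]⟩

instance isCentral_baseChange (K L A : Type*) [Field K] [Field L] [Algebra K L]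
    [Ring A] [Algebra K A] [Algebra.IsCentral K A] : Algebra.IsCentral L (L ⊗[K] A) where
  out z hz := by
    rw [Subalgebra.mem_center_iff] at hz
    obtain ⟨c, rfl⟩ := exists_tmul_one_of_commute K L A z fun a => hz _
    exact ⟨c, rfl⟩

instance isCentral_tensor (K B A : Type*) [Field K] [Ring A] [Algebra K A]
    [Algebra.IsCentral K A] [Nontrivial A] [Ring B] [Algebra K B] [Algebra.IsCentral K B] :
    Algebra.IsCentral K (B ⊗[K] A) where
  out z hz := by
    rw [Subalgebra.mem_center_iff] at hz
    obtain ⟨c, rfl⟩ := exists_tmul_one_of_commute K B A z fun a => hz _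
    have hc : c ∈ Subalgebra.center K B := by
      rw [Subalgebra.mem_center_iff]
      intro b
      have := hz (b ⊗ₜ 1)
      simp only [Algebra.TensorProduct.tmul_mul_tmul, mul_one] at this
      exact Algebra.TensorProduct.includeLeft_injective (S := K)
        (FaithfulSMul.algebraMap_injective K A) this
    obtain ⟨k, rfl⟩ := (Algebra.IsCentral.mem_center_iff K).1 hc
    exact ⟨k, rfl⟩

end TensorCSA

section Brauer

/-- The Brauer class of a finite-dimensional central simple algebra. -/
def brauerClass (K A : Type u) [Field K] [Ring A] [Algebra K A] [Algebra.IsCentral K A]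
    [IsSimpleRing A] [FiniteDimensional K A] : BrauerGroup.{u, u} K :=
  Quotient.mk (Brauer.CSA_Setoid.{u, u} K) { toAlgCat := AlgCat.of K A }

variable {K : Type u} [Field K]

theorem brauerClass_eq_of_matrix {A B : Type u} [Ring A] [Algebra K A] [Algebra.IsCentral K A]
    [IsSimpleRing A] [FiniteDimensional K A] [Ring B] [Algebra K B] [Algebra.IsCentral K B]
    [IsSimpleRing B] [FiniteDimensional K B] {m n : Type} [Fintype m] [DecidableEq m] [Nonempty m]
    [Fintype n] [DecidableEq n] [Nonempty n] (e : Matrix m m A ≃ₐ[K] Matrix n n B) :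
    brauerClass K A = brauerClass K B :=
  Quotient.sound (s := Brauer.CSA_Setoid.{u, u} K)
    ⟨Fintype.card m, Fintype.card n, Fintype.card_ne_zero, Fintype.card_ne_zero,
      ⟨(Matrix.reindexAlgEquiv K A (Fintype.equivFin m)).symm.trans
        (e.trans (Matrix.reindexAlgEquiv K B (Fintype.equivFin n)))⟩⟩

theorem brauerClass_eq_of_algEquiv {A B : Type u} [Ring A] [Algebra K A] [Algebra.IsCentral K A]
    [IsSimpleRing A] [FiniteDimensional K A] [Ring B] [Algebra K B] [Algebra.IsCentral K B]
    [IsSimpleRing B] [FiniteDimensional K B] (e : A ≃ₐ[K] B) :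
    brauerClass K A = brauerClass K B :=
  brauerClass_eq_of_matrix (m := Unit) (n := Unit) e.mapMatrix

theorem brauerClass_eq_iff (A B : CSA.{u, u} K) :
    brauerClass K A = brauerClass K B ↔ IsBrauerEquivalent A B :=
  ⟨fun h => Quotient.exact (s := Brauer.CSA_Setoid.{u, u} K) h,
    fun h => Quotient.sound (s := Brauer.CSA_Setoid.{u, u} K) h⟩

/-- `A ⊗ Aᵐᵒᵖ` is a matrix algebra. -/
noncomputable def csaTensorOpEquiv (A : Type u) [Ring A] [Algebra K A] [Algebra.IsCentral K A]
    [IsSimpleRing A] [FiniteDimensional K A] :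
    A ⊗[K] Aᵐᵒᵖ ≃ₐ[K] Matrix (Fin (Module.finrank K A)) (Fin (Module.finrank K A)) K :=
  (AlgEquiv.ofBijective (AlgHom.mulLeftRight K A) (by
    have h := csa_mulLeftRight_surjective K A
    refine ⟨?_, h⟩
    refine (LinearMap.injective_iff_surjective_of_finrank_eq_finrank
      (f := (AlgHom.mulLeftRight K A).toLinearMap) ?_).2 h
    rw [Module.finrank_tensorProduct, Module.finrank_linearMap,
      (MulOpposite.opLinearEquiv K : A ≃ₗ[K] Aᵐᵒᵖ).finrank_eq])).trans
    (algEquivMatrix (Module.finBasis K A))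

noncomputable instance brauerAdd : Add (BrauerGroup.{u, u} K) where
  add := Quotient.map₂ (sa := Brauer.CSA_Setoid.{u, u} K) (sb := Brauer.CSA_Setoid.{u, u} K)
    (sc := Brauer.CSA_Setoid.{u, u} K) (fun A B => { toAlgCat := AlgCat.of K (A ⊗[K] B) }) (by
      rintro A A' ⟨n, m, hn, hm, ⟨e⟩⟩ B B' ⟨n', m', hn', hm', ⟨e'⟩⟩
      have := NeZero.mk hn; have := NeZero.mk hm; have := NeZero.mk hn'; have := NeZero.mk hm'
      exact (brauerClass_eq_iff _ _).1 (brauerClass_eq_of_matrix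
        ((Matrix.kroneckerTMulAlgEquiv (Fin n) (Fin n') K K A B).symm.trans
        ((Algebra.TensorProduct.congr e e').trans
          (Matrix.kroneckerTMulAlgEquiv (Fin m) (Fin m') K K A' B')))))

noncomputable instance brauerZero : Zero (BrauerGroup.{u, u} K) where
  zero := brauerClass K K

noncomputable instance brauerNeg : Neg (BrauerGroup.{u, u} K) where
  neg := Quotient.map (sa := Brauer.CSA_Setoid.{u, u} K) (sb := Brauer.CSA_Setoid.{u, u} K)
    (fun A => { toAlgCat := AlgCat.of K (A : Type u)ᵐᵒᵖ }) (by
      rintro A A' ⟨n, m, hn, hm, ⟨e⟩⟩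
      exact ⟨n, m, hn, hm, ⟨(AlgEquiv.mopMatrix (R := K) (α := A)).trans
        ((AlgEquiv.op e).trans (AlgEquiv.mopMatrix (R := K) (α := A')).symm)⟩⟩)

/-- The group structure on the Brauer group of a field, written additively: the sum of the classes
of `A` and `B` is the class of `A ⊗ B`, and the negative of the class of `A` is that of the
opposite algebra. -/
noncomputable instance brauerAddCommGroup : AddCommGroup (BrauerGroup.{u, u} K) where
  nsmul := nsmulRec
  zsmul := zsmulRec
  add_assoc x y z := by
    induction x using Quotient.inductionOn with | h A => ?_
    induction y using Quotient.inductionOn with | h B => ?_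
    induction z using Quotient.inductionOn with | h C => ?_
    exact brauerClass_eq_of_algEquiv (Algebra.TensorProduct.assoc K K K A B C)
  zero_add x := by
    induction x using Quotient.inductionOn with | h A => ?_
    exact brauerClass_eq_of_algEquiv (Algebra.TensorProduct.lid K A)
  add_zero x := by
    induction x using Quotient.inductionOn with | h A => ?_
    exact brauerClass_eq_of_algEquiv (Algebra.TensorProduct.rid K K A)
  add_comm x y := by
    induction x using Quotient.inductionOn with | h A => ?_
    induction y using Quotient.inductionOn with | h B => ?_
    exact brauerClass_eq_of_algEquiv (Algebra.TensorProduct.comm K A B)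
  neg_add_cancel x := by
    induction x using Quotient.inductionOn with | h A => ?_
    have : NeZero (Module.finrank K A) := ⟨Module.finrank_pos.ne'⟩
    exact brauerClass_eq_of_matrix (A := (A : Type u)ᵐᵒᵖ ⊗[K] A) (B := K) (m := Unit)
      (n := Unit × Fin (Module.finrank K A))
      (((Algebra.TensorProduct.comm K (A : Type u)ᵐᵒᵖ A).trans (csaTensorOpEquiv A)).mapMatrix.trans
        (Matrix.compAlgEquiv Unit (Fin (Module.finrank K A)) K K))

theorem brauerClass_add (A B : Type u) [Ring A] [Algebra K A] [Algebra.IsCentral K A]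
    [IsSimpleRing A] [FiniteDimensional K A] [Ring B] [Algebra K B] [Algebra.IsCentral K B]
    [IsSimpleRing B] [FiniteDimensional K B] :
    brauerClass K A + brauerClass K B = brauerClass K (A ⊗[K] B) := rfl

theorem brauerClass_self : brauerClass K K = 0 := rfl

theorem brauerClass_op (A : Type u) [Ring A] [Algebra K A] [Algebra.IsCentral K A]
    [IsSimpleRing A] [FiniteDimensional K A] :
    brauerClass K Aᵐᵒᵖ = - brauerClass K A := rfl

/-- Extension of scalars on Brauer groups: the class of `A` is sent to that of `L ⊗ A`. -/
noncomputable def brauerBaseChange (K L : Type u) [Field K] [Field L] [Algebra K L] :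
    BrauerGroup.{u, u} K →+ BrauerGroup.{u, u} L where
  toFun := Quotient.map (sa := Brauer.CSA_Setoid.{u, u} K) (sb := Brauer.CSA_Setoid.{u, u} L)
    (fun A => { toAlgCat := AlgCat.of L (L ⊗[K] A) }) (by
      rintro A A' ⟨n, m, hn, hm, ⟨e⟩⟩
      have := NeZero.mk hn; have := NeZero.mk hm
      exact (brauerClass_eq_iff _ _).1 (brauerClass_eq_of_matrix
        ((Matrix.kroneckerTMulAlgEquiv Unit (Fin n) K L L A).symm.trans
        ((Algebra.TensorProduct.congr AlgEquiv.refl e).trans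
          (Matrix.kroneckerTMulAlgEquiv Unit (Fin m) K L L A')))))
  map_zero' := brauerClass_eq_of_algEquiv (Algebra.TensorProduct.rid K L L)
  map_add' x y := by
    induction x using Quotient.inductionOn with | h A => ?_
    induction y using Quotient.inductionOn with | h B => ?_
    refine brauerClass_eq_of_algEquiv (K := L) (A := L ⊗[K] (A ⊗[K] B))
      (B := (L ⊗[K] A) ⊗[L] (L ⊗[K] B)) ?_
    let f : A ⊗[K] B →ₐ[K] (L ⊗[K] A) ⊗[L] (L ⊗[K] B) :=
      Algebra.TensorProduct.lift
        (((Algebra.TensorProduct.includeLeft : L ⊗[K] A →ₐ[L] (L ⊗[K] A) ⊗[L] (L ⊗[K] B)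
          ).restrictScalars K).comp Algebra.TensorProduct.includeRight)
        (((Algebra.TensorProduct.includeRight : L ⊗[K] B →ₐ[L] (L ⊗[K] A) ⊗[L] (L ⊗[K] B)
          ).restrictScalars K).comp Algebra.TensorProduct.includeRight)
        (fun a b => by simp [commute_iff_eq])
    let g : L ⊗[K] (A ⊗[K] B) →ₐ[L] (L ⊗[K] A) ⊗[L] (L ⊗[K] B) :=
      Algebra.TensorProduct.lift (Algebra.ofId L _) f (fun l x => Algebra.commutes l (f x))
    have hg : Function.Injective g := g.toRingHom.injective
    exact AlgEquiv.ofBijective g ⟨hg,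
      (LinearMap.injective_iff_surjective_of_finrank_eq_finrank (f := g.toLinearMap) (by
        simp [Module.finrank_tensorProduct])).1 hg⟩

theorem brauerBaseChange_class (K L A : Type u) [Field K] [Field L] [Algebra K L] [Ring A]
    [Algebra K A] [Algebra.IsCentral K A] [IsSimpleRing A] [FiniteDimensional K A] :
    brauerBaseChange K L (brauerClass K A) = brauerClass L (L ⊗[K] A) := rfl

/-- The relative Brauer group `Br(L/K)`, the kernel of `Br K → Br L`. -/
noncomputable def relativeBrauerGroup (K L : Type u) [Field K] [Field L] [Algebra K L] :
    AddSubgroup (BrauerGroup.{u, u} K) :=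
  (brauerBaseChange K L).ker

/-- The `n`-torsion subgroup of the relative Brauer group `Br(L/K)`. -/
noncomputable def relativeBrauerTorsion (K L : Type u) [Field K] [Field L] [Algebra K L] (n : ℕ) :
    AddSubgroup (BrauerGroup.{u, u} K) :=
  relativeBrauerGroup K L ⊓ (nsmulAddMonoidHom n : BrauerGroup.{u, u} K →+ BrauerGroup.{u, u} K).ker

theorem mem_relativeBrauerTorsion {K L : Type u} [Field K] [Field L] [Algebra K L] {n : ℕ}
    {x : BrauerGroup.{u, u} K} :
    x ∈ relativeBrauerTorsion K L n ↔ brauerBaseChange K L x = 0 ∧ n • x = 0 := Iff.rfl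

/-- `A` is a cyclic algebra `(E/K, σ, b)`: there are a finite cyclic Galois extension `E/K` of some
degree `n` with Galois group generated by `σ`, and `b ∈ Kˣ`, such that `A` is generated by a copy
of `E` and an element `y` with `y ^ n = b` and `y * e = σ(e) * y` for `e ∈ E`, and
`1, y, …, y ^ (n - 1)` is a basis of `A` as a left `E`-vector space. -/
def IsCyclicAlgebra (K A : Type u) [Field K] [Ring A] [Algebra K A] : Prop :=
  ∃ (E : Type u) (_ : Field E) (_ : Algebra K E) (_ : FiniteDimensional K E) (_ : IsGalois K E)
    (σ : E ≃ₐ[K] E) (ι : E →ₐ[K] A) (b : K) (y : A),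
    (∀ τ : E ≃ₐ[K] E, τ ∈ Subgroup.zpowers σ) ∧
    b ≠ 0 ∧
    y ^ Module.finrank K E = algebraMap K A b ∧
    (∀ e : E, y * ι e = ι (σ e) * y) ∧
    ∀ a : A, ∃! c : Fin (Module.finrank K E) → E, a = ∑ i, ι (c i) * y ^ (i : ℕ)

/-- `x` is the Brauer class of a cyclic (central simple) algebra over `K`. -/
def IsCyclicBrauerClass {K : Type u} [Field K] (x : BrauerGroup.{u, u} K) : Prop :=
  ∃ A : CSA.{u, u} K, IsCyclicAlgebra K A ∧
    x = Quotient.mk (Brauer.CSA_Setoid.{u, u} K) A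

end Brauer

section Unramified

/-- For a discrete valuation ring `O` with fraction field `K` and an extension `L/K`: the integral
closure of `O` in `L` is unramified over `O`. For `O` complete and `L/K` finite separable this says
that `L/K` has ramification index one and separable residue field extension. -/
def IsUnramifiedExtension (O K L : Type*) [CommRing O] [Field K] [Algebra O K] [Field L]
    [Algebra K L] : Prop :=
  letI : Algebra O L := Algebra.compHom L (algebraMap O K)
  Algebra.FormallyUnramified O (integralClosure O L)

/-- The maximal unramified extension `K^{nr}` of `K` in a separable closure of `K`: the compositum
of all finite subextensions that are unramified with respect to `O`. -/
noncomputable def maximalUnramifiedExtension (O K : Type*) [CommRing O] [Field K] [Algebra O K] :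
    IntermediateField K (SeparableClosure K) :=
  ⨆ (L : IntermediateField K (SeparableClosure K)) (_ : FiniteDimensional K L)
    (_ : IsUnramifiedExtension O K L), L

end Unramified

/-! Let Ω be the maximal unramified extension, Γ = Gal(Ω/K), π a uniformizer of `O`, and l the
residue field of Ω. A class x in the p-torsion of Br(Ω/K) is given by a locally constant 2-cocycle α
of Γ in the units of Ω, and p x = 0 says that α^p = ∂g for some cochain g. Below, ∂ denotes the
coboundary and a symbol is a cocycle c^y, where c is Γ-invariant and y is the 2-cocycle of carries
of a character of Γ; the symbols with c in K are exactly what cyclic algebras give.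

Since Ω/K is unramified, every element of Ω is a power of π times a unit, compatibly with Γ.
Comparing valuations in α^p = ∂g shows that the valuation of g is a character modulo p whose carries
are the valuations of α. So the π-part of α is a symbol of order p with element π, and this is one
of the two cyclic classes (`exists_symbols`). What remains is a cocycle of units whose p-th power is
again a coboundary.

Its residue is a cocycle a in l with a^p = ∂g', and the heart of the proof is a cocycle version of
Albert's theorem in characteristic p: a is cohomologous to a single symbol
(`exists_symbol_of_pow_coboundary`). The field l is generated over l^p by Γ-invariant elements, so
a^p, a cocycle in M = l^p, becomes trivial in M(b₁, ..., b_r) with invariant b_i. The extension is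
removed one purely inseparable step of degree p at a time (`IsSymbolCochain.descend`). For a single
step M(v)/M, a coboundary with values in M is analysed through the derivation D with D v = v:
logarithmic derivatives give an additive 1-cocycle, additive Hilbert 90 splits it, and the p-power
identity characterising logarithmic derivatives turns the splitting into an Artin–Schreier character
(`exists_symbol_of_coboundary_mem`). Frobenius finally takes the result from a^p back to a.

The symbol over l lifts to K, because invariant residues lift to invariant integers. The quotient of
the unit cocycle by the lifted symbol has residue 1, and such cocycles are coboundaries by
successive approximation over a complete finite level (`exists_coboundary_of_principal_units`). All
additive vanishing used here rests on integers of trace one, which exist by unramifiedness and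
Dedekind's independence of characters. The passage between Brauer classes and cocycles is Galois
descent for matrix algebras. -/

/-! ### Additive cohomology of a compact group with locally constant cochains. -/

section LocallyConstantCochains

/-- A locally constant function on a product with a compact group is invariant under an open
subgroup in the group variable. -/
theorem IsLocallyConstant.exists_open_subgroup {Γ Y X : Type*} [Group Γ] [TopologicalSpace Γ]
    [IsTopologicalGroup Γ] [CompactSpace Γ] [TopologicalSpace Y] [CompactSpace Y]
    {f : Y × Γ → X} (hf : IsLocallyConstant f) :
    ∃ N : Subgroup Γ, IsOpen (N : Set Γ) ∧ ∀ y g, ∀ n ∈ N, f (y, g * n) = f (y, g) := by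
  refine ⟨{ carrier := {n | ∀ y g, f (y, g * n) = f (y, g)}
            mul_mem' := fun {a b} ha hb y g => by rw [← mul_assoc, hb, ha]
            one_mem' := fun y g => by rw [mul_one]
            inv_mem' := fun {a} ha y g => by
              have := ha y (g * a⁻¹)
              rw [inv_mul_cancel_right] at this
              exact this.symm }, ?_, fun y g n hn => hn y g⟩
  -- The complement of the group of right periods is the projection to `Γ` of this closed set, and
  -- the projection is a closed map because `Y × Γ` is compact.
  have hU : IsClosed {z : Γ × (Y × Γ) | f (z.2.1, z.2.2 * z.1) ≠ f z.2} := by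
    have h1 : IsLocallyConstant fun z : Γ × (Y × Γ) => f (z.2.1, z.2.2 * z.1) :=
      hf.comp_continuous (by fun_prop)
    have h2 : IsLocallyConstant fun z : Γ × (Y × Γ) => f z.2 := hf.comp_continuous (by fun_prop)
    simpa using ((h1.prodMk h2).comp fun w => w.1 ≠ w.2).isClosed_fiber True
  have := isClosedMap_fst_of_compactSpace (X := Γ) (Y := Y × Γ) _ hU
  rw [← isOpen_compl_iff] at this
  convert this using 1
  ext n
  simp

/-- A group action on a set with locally constant orbit maps. -/
class LocallyConstantSMul (Γ l : Type*) [TopologicalSpace Γ] [SMul Γ l] : Prop where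
  isLocallyConstant_smul : ∀ x : l, IsLocallyConstant fun g : Γ => g • x

theorem IsLocallyConstant.smul_of_continuous {Γ l Z : Type*} [TopologicalSpace Γ] [SMul Γ l]
    [LocallyConstantSMul Γ l] [TopologicalSpace Z] {φ : Z → Γ} (hφ : Continuous φ) {f : Z → l}
    (hf : IsLocallyConstant f) : IsLocallyConstant fun z => φ z • f z := by
  rw [IsLocallyConstant.iff_eventually_eq]
  intro z
  have h1 := hf.eventually_eq z
  have h2 := ((LocallyConstantSMul.isLocallyConstant_smul (Γ := Γ) (f z)).comp_continuous
    hφ).eventually_eq z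
  filter_upwards [h1, h2] with w hw1 hw2
  rw [hw1]
  exact hw2

theorem IsLocallyConstant.finset_sum {Z l ι : Type*} [TopologicalSpace Z] [AddCommMonoid l]
    (s : Finset ι) {f : ι → Z → l} (hf : ∀ i, IsLocallyConstant (f i)) :
    IsLocallyConstant fun z => ∑ i ∈ s, f i z := by
  classical
  induction s using Finset.induction_on with
  | empty => exact IsLocallyConstant.const 0
  | insert a s ha ih =>
    simp only [Finset.sum_insert ha]
    exact (hf a).add ih

theorem finite_quotient_of_isOpen {Γ : Type*} [Group Γ] [TopologicalSpace Γ]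
    [IsTopologicalGroup Γ] [CompactSpace Γ] (N : Subgroup Γ) (hN : IsOpen (N : Set Γ)) :
    Finite (Γ ⧸ N) := Subgroup.quotient_finite_of_isOpen N hN

/-- Summing a right `N`-invariant function over representatives of `Γ ⧸ N` is invariant under left
translation. -/
theorem sum_out_mul_left {Γ l : Type*} [Group Γ] [AddCommMonoid l] (N : Subgroup Γ)
    [Fintype (Γ ⧸ N)] (F : Γ → l) (hF : ∀ g, ∀ n ∈ N, F (g * n) = F g) (g : Γ) :
    ∑ q : Γ ⧸ N, F (g * q.out) = ∑ q : Γ ⧸ N, F q.out := by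
  rw [← Equiv.sum_comp (MulAction.toPerm g) fun q : Γ ⧸ N => F q.out]
  refine Finset.sum_congr rfl fun q _ => ?_
  obtain ⟨n, hn⟩ := QuotientGroup.mk_out_eq_mul N (g * q.out)
  have h : (MulAction.toPerm g q : Γ ⧸ N) = ((g * q.out : Γ) : Γ ⧸ N) := by
    conv_lhs => rw [← QuotientGroup.out_eq' q]
    rfl
  rw [h, hn, hF _ _ n.2]

variable {Γ l : Type*} [Group Γ] [TopologicalSpace Γ] [Field l] [MulSemiringAction Γ l]

variable (Γ) in
/-- Every open subgroup `N` fixes an element of `M` whose trace over `Γ ⧸ N` is one. -/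
def HasTraceOne (M : Subfield l) : Prop :=
  ∀ N : Subgroup Γ, IsOpen (N : Set Γ) →
    ∃ t ∈ M, (∀ n ∈ N, n • t = t) ∧ ∑ᶠ q : Γ ⧸ N, q.out • t = 1

variable [IsTopologicalGroup Γ] [CompactSpace Γ]

/-- Frobenius is additive and commutes with `Γ`, so the p-th power of an element of trace one has
trace one and lies in `M`. -/
theorem HasTraceOne.of_pow_mem {p : ℕ} [Fact p.Prime] [CharP l p] (h : HasTraceOne Γ (⊤ : Subfield l))
    {M : Subfield l} (hM : ∀ x, x ^ p ∈ M) : HasTraceOne Γ M := by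
  intro N hN
  obtain ⟨t, -, ht, h1⟩ := h N hN
  have := finite_quotient_of_isOpen N hN
  have := Fintype.ofFinite (Γ ⧸ N)
  refine ⟨t ^ p, hM t, fun n hn => by rw [smul_pow', ht n hn], ?_⟩
  rw [finsum_eq_sum_of_fintype] at h1 ⊢
  simp_rw [smul_pow']
  rw [← sum_pow_char, h1, one_pow]

/-- Additive Hilbert 90 for locally constant cocycles. -/
theorem exists_smul_sub_of_additive_cocycle {M : Subfield l} (hT : HasTraceOne Γ M)
    (hM : ∀ (s : Γ), ∀ x ∈ M, s • x ∈ M) {h : Γ → l} (hlc : IsLocallyConstant h)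
    (hhM : ∀ s, h s ∈ M) (hc : ∀ s t, h (s * t) = h s + s • h t) :
    ∃ m ∈ M, ∀ s, h s = s • m - m := by
  obtain ⟨N, hN, hinv⟩ := IsLocallyConstant.exists_open_subgroup (Y := Unit)
    (f := fun z : Unit × Γ => h z.2) (hlc.comp_continuous continuous_snd)
  replace hinv := hinv ()
  obtain ⟨t, htM, ht, h1⟩ := hT N hN
  have := finite_quotient_of_isOpen N hN
  have := Fintype.ofFinite (Γ ⧸ N)
  rw [finsum_eq_sum_of_fintype] at h1
  -- The Poincaré sum: by the cocycle identity, applying `s` permutes the terms up to `h s` times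
  -- the trace of `t`, which is one.
  refine ⟨-∑ q : Γ ⧸ N, h q.out * q.out • t,
    M.neg_mem (M.sum_mem fun q _ => M.mul_mem (hhM _) (hM _ _ htM)), fun s => ?_⟩
  have key := sum_out_mul_left N (fun g => h g * g • t)
    (fun g n hn => by simp only [hinv g n hn, mul_smul, ht n hn]) s
  have h2 : ∀ q : Γ ⧸ N, s • (h q.out * q.out • t) =
      h (s * q.out) * (s * q.out) • t - h s * s • q.out • t := fun q => by
    rw [smul_mul', hc, mul_smul]; ring
  rw [smul_neg, Finset.smul_sum, Finset.sum_congr rfl fun q _ => h2 q, Finset.sum_sub_distrib, key,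
    ← Finset.mul_sum, ← Finset.smul_sum, h1, smul_one]
  ring

/-- The vanishing of the second cohomology of the additive group, for locally constant cocycles. -/
theorem exists_coboundary_of_additive_two_cocycle [LocallyConstantSMul Γ l]
    (hT : HasTraceOne Γ (⊤ : Subfield l)) {c : Γ → Γ → l}
    (hlc : IsLocallyConstant fun z : Γ × Γ => c z.1 z.2)
    (hc : ∀ s g t, s • c g t + c s (g * t) = c (s * g) t + c s g) :
    ∃ m : Γ → l, IsLocallyConstant m ∧ ∀ s t, c s t = m s + s • m t - m (s * t) := by
  obtain ⟨N, hN, hinv⟩ := hlc.exists_open_subgroup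
  obtain ⟨t, -, ht, h1⟩ := hT N hN
  have := finite_quotient_of_isOpen N hN
  have := Fintype.ofFinite (Γ ⧸ N)
  rw [finsum_eq_sum_of_fintype] at h1
  -- The two-variable Poincaré sum: the second variable is averaged against the conjugates of `t`,
  -- and the cocycle identity leaves `c s g` times the trace of `t`.
  refine ⟨fun s => ∑ q : Γ ⧸ N, c s q.out * (s * q.out) • t,
    IsLocallyConstant.finset_sum _ fun q => ?_, fun s g => ?_⟩
  · refine IsLocallyConstant.mul
      (hlc.comp_continuous (f := fun s => (s, q.out)) (by fun_prop)) ?_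
    exact IsLocallyConstant.smul_of_continuous (by fun_prop) (IsLocallyConstant.const t)
  have key := sum_out_mul_left N (fun h => c s h * (s * h) • t)
    (fun h n hn => by simp only [hinv s h n hn, ← mul_assoc, mul_smul _ n, ht n hn]) g
  beta_reduce at key ⊢
  rw [← key, Finset.smul_sum, ← Finset.sum_add_distrib, ← Finset.sum_sub_distrib]
  have h2 : ∀ q : Γ ⧸ N, c s (g * q.out) * (s * (g * q.out)) • t +
      s • (c g q.out * (g * q.out) • t) - c (s * g) q.out * (s * g * q.out) • t =
      c s g * (s * g) • q.out • t := fun q => by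
    rw [smul_mul', ← mul_smul, ← mul_smul, ← mul_assoc, ← add_mul, ← sub_mul, add_comm, hc]; ring
  rw [Finset.sum_congr rfl fun q _ => h2 q, ← Finset.mul_sum, ← Finset.smul_sum, h1, smul_one,
    mul_one]

end LocallyConstantCochains

/-! ### p-th powers of sums of noncommuting operators in characteristic p. -/

section Jacobson

open Polynomial

attribute [local instance] LieRing.ofAssociativeRing LieAlgebra.ofAssociativeAlgebra

/-- In characteristic `p`, `d (x ^ p) = (ad x) ^ (p - 1) (d x)` for every derivation `d` of a
noncommutative ring. -/
theorem derivation_pow_char {p : ℕ} [Fact p.Prime] {S : Type*} [Ring S] [Algebra (ZMod p) S]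
    [Nontrivial S] (d : S →ₗ[ZMod p] S) (hd : ∀ x y, d (x * y) = d x * y + x * d y) (x : S) :
    d (x ^ p) = (LieAlgebra.ad (ZMod p) S x ^ (p - 1)) (d x) := by
  -- In `End S` one has `⁅L y, d⁆ = -L (d y)`. Since `ad` is a difference of commuting left and
  -- right multiplications, `ad (L x) ^ p = ad (L (x ^ p))`. Both sides are applied to `d` and then
  -- evaluated at 1.
  let L : S →ₐ[ZMod p] Module.End (ZMod p) S := Algebra.lmul (ZMod p) S
  have hbr : ∀ y, ⁅L y, d⁆ = -L (d y) := fun y => LinearMap.ext fun z => by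
    change y * d z - d (y * z) = -(d y * z)
    rw [hd]
    abel
  have hLL : ∀ y z, ⁅L y, L z⁆ = L ⁅y, z⁆ := fun y z => by simp [Ring.lie_def]
  have hn : ∀ n z, (LieAlgebra.ad (ZMod p) (Module.End (ZMod p) S) (L x) ^ n) (L z) =
      L ((LieAlgebra.ad (ZMod p) S x ^ n) z) := by
    intro n
    induction n with
    | zero => intro z; simp
    | succ n ih =>
      intro z
      rw [pow_succ, pow_succ, Module.End.mul_apply, Module.End.mul_apply, LieAlgebra.ad_apply,
        LieAlgebra.ad_apply, hLL, ih]
  have hp : LieAlgebra.ad (ZMod p) (Module.End (ZMod p) S) (L x) ^ p = LieAlgebra.ad (ZMod p) (Module.End (ZMod p) S) (L x ^ p) := by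
    have : CharP (Module.End (ZMod p) (Module.End (ZMod p) S)) p :=
      charP_of_injective_algebraMap (algebraMap (ZMod p) _).injective p
    rw [LieAlgebra.ad_eq_lmul_left_sub_lmul_right, Pi.sub_apply, Pi.sub_apply,
      sub_pow_char_of_commute p (LinearMap.commute_mulLeft_right (L x) (L x)),
      LinearMap.pow_mulLeft, LinearMap.pow_mulRight]
  have h1 := congrArg (fun f => f d 1) hp
  have hpow : LieAlgebra.ad (ZMod p) (Module.End (ZMod p) S) (L x) ^ p =
      LieAlgebra.ad (ZMod p) (Module.End (ZMod p) S) (L x) ^ (p - 1) *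
        LieAlgebra.ad (ZMod p) (Module.End (ZMod p) S) (L x) := by
    rw [← pow_succ, Nat.sub_add_cancel (Fact.out : p.Prime).one_le]
  rw [hpow] at h1
  simp only [Module.End.mul_apply, LieAlgebra.ad_apply, ← map_pow, hbr, map_neg, hn] at h1
  simpa [L] using h1.symm

/-- A special case of Jacobson's formula for `(a + b) ^ p` in characteristic `p`. -/
theorem add_pow_char_of_commute_ad {p : ℕ} [Fact p.Prime] {A : Type*} [Ring A] [Algebra (ZMod p) A]
    [Nontrivial A] (a b : A) (h : ∀ i, Commute b ((LieAlgebra.ad (ZMod p) A a ^ i) b)) :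
    (a + b) ^ p = a ^ p + b ^ p + (LieAlgebra.ad (ZMod p) A a ^ (p - 1)) b := by
  have : CharP A p := charP_of_injective_algebraMap (algebraMap (ZMod p) _).injective p
  have hp := (Fact.out : p.Prime)
  let x : A[X] := C a + C b * X
  have had : ∀ i, (LieAlgebra.ad (ZMod p) A[X] x ^ i) (C b) =
      C ((LieAlgebra.ad (ZMod p) A a ^ i) b) := by
    intro i
    induction i with
    | zero => simp
    | succ i ih =>
      rw [pow_succ', pow_succ', Module.End.mul_apply, Module.End.mul_apply, ih,
        LieAlgebra.ad_apply, LieAlgebra.ad_apply, Ring.lie_def, Ring.lie_def]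
      generalize hy : (LieAlgebra.ad (ZMod p) A a ^ i) b = y
      have h1 : x * C y = C (a * y) + C (b * y) * X := by
        simp only [x, add_mul, mul_assoc, X_mul_C, C_mul]
      have h2 : C y * x = C (y * a) + C (y * b) * X := by
        simp only [x, mul_add, ← mul_assoc, C_mul]
      rw [h1, h2, ← hy, (h i).eq, map_sub]
      abel
  have hder : derivative (x ^ p) = C ((LieAlgebra.ad (ZMod p) A a ^ (p - 1)) b) := by
    have := derivation_pow_char (p := p) (S := A[X])
      ((derivative : A[X] →ₗ[A] A[X]).restrictScalars (ZMod p)) (fun f g => by simp) x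
    rw [LinearMap.restrictScalars_apply, LinearMap.restrictScalars_apply] at this
    rw [this, ← had]
    simp [x]
  have hc : ∀ i, (x ^ p).coeff (i + 1) * ((i : A) + 1) =
      if i = 0 then (LieAlgebra.ad (ZMod p) A a ^ (p - 1)) b else 0 := fun i => by
    rw [← coeff_derivative, hder, coeff_C]
  have hdx : x.natDegree ≤ 1 := by
    simp only [x]
    compute_degree
  have hdeg : (x ^ p).natDegree ≤ p := by
    simpa using natDegree_pow_le_of_le p hdx
  have hx0 : (x ^ p).coeff 0 = a ^ p := by
    have : ∀ n, (x ^ n).coeff 0 = a ^ n := fun n => by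
      induction n with
      | zero => simp
      | succ n ih => rw [pow_succ, pow_succ, mul_coeff_zero, ih]; simp [x]
    exact this p
  have hxp : (x ^ p).coeff p = b ^ p := by
    have := coeff_pow_of_natDegree_le (m := p) (n := 1) hdx
    rw [mul_one] at this
    rw [this]
    simp [x]
  let ev : A[X] →+* A := eval₂RingHom' (RingHom.id A) 1 fun a => Commute.one_right a
  have hev : ∀ f : A[X], ev f = f.eval 1 := fun f => rfl
  have h1 : (a + b) ^ p = ev (x ^ p) := by
    rw [map_pow, hev]
    simp [x]
  rw [h1, hev, eval_eq_sum_range' (Nat.lt_succ_of_le hdeg)]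
  simp only [one_pow, mul_one]
  rw [Finset.sum_range_succ, hxp]
  obtain ⟨m, rfl⟩ : ∃ m, p = m + 2 := ⟨p - 2, by have := hp.two_le; omega⟩
  rw [Finset.sum_range_succ', Finset.sum_range_succ', hx0, Finset.sum_eq_zero, zero_add]
  · have := hc 0
    simp only [Nat.cast_zero, zero_add, mul_one, if_true] at this
    rw [zero_add, this]
    abel
  · intro i hi
    have h2 := hc (i + 1)
    rw [if_neg (Nat.succ_ne_zero i)] at h2
    have h3 : ((i : ZMod (m + 2)) + 1 + 1) ≠ 0 := by
      have : ((i + 2 : ℕ) : ZMod (m + 2)) ≠ 0 := by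
        rw [Ne, ZMod.natCast_eq_zero_iff]
        intro hdvd
        have := Nat.le_of_dvd (by omega) hdvd
        have := Finset.mem_range.1 hi
        omega
      push_cast at this
      convert this using 1
      ring
    have h4 : (((i + 1 : ℕ) : A) + 1) = algebraMap (ZMod (m + 2)) A ((i : ZMod (m + 2)) + 1 + 1) := by
      simp
    rw [h4, ← Algebra.commutes, ← Algebra.smul_def] at h2
    exact (smul_eq_zero_iff_right h3).1 h2

/-- Hochschild's formula for the `p`-th power of the sum of a derivation and a multiplication
operator in characteristic `p`. -/
theorem Derivation.add_lmul_pow_char {p : ℕ} [Fact p.Prime] {R : Type*} [CommRing R]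
    [Algebra (ZMod p) R] [Nontrivial R] (D : Derivation (ZMod p) R R) (h x : R) :
    (((D : R →ₗ[ZMod p] R) + Algebra.lmul (ZMod p) R h : Module.End (ZMod p) R) ^ p) x =
      D^[p] x + (h ^ p + D^[p - 1] h) * x := by
  -- Bracketing with `D` turns multiplication by `h` into multiplication by `D h`; multiplication
  -- operators commute, so the special case of Jacobson's formula applies.
  have had : ∀ i, (LieAlgebra.ad (ZMod p) (Module.End (ZMod p) R) (D : R →ₗ[ZMod p] R) ^ i)
      (Algebra.lmul (ZMod p) R h) = Algebra.lmul (ZMod p) R (D^[i] h) := by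
    intro i
    induction i with
    | zero => simp
    | succ i ih =>
      rw [pow_succ', Module.End.mul_apply, ih, LieAlgebra.ad_apply, Ring.lie_def]
      ext y
      simp only [Function.iterate_succ', Function.comp_apply, LinearMap.sub_apply,
        Module.End.mul_apply, Algebra.coe_lmul_eq_mul, LinearMap.mul_apply', Derivation.coeFn_coe,
        Derivation.leibniz, smul_eq_mul]
      ring
  rw [add_pow_char_of_commute_ad, had, LinearMap.add_apply, LinearMap.add_apply, ← map_pow,
    Module.End.pow_apply]
  · simp only [Algebra.coe_lmul_eq_mul, LinearMap.mul_apply', Derivation.coeFn_coe]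
    ring
  · intro i
    rw [had, commute_iff_eq, ← map_mul, ← map_mul, mul_comm]

end Jacobson

/-! ### The Euler derivation of a purely inseparable extension of degree p and its logarithmic
derivatives. -/

section InseparableDerivation

open Polynomial

variable {p : ℕ} [Fact p.Prime] {M E : Type*} [Field M] [Field E] [Algebra M E] [CharP M p]

/-- By injectivity of Frobenius, a p-th root of `a` in `M` would be `v` itself; hence X^p - a is
irreducible. -/
theorem minpoly_of_pow_char_mem {v : E} {a : M} (hv : v ^ p = algebraMap M E a)
    (hvM : v ∉ Set.range (algebraMap M E)) : minpoly M v = X ^ p - C a := by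
  have hp : p.Prime := Fact.out
  have : CharP E p := charP_of_injective_algebraMap (algebraMap M E).injective p
  refine (minpoly.eq_of_irreducible_of_monic (X_pow_sub_C_irreducible_of_prime hp fun b hb => ?_)
    (by simp [hv]) (monic_X_pow_sub_C a hp.ne_zero)).symm
  refine hvM ⟨b, frobenius_inj E p ?_⟩
  rw [frobenius_def, frobenius_def, hv, ← map_pow, hb]

/-- For a purely inseparable extension `E = M(v)` of degree `p`, there is an `M`-derivation of `E`
with `D v = v`. -/
theorem exists_derivation_apply_eq_self {v : E} {a : M} (hv : v ^ p = algebraMap M E a)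
    (hvM : v ∉ Set.range (algebraMap M E)) (htop : Algebra.adjoin M {v} = ⊤) :
    ∃ D : Derivation M E E, D v = v := by
  have hs : Function.Surjective (aeval (R := M) v) := by
    rw [← AlgHom.range_eq_top, ← Algebra.adjoin_singleton_eq_range_aeval, htop]
  -- X·d/dX kills X^p - a in characteristic p, so it preserves the ideal of the minimal polynomial
  -- and descends to `E`.
  let d : Derivation M M[X] M[X] := (X : M[X]) • Polynomial.derivative'
  have hd : ∀ P, aeval v P = 0 → aeval v (d P) = 0 := by
    intro P hP
    obtain ⟨Q, rfl⟩ := minpoly.dvd M v hP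
    rw [minpoly_of_pow_char_mem hv hvM]
    simp [d, derivative_X_pow, hv]
  exact ⟨Derivation.liftOfSurjective hs hd, by
    simpa [d] using Derivation.liftOfSurjective_apply hs hd X⟩

variable {v : E} {a : M} {D : Derivation M E E}

/-- The powers v^j span `E` and are eigenvectors of `D` whose eigenvalues j lie in the prime field,
where j^p = j. -/
theorem Derivation.iterate_char_eq_self (htop : Algebra.adjoin M {v} = ⊤) (hD : D v = v) (x : E) :
    D^[p] x = D x := by
  have : CharP E p := charP_of_injective_algebraMap (algebraMap M E).injective p
  have hs : Function.Surjective (aeval (R := M) v) := by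
    rw [← AlgHom.range_eq_top, ← Algebra.adjoin_singleton_eq_range_aeval, htop]
  have hv : ∀ n j : ℕ, D^[n] (v ^ j) = (j : E) ^ n * v ^ j := by
    intro n j
    have h1 : D (v ^ j) = (j : E) * v ^ j := by
      rcases j with _ | j
      · simp
      · rw [D.leibniz_pow, hD, Nat.add_sub_cancel, nsmul_eq_mul, smul_eq_mul, pow_succ]
    induction n with
    | zero => simp
    | succ n ih =>
      rw [Function.iterate_succ_apply', ih, D.leibniz, h1]
      have : D ((j : E) ^ n) = 0 := by
        rw [← Nat.cast_pow]; exact D.map_natCast _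
      rw [this]
      simp only [smul_eq_mul]
      ring
  have hlin : ((D : E →ₗ[M] E) ^ p : Module.End M E) = (D : E →ₗ[M] E) := by
    refine LinearMap.ext fun y => ?_
    obtain ⟨P, rfl⟩ := hs y
    induction P using Polynomial.induction_on' with
    | add P Q hP hQ => rw [map_add, map_add, map_add, hP, hQ]
    | monomial j c =>
      rw [aeval_monomial, ← Algebra.smul_def, LinearMap.map_smul, LinearMap.map_smul,
        Module.End.pow_apply]
      have h1 := hv 1 j
      rw [Function.iterate_one, pow_one] at h1
      have h2 : ((j : E)) ^ p = j := by
        have := _root_.map_natCast (frobenius E p) j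
        rwa [frobenius_def] at this
      change c • D^[p] (v ^ j) = c • D (v ^ j)
      rw [hv, h2, h1]
  have := congrArg (fun f => f x) hlin
  rwa [Module.End.pow_apply] at this

/-- If x = Q(v) with deg Q < p, then D x = Q'(v) v. So Q' = 0, its degree being too small to vanish
at v otherwise, and Q is constant because the degrees 1, ..., p - 1 are invertible. Thus the
constants of `D` are exactly `M`. -/
theorem Derivation.mem_range_of_apply_eq_zero (hv : v ^ p = algebraMap M E a)
    (hvM : v ∉ Set.range (algebraMap M E)) (htop : Algebra.adjoin M {v} = ⊤) (hD : D v = v)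
    {x : E} (hx : D x = 0) : x ∈ Set.range (algebraMap M E) := by
  have hp : p.Prime := Fact.out
  have hv0 : v ≠ 0 := fun h => hvM ⟨0, by simp [h]⟩
  have hs : Function.Surjective (aeval (R := M) v) := by
    rw [← AlgHom.range_eq_top, ← Algebra.adjoin_singleton_eq_range_aeval, htop]
  obtain ⟨P, rfl⟩ := hs x
  have hmin := minpoly_of_pow_char_mem hv hvM
  have hmon : (X ^ p - C a : M[X]).Monic := monic_X_pow_sub_C a hp.ne_zero
  obtain ⟨Q, hQd, hQ⟩ : ∃ Q : M[X], Q.degree < p ∧ aeval v Q = aeval v P := by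
    refine ⟨P %ₘ (X ^ p - C a), ?_, ?_⟩
    · have := degree_modByMonic_lt P hmon
      rwa [degree_X_pow_sub_C hp.pos] at this
    · conv_rhs => rw [← modByMonic_add_div P (X ^ p - C a)]
      simp [hv]
  rw [← hQ] at hx ⊢
  rw [D.map_aeval, hD, smul_eq_mul, mul_eq_zero, or_iff_left hv0] at hx
  have hder : derivative Q = 0 := by
    by_contra hne
    have h1 := minpoly.degree_le_of_ne_zero M v hne hx
    rw [hmin, degree_X_pow_sub_C hp.pos] at h1
    exact absurd (lt_of_le_of_lt (degree_derivative_le) hQd) (not_lt.2 h1)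
  have hQc : Q = C (Q.coeff 0) := by
    ext i
    rw [coeff_C]
    split_ifs with hi
    · rw [hi]
    · obtain ⟨j, rfl⟩ := Nat.exists_eq_succ_of_ne_zero hi
      rcases lt_or_ge (j + 1) p with hj | hj
      · have h1 := congrArg (fun R => R.coeff j) hder
        simp only [coeff_derivative, coeff_zero, mul_eq_zero] at h1
        refine h1.resolve_right fun h2 => ?_
        have h3 : ((j + 1 : ℕ) : M) = 0 := by push_cast; exact h2
        rw [CharP.cast_eq_zero_iff M p] at h3
        exact absurd (Nat.le_of_dvd (Nat.succ_pos j) h3) (not_le.2 hj)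
      · exact coeff_eq_zero_of_degree_lt (lt_of_lt_of_le hQd (by exact_mod_cast hj))
  rw [hQc, aeval_C]
  exact ⟨_, rfl⟩

variable (p) in
theorem prod_X_sub_C_zmod : (∏ i : ZMod p, (X - C i) : (ZMod p)[X]) = X ^ p - X := by
  have hp : p.Prime := Fact.out
  have hr := FiniteField.roots_X_pow_card_sub_X (ZMod p)
  have hd := FiniteField.X_pow_card_sub_X_natDegree_eq (ZMod p) hp.one_lt
  rw [ZMod.card] at hr
  have hm : (X ^ p - X : (ZMod p)[X]).Monic := by
    refine monic_X_pow_sub (n := p) ?_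
    rw [degree_X]
    exact_mod_cast hp.one_lt
  have := prod_multiset_X_sub_C_of_monic_of_roots_card_eq hm (by
    rw [hr, hd, Finset.card_val, Finset.card_univ, ZMod.card])
  rw [← this, hr]
  rfl

/-- In characteristic `p`, `x ^ p - x` is the product of the `x - i` over the prime field. -/
theorem prod_sub_zmod (R : Type*) [CommRing R] [Algebra (ZMod p) R] (x : R) :
    ∏ i : ZMod p, (x - algebraMap (ZMod p) R i) = x ^ p - x := by
  have := congrArg (aeval x) (prod_X_sub_C_zmod p)
  simpa [map_prod] using this

theorem exists_intCast_of_pow_char_eq_self [CharP E p] {x : E} (hx : x ^ p = x) :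
    ∃ n : ℤ, (n : E) = x := by
  let _ : Algebra (ZMod p) E := ZMod.algebra E p
  have h := prod_sub_zmod (p := p) E x
  rw [hx, sub_self, Finset.prod_eq_zero_iff] at h
  obtain ⟨i, -, hi⟩ := h
  obtain ⟨n, rfl⟩ := ZMod.intCast_surjective i
  exact ⟨n, by rw [sub_eq_zero] at hi; simp [hi]⟩

/-- With h = D f / f, the operator D + h is the conjugate of D by multiplication by f. Hence its
p-th power is the conjugate of D^p = D, and Hochschild's formula for that power, evaluated at 1,
gives the identity. -/
theorem Derivation.logDeriv_pow_char (htop : Algebra.adjoin M {v} = ⊤) (hD : D v = v) {f : E}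
    (hf : f ≠ 0) : (D f / f) ^ p + D^[p - 1] (D f / f) = D f / f := by
  have hchar : CharP E p := charP_of_injective_algebraMap (algebraMap M E).injective p
  let _ : Algebra (ZMod p) E := ZMod.algebra E p
  have hp : p.Prime := Fact.out
  let D' : Derivation (ZMod p) E E := Derivation.mk' (D.toLinearMap.toAddMonoidHom.toZModLinearMap p)
    fun x y => D.leibniz x y
  have hD' : ∀ x, D' x = D x := fun x => rfl
  have hit : ∀ n x, D'^[n] x = D^[n] x := fun n x => rfl
  set h := D f / f with hh
  have hconj : ∀ n x, (((D' : E →ₗ[ZMod p] E) + Algebra.lmul (ZMod p) E h : Module.End (ZMod p) E)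
      ^ n) x = D^[n] (f * x) / f := by
    intro n
    induction n with
    | zero => intro x; simp [hf]
    | succ n ih =>
      intro x
      rw [pow_succ, Module.End.mul_apply, ih, Function.iterate_succ_apply]
      congr 2
      change f * (D x + h * x) = D (f * x)
      rw [D.leibniz, hh, smul_eq_mul, smul_eq_mul]
      field_simp
      try ring
  have key := D'.add_lmul_pow_char h 1
  rw [hconj, mul_one, iterate_char_eq_self htop hD, hit, iterate_char_eq_self htop hD, hit] at key
  simpa using key.symm

/-- The characterization of logarithmic derivatives in `M(v)` with respect to `D v = v`. -/
theorem Derivation.exists_logDeriv_eq (hvM : v ∉ Set.range (algebraMap M E)) (htop : Algebra.adjoin M {v} = ⊤) (hD : D v = v) {m : E}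
    (hm : m ^ p + D^[p - 1] m = m) : ∃ r ≠ 0, D r = m * r := by
  have hchar : CharP E p := charP_of_injective_algebraMap (algebraMap M E).injective p
  let _ : Algebra (ZMod p) E := ZMod.algebra E p
  have hp : p.Prime := Fact.out
  have hv0 : v ≠ 0 := fun h => hvM ⟨0, by simp [h]⟩
  let D' : Derivation (ZMod p) E E := Derivation.mk' (D.toLinearMap.toAddMonoidHom.toZModLinearMap p)
    fun x y => D.leibniz x y
  -- A nonzero kernel vector of T = D - m is wanted. By Hochschild's formula the condition on `m`
  -- says T^p = T, so the product of the T - i over the prime field is zero. Multiplication by v^n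
  -- conjugates T into T - n, so injectivity of T would make every factor injective.
  let T : Module.End (ZMod p) E := (D' : E →ₗ[ZMod p] E) + Algebra.lmul (ZMod p) E (-m)
  have hT : ∀ x, T x = D x - m * x := fun x => by
    change D x + (-m) * x = _
    ring
  have hneg : ∀ n, D'^[n] (-m) = -D^[n] m := fun n => by
    change D^[n] (-m) = _
    exact Function.Semiconj.iterate_right (f := Neg.neg) (fun x => (D.map_neg x).symm) n m |>.symm
  have hTp : T ^ p = T := by
    refine LinearMap.ext fun x => ?_
    rw [D'.add_lmul_pow_char (-m) x, hneg, hT]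
    have h2 : (-m) ^ p = -m ^ p := by
      have := sub_pow_char (0 : E) m (p := p)
      simpa [hp.ne_zero] using this
    change D^[p] x + _ = _
    rw [iterate_char_eq_self htop hD, h2, ← neg_add, hm]
    ring
  by_contra! hcon
  have hinj : ∀ x, T x = 0 → x = 0 := fun x hx => by
    by_contra h0
    rw [hT, sub_eq_zero] at hx
    exact hcon x h0 hx
  have hinj' : ∀ (n : ℕ) x, (T - algebraMap (ZMod p) (Module.End (ZMod p) E) (n : ZMod p)) x = 0 →
      x = 0 := by
    intro n x hx
    have h1 : T (x * (v ^ n)⁻¹) = 0 := by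
      have h3 : D (v ^ n) = (n : E) * v ^ n := by
        rcases n with _ | n
        · simp
        · rw [D.leibniz_pow, hD, Nat.add_sub_cancel, nsmul_eq_mul, smul_eq_mul, pow_succ]
      have h4 : T x = n * x := by
        rw [LinearMap.sub_apply, sub_eq_zero] at hx
        rw [hx]
        simp [Algebra.smul_def]
      rw [hT] at h4 ⊢
      rw [D.leibniz, D.leibniz_inv, h3]
      have hvn := pow_ne_zero n hv0
      have h5 : D x = n * x + m * x := by rw [← h4]; ring
      simp only [smul_eq_mul, h5]
      field_simp
      ring
    have := hinj _ h1
    simpa [hv0] using this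
  have hprod : (aeval T (∏ i : ZMod p, (X - C i) : (ZMod p)[X])) = 0 := by
    rw [prod_X_sub_C_zmod]
    simp [hTp]
  have hind : ∀ (s : Finset (ZMod p)) (x : E),
      aeval T (∏ i ∈ s, (X - C i) : (ZMod p)[X]) x = 0 → x = 0 := by
    intro s
    induction s using Finset.induction_on with
    | empty => intro x hx; simpa using hx
    | insert i s hi ih =>
      intro x hx
      rw [Finset.prod_insert hi, map_mul, Module.End.mul_apply] at hx
      refine ih x ?_
      obtain ⟨n, rfl⟩ := ZMod.natCast_zmod_surjective i
      refine hinj' n _ ?_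
      simpa only [map_sub, aeval_X, aeval_C] using hx
  exact one_ne_zero (hind Finset.univ (1 : E) (by rw [hprod]; rfl))

end InseparableDerivation

/-! ### One purely inseparable step: coboundaries of M(v) with values in M. -/

section DegreeP

open Polynomial IntermediateField

variable {p : ℕ} [Fact p.Prime] {Γ l : Type*} [Group Γ] [Field l] [CharP l p]
  [MulSemiringAction Γ l]

theorem smul_mem_adjoin_simple {M : Subfield l} (hMs : ∀ s : Γ, ∀ x ∈ M, s • x ∈ M) {v : l}
    (hv : ∀ s : Γ, s • v = v) (s : Γ) {x : l} (hx : x ∈ adjoin M {v}) : s • x ∈ adjoin M {v} := by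
  have : (adjoin M {v}).toSubfield ≤
      (adjoin M {v}).toSubfield.comap (MulSemiringAction.toRingHom Γ l s) := by
    rw [adjoin_toSubfield, Subfield.closure_le]
    rintro y (⟨z, rfl⟩ | rfl)
    · exact Subfield.subset_closure (Or.inl ⟨⟨s • (z : l), hMs s z z.2⟩, rfl⟩)
    · change s • y ∈ Subfield.closure _
      rw [hv]
      exact Subfield.subset_closure (Or.inr rfl)
  exact this hx

theorem adjoin_gen_eq_top {M : Subfield l} {v : l} (hv : IsIntegral M v) :
    Algebra.adjoin M {AdjoinSimple.gen M v} = ⊤ := by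
  have := (adjoin.powerBasis hv).adjoin_gen_eq_top
  rwa [adjoin.powerBasis_gen] at this

variable [TopologicalSpace Γ] [IsTopologicalGroup Γ] [CompactSpace Γ] [LocallyConstantSMul Γ l]

/-- A two-cocycle with values in `M` that becomes trivial in `M(v)`, where `v ^ p ∈ M`, is
cohomologous to the cocycle attached to `v ^ p` and a character of order `p`. -/
theorem exists_symbol_of_coboundary_mem {M : Subfield l} (hMp : ∀ x : l, x ^ p ∈ M)
    (hMs : ∀ s : Γ, ∀ x ∈ M, s • x ∈ M) {v : l} (hvM : v ∉ M) (hv : ∀ s : Γ, s • v = v)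
    (hT : HasTraceOne Γ (⊤ : Subfield l)) (hAS : ∀ a : l, ∃ x, x ^ p - x = a) {g : Γ → l}
    (hg : IsLocallyConstant g) (hg0 : ∀ s, g s ≠ 0) (hgM' : ∀ s, g s ∈ adjoin M {v})
    (hgM : ∀ s t, g s * s • g t / g (s * t) ∈ M) :
    ∃ (η : Γ → ℤ) (y : Γ → Γ → ℤ) (h : Γ → l), IsLocallyConstant η ∧ IsLocallyConstant h ∧
      (∀ s t, η s + η t - η (s * t) = p * y s t) ∧ (∀ s, h s ∈ M) ∧ (∀ s, h s ≠ 0) ∧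
      ∀ s t, g s * s • g t / g (s * t) = (v ^ p) ^ y s t * (h s * s • h t / h (s * t)) := by
  classical
  have hp : p.Prime := Fact.out
  have : CharP M p := (algebraMap M l).charP (algebraMap M l).injective p
  have hv0 : v ≠ 0 := fun h => hvM (h ▸ M.zero_mem)
  have hint : IsIntegral M v := IsIntegral.of_pow hp.pos
    (isIntegral_algebraMap (x := (⟨v ^ p, hMp v⟩ : M)))
  let E := adjoin M {v}
  let w : E := AdjoinSimple.gen M v
  have hwp : w ^ p = algebraMap M E ⟨v ^ p, hMp v⟩ := Subtype.ext rfl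
  have hwM : w ∉ Set.range (algebraMap M E) := by
    rintro ⟨z, hz⟩
    have := congrArg (algebraMap E l) hz
    exact hvM ((show (z : l) = v from this) ▸ z.2)
  have htop : Algebra.adjoin M {w} = ⊤ := adjoin_gen_eq_top hint
  have hMrange : ∀ x : E, x ∈ Set.range (algebraMap M E) → (x : l) ∈ M := by
    rintro _ ⟨z, rfl⟩
    exact z.2
  obtain ⟨D, hD⟩ := exists_derivation_apply_eq_self hwp hwM htop
  have hker : ∀ x : E, D x = 0 → (x : l) ∈ M := fun x hx =>
    hMrange x (D.mem_range_of_apply_eq_zero hwp hwM htop hD hx)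
  have hDM : ∀ x : E, (x : l) ∈ M → D x = 0 := fun x hx => by
    have : x = algebraMap M E ⟨x, hx⟩ := Subtype.ext rfl
    rw [this, D.map_algebraMap]
  let σ : Γ → E →+* E := fun s =>
    { toFun := fun x => ⟨s • (x : l), smul_mem_adjoin_simple hMs hv s x.2⟩
      map_one' := Subtype.ext (by simp)
      map_mul' := fun x y => Subtype.ext (by simp)
      map_zero' := Subtype.ext (by simp)
      map_add' := fun x y => Subtype.ext (by simp) }
  have hσ : ∀ s x, ((σ s x : E) : l) = s • (x : l) := fun s x => rfl
  have hDσ : ∀ s x, D (σ s x) = σ s (D x) := by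
    intro s x
    have hx : x ∈ Algebra.adjoin M {w} := htop ▸ Algebra.mem_top
    induction hx using Algebra.adjoin_induction with
    | mem x hx =>
      rw [Set.mem_singleton_iff.1 hx, hD]
      have : σ s w = w := Subtype.ext (hv s)
      rw [this, hD]
    | algebraMap r =>
      rw [D.map_algebraMap, map_zero]
      exact hDM _ (hMs s r r.2)
    | add x y _ _ hx hy => rw [map_add, map_add, map_add, map_add, hx, hy]
    | mul x y _ _ hx hy =>
      rw [map_mul, D.leibniz, D.leibniz, hx, hy]
      simp
  have hDσn : ∀ s n x, D^[n] (σ s x) = σ s (D^[n] x) := fun s n x =>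
    (Function.Semiconj.iterate_right (f := σ s) (fun x => (hDσ s x).symm) n x).symm
  let G : Γ → E := fun s => ⟨g s, hgM' s⟩
  have hG0 : ∀ s, G s ≠ 0 := fun s h => hg0 s (congrArg Subtype.val h)
  -- The coboundary of `G` lies in `M`, which `D` kills. Taking logarithmic derivatives therefore
  -- makes `f` an additive 1-cocycle, which is split by some `m` in `E`.
  let f : Γ → E := fun s => D (G s) / G s
  have hfc : ∀ s t, f (s * t) = f s + σ s (f t) := by
    intro s t
    have h0 : σ s (G t) ≠ 0 := fun h => hG0 t ((map_eq_zero (σ s)).1 h)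
    have h1 : D (G s * σ s (G t) / G (s * t)) = 0 := hDM _ (hgM s t)
    have h2 : G s * σ s (G t) = G s * σ s (G t) / G (s * t) * G (s * t) := by
      rw [div_mul_cancel₀ _ (hG0 _)]
    have h3 := congrArg D h2
    rw [D.leibniz, D.leibniz, h1, hDσ] at h3
    simp only [smul_eq_mul, mul_zero, add_zero] at h3
    simp only [f, map_div₀]
    have hGst := hG0 (s * t)
    have hGs := hG0 s
    field_simp at h3 ⊢
    linear_combination -h3
  have hflc : IsLocallyConstant fun s => (f s : l) := by
    have : IsLocallyConstant G := by
      rw [IsLocallyConstant.iff_eventually_eq]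
      intro s
      filter_upwards [hg.eventually_eq s] with t ht
      exact Subtype.ext ht
    exact this.comp fun x => ((D x / x : E) : l)
  obtain ⟨m, hmE, hm⟩ := exists_smul_sub_of_additive_cocycle (M := E.toSubfield)
    (hT.of_pow_mem fun x => E.algebraMap_mem ⟨x ^ p, hMp x⟩)
    (fun s x hx => smul_mem_adjoin_simple hMs hv s hx) hflc (fun s => (f s).2)
    (fun s t => congrArg Subtype.val (hfc s t))
  let m₁ : E := ⟨m, hmE⟩
  have hm₁ : ∀ s, f s = σ s m₁ - m₁ := fun s => Subtype.ext (hm s)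
  have : CharP E p := (algebraMap E l).charP (algebraMap E l).injective p
  have hDp : ∀ x : E, D (x ^ p) = 0 := fun x => hDM _ (hMp x)
  have hit : ∀ x, D (D^[p - 1] x) = D x := fun x => by
    rw [← Function.iterate_succ_apply' D, Nat.succ_eq_add_one, Nat.sub_add_cancel hp.one_le,
      D.iterate_char_eq_self htop hD]
  have hsub : ∀ n x y, D^[n] (x - y) = D^[n] x - D^[n] y := fun n x y => by
    have := iterate_map_sub (D.toLinearMap.toAddMonoidHom) n x y
    exact this
  -- `e` is the obstruction to `m₁` being a logarithmic derivative. It is a constant of `D`, and it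
  -- is `Γ`-invariant because every `f s` is a logarithmic derivative. An Artin–Schreier root θ of
  -- `e` lies in `M`, as θ = θ^p - e, and m₁ - θ is no longer obstructed.
  let e : E := m₁ ^ p + D^[p - 1] m₁ - m₁
  have heM : (e : l) ∈ M := hker _ (by simp only [e]; rw [map_sub, map_add, hDp, hit]; ring)
  have hefix : ∀ s : Γ, s • (e : l) = e := by
    intro s
    have h1 := D.logDeriv_pow_char htop hD (hG0 s)
    change f s ^ p + D^[p - 1] (f s) = f s at h1
    rw [hm₁, sub_pow_char, hsub, hDσn] at h1
    have h2 : σ s e = e := by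
      simp only [e, map_sub, map_add, map_pow]
      linear_combination h1
    exact congrArg Subtype.val h2
  obtain ⟨θ, hθ⟩ := hAS e
  have hθM : θ ∈ M := by
    have : θ = θ ^ p - e := by rw [← hθ]; ring
    rw [this]
    exact M.sub_mem (hMp θ) heM
  let θ₁ : E := ⟨θ, E.algebraMap_mem ⟨θ, hθM⟩⟩
  have hθ₁ : θ₁ ^ p - θ₁ = e := Subtype.ext hθ
  have hDθ : D θ₁ = 0 := hDM _ hθM
  have hm₂ : (m₁ - θ₁) ^ p + D^[p - 1] (m₁ - θ₁) = m₁ - θ₁ := by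
    have h1 : D^[p - 1] θ₁ = 0 := by
      obtain ⟨k, hk⟩ : ∃ k, p - 1 = k + 1 := ⟨p - 2, by have := hp.two_le; omega⟩
      rw [hk, Function.iterate_succ_apply, hDθ]
      exact iterate_map_zero D.toLinearMap.toAddMonoidHom k
    rw [sub_pow_char, hsub, h1]
    simp only [e] at hθ₁
    linear_combination -hθ₁
  obtain ⟨r, hr0, hr⟩ := D.exists_logDeriv_eq hwM htop hD hm₂
  -- sθ - θ satisfies x^p = x, so it is an integer of the prime field; `F` picks a representative
  -- and its default 0 is never used. Since `F` depends only on the value, η stays locally constant.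
  let F : l → ℤ := fun x => if hx : ∃ n : ℤ, (n : l) = x then hx.choose else 0
  let η : Γ → ℤ := fun s => F (s • θ - θ)
  have hη : ∀ s, (η s : l) = s • θ - θ := by
    intro s
    have hx : ∃ n : ℤ, (n : l) = s • θ - θ := by
      refine exists_intCast_of_pow_char_eq_self ?_
      have h1 := congrArg (s • ·) hθ
      simp only [smul_sub, smul_pow', hefix] at h1
      rw [sub_pow_char]
      linear_combination h1 - hθ
    simp only [η, F, dif_pos hx]
    exact hx.choose_spec
  have hηE : ∀ s, (η s : E) = σ s θ₁ - θ₁ := fun s => Subtype.ext (by push_cast; exact hη s)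
  have hηlc : IsLocallyConstant η :=
    (LocallyConstantSMul.isLocallyConstant_smul (Γ := Γ) θ).comp fun x => F (x - θ)
  have hdvd : ∀ s t, (p : ℤ) ∣ η s + η t - η (s * t) := by
    intro s t
    rw [← CharP.intCast_eq_zero_iff l p]
    push_cast
    have h1 : (s * t) • θ - θ = (s • θ - θ) + s • (t • θ - θ) := by rw [mul_smul, smul_sub]; ring
    have h2 : s • (t • θ - θ) = t • θ - θ := by
      rw [← hη]
      exact map_intCast (MulSemiringAction.toRingHom Γ l s) (η t)
    rw [hη, hη, hη, h1, h2]
    ring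
  choose y hy using hdvd
  have hσr0 : ∀ s, σ s r ≠ 0 := fun s h => hr0 ((map_eq_zero (σ s)).1 h)
  have hw0 : w ≠ 0 := fun h => hv0 (congrArg Subtype.val h)
  have hlog : ∀ {x y : E}, x ≠ 0 → y ≠ 0 → D (x * y) / (x * y) = D x / x + D y / y := by
    intro x y hx hy
    rw [D.leibniz]
    simp only [smul_eq_mul]
    field_simp
    ring
  have hloginv : ∀ {x : E}, x ≠ 0 → D x⁻¹ / x⁻¹ = -(D x / x) := by
    intro x hx
    rw [D.leibniz_inv]
    simp only [smul_eq_mul]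
    field_simp
  have hlogz : ∀ n : ℤ, D (w ^ n) / w ^ n = n := by
    have hn : ∀ n : ℕ, D (w ^ n) / w ^ n = n := fun n => by
      induction n with
      | zero => simp
      | succ n ih =>
        rw [pow_succ, hlog (pow_ne_zero n hw0) hw0, ih, hD, div_self hw0]
        push_cast
        rfl
    intro n
    rcases n.eq_nat_or_neg with ⟨k, rfl | rfl⟩
    · simpa using hn k
    · rw [zpow_neg, hloginv (zpow_ne_zero _ hw0)]
      simpa using hn k
  -- The logarithmic derivative of `H s` is f s + (m₁ - θ) - s(m₁ - θ) - η s = 0, so `H` has values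
  -- in `M`. The factor r / s(r) does not affect the coboundary, and w^η contributes (w^p)^y because
  -- ∂η = p y.
  let H : Γ → E := fun s => G s * (r * (σ s r)⁻¹) * (w ^ η s)⁻¹
  have hH0 : ∀ s, H s ≠ 0 := fun s => mul_ne_zero
    (mul_ne_zero (hG0 s) (mul_ne_zero hr0 (inv_ne_zero (hσr0 s)))) (inv_ne_zero (zpow_ne_zero _ hw0))
  have hHM : ∀ s, (H s : l) ∈ M := by
    intro s
    refine hker _ ?_
    have h1 : D (H s) / H s = 0 := by
      have hwz := zpow_ne_zero (η s) hw0
      simp only [H]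
      rw [hlog (mul_ne_zero (hG0 s) (mul_ne_zero hr0 (inv_ne_zero (hσr0 s)))) (inv_ne_zero hwz),
        hlog (hG0 s) (mul_ne_zero hr0 (inv_ne_zero (hσr0 s))), hlog hr0 (inv_ne_zero (hσr0 s)),
        hloginv (hσr0 s), hloginv hwz, hlogz, hDσ, hr, map_mul, mul_div_cancel_right₀ _ hr0,
        mul_div_cancel_right₀ _ (hσr0 s), hηE]
      change f s + _ + _ = 0
      rw [hm₁, map_sub]
      ring
    rcases div_eq_zero_iff.1 h1 with h | h
    · exact h
    · exact absurd h (hH0 s)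
  refine ⟨η, y, fun s => H s, hηlc, ?_, hy, hHM, fun s h => hH0 s (Subtype.ext h), fun s t => ?_⟩
  · have h1 : IsLocallyConstant fun s : Γ => s • (r : l) :=
      LocallyConstantSMul.isLocallyConstant_smul (r : l)
    exact ((hg.prodMk h1).prodMk hηlc).comp fun z =>
      z.1.1 * ((r : l) * z.1.2⁻¹) * (v ^ z.2)⁻¹
  · have h1 : G s * σ s (G t) / G (s * t) =
        (w ^ p) ^ y s t * (H s * σ s (H t) / H (s * t)) := by
      have h2 : σ (s * t) r = σ s (σ t r) := Subtype.ext (mul_smul s t (r : l))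
      have h3 : σ s w = w := Subtype.ext (hv s)
      have h4 : w ^ η s * w ^ η t = (w ^ p) ^ y s t * w ^ η (s * t) := by
        rw [← zpow_natCast, ← zpow_mul, ← zpow_add₀ hw0, ← zpow_add₀ hw0, ← hy]
        congr 1
        ring
      simp only [H, map_mul, map_inv₀, map_zpow₀, h2, h3]
      have hws := zpow_ne_zero (η s) hw0
      have hwt := zpow_ne_zero (η t) hw0
      have hwst := zpow_ne_zero (η (s * t)) hw0
      have a1 := hG0 (s * t)
      have a2 := hσr0 s
      have a3 : σ s (σ t r) ≠ 0 := h2 ▸ hσr0 (s * t)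
      generalize w ^ η s = ws at *
      generalize w ^ η t = wt at *
      generalize w ^ η (s * t) = wst at *
      generalize (w ^ p) ^ y s t = wy at *
      field_simp
      linear_combination (G s * σ s (G t)) * h4
    have := congrArg (algebraMap E l) h1
    simp only [map_div₀, map_mul, map_zpow₀, map_pow] at this
    exact this

end DegreeP

/-! ### Characters modulo q as integer-valued lifts, their carry cocycles, and norms. -/

section Characters

variable {Γ l : Type*} [Group Γ] [Field l] [MulSemiringAction Γ l]

/-- The multiplicative coboundary of a one-cochain. -/
def mulCoboundary (h : Γ → l) (s t : Γ) : l := h s * s • h t / h (s * t)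

theorem mulCoboundary_mul (h k : Γ → l) (s t : Γ) :
    mulCoboundary (fun s => h s * k s) s t = mulCoboundary h s t * mulCoboundary k s t := by
  simp only [mulCoboundary, smul_mul']
  rw [div_mul_div_comm]
  ring

theorem mulCoboundary_inv (h : Γ → l) (s t : Γ) :
    mulCoboundary (fun s => (h s)⁻¹) s t = (mulCoboundary h s t)⁻¹ := by
  simp only [mulCoboundary, smul_inv'', inv_div, div_inv_eq_mul]
  rw [mul_comm (h s), div_mul_eq_div_div_swap, div_eq_mul_inv, div_eq_mul_inv]
  ring

theorem mulCoboundary_zpow {v : l} (hv0 : v ≠ 0) (hv : ∀ s : Γ, s • v = v) (x : Γ → ℤ) (s t : Γ) :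
    mulCoboundary (fun s => v ^ x s) s t = v ^ (x s + x t - x (s * t)) := by
  have : s • v ^ x t = v ^ x t := by simp [smul_zpow₀', hv]
  rw [mulCoboundary, this, zpow_sub₀ hv0, zpow_add₀ hv0]

/-- The integers `y` are the carries of the character `x` modulo `q`. -/
def IsCarry (q : ℕ) (x : Γ → ℤ) (y : Γ → Γ → ℤ) : Prop :=
  ∀ s t, x s + x t - x (s * t) = q * y s t

namespace IsCarry

variable {q : ℕ} {x : Γ → ℤ} {y : Γ → Γ → ℤ}

theorem apply_one (h : IsCarry q x y) : x 1 = q * y 1 1 := by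
  have := h 1 1
  rw [mul_one] at this
  linarith

theorem dvd_mul_iff (h : IsCarry q x y) (s t : Γ) : (q : ℤ) ∣ x (s * t) ↔ (q : ℤ) ∣ x s + x t := by
  have := h s t
  constructor
  · rintro ⟨k, hk⟩; exact ⟨k + y s t, by rw [mul_add]; linarith⟩
  · rintro ⟨k, hk⟩; exact ⟨k - y s t, by rw [mul_sub]; linarith⟩

theorem dvd_inv_iff (h : IsCarry q x y) (s : Γ) : (q : ℤ) ∣ x s⁻¹ + x s := by
  rw [← h.dvd_mul_iff, inv_mul_cancel]
  exact ⟨_, h.apply_one⟩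

/-- The kernel of the character `x` modulo `q`. -/
def kernel (h : IsCarry q x y) : Subgroup Γ where
  carrier := {s | (q : ℤ) ∣ x s}
  one_mem' := ⟨_, h.apply_one⟩
  mul_mem' {a b} ha hb := (h.dvd_mul_iff a b).2 (dvd_add ha hb)
  inv_mem' {a} ha := (dvd_add_left ha).1 (h.dvd_inv_iff a)

theorem mem_kernel (h : IsCarry q x y) {s : Γ} : s ∈ h.kernel ↔ (q : ℤ) ∣ x s := Iff.rfl

instance (h : IsCarry q x y) : h.kernel.Normal where
  conj_mem n hn g := by
    rw [mem_kernel] at hn ⊢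
    obtain ⟨a, ha⟩ := hn
    obtain ⟨b, hb⟩ := h.dvd_inv_iff g
    have h1 := h g n
    have h2 := h (g * n) g⁻¹
    exact ⟨a + b - y g n - y (g * n) g⁻¹, by linear_combination ha + hb - h1 - h2⟩

theorem zpow (h : IsCarry q x y) (s : Γ) (n : ℤ) : (q : ℤ) ∣ x (s ^ n) - n * x s := by
  induction n with
  | zero => simpa using ⟨_, h.apply_one⟩
  | succ n ih =>
    obtain ⟨k, hk⟩ := ih
    refine ⟨k - y (s ^ (n : ℤ)) s, ?_⟩
    have := h (s ^ (n : ℤ)) s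
    rw [zpow_add_one]
    linear_combination hk - this
  | pred n ih =>
    obtain ⟨k, hk⟩ := ih
    refine ⟨k + y (s ^ (-(n : ℤ) - 1)) s, ?_⟩
    have := h (s ^ (-(n : ℤ) - 1)) s
    rw [← zpow_add_one, sub_add_cancel] at this
    linear_combination hk + this

theorem zpow_inv_mul_mem (h : IsCarry q x y) {σ : Γ} (hσ : (q : ℤ) ∣ x σ - 1) {s : Γ} {n : ℤ}
    (hn : (q : ℤ) ∣ x s - n) : (σ ^ n)⁻¹ * s ∈ h.kernel := by
  rw [mem_kernel, h.dvd_mul_iff]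
  obtain ⟨a, ha⟩ := hσ
  obtain ⟨b, hb⟩ := h.zpow σ n
  obtain ⟨c, hc⟩ := h.dvd_inv_iff (σ ^ n)
  obtain ⟨d, hd⟩ := hn
  exact ⟨c - b - n * a + d, by linear_combination hc - hb - n * ha + hd⟩

theorem cocycle (h : IsCarry q x y) (hq : q ≠ 0) (s g t : Γ) :
    y g t + y s (g * t) = y (s * g) t + y s g := by
  have hq' : (q : ℤ) ≠ 0 := by exact_mod_cast hq
  refine mul_left_cancel₀ hq' ?_
  rw [mul_add, mul_add, ← h, ← h, ← h, ← h, mul_assoc]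
  ring

theorem eq_div (h : IsCarry q x y) (hq : q ≠ 0) (s t : Γ) :
    y s t = (x s + x t - x (s * t)) / q := by
  rw [h, Int.mul_ediv_cancel_left]
  exact_mod_cast hq

/-- The same carries come from a character of smaller order that is surjective. -/
theorem exists_surjective {p n : ℕ} [Fact p.Prime] {x : Γ → ℤ} (h : IsCarry (p ^ n) x y) :
    ∃ (m : ℕ) (d : ℤ) (x' : Γ → ℤ) (σ : Γ), (∀ s, x' s = x s / d) ∧ IsCarry (p ^ m) x' y ∧
      ((p ^ m : ℕ) : ℤ) ∣ x' σ - 1 := by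
  have hp : p.Prime := Fact.out
  -- The subgroup of ℤ generated by p^n and the values of `x`; it is dℤ with d dividing p^n.
  -- Dividing both `x` and the modulus by d keeps the carries and makes 1 a value of the character.
  let A : AddSubgroup ℤ :=
    { carrier := {k | ∃ s, ((p ^ n : ℕ) : ℤ) ∣ k - x s}
      zero_mem' := ⟨1, by simpa using ⟨_, h.apply_one⟩⟩
      add_mem' := by
        rintro a b ⟨s, c, hs⟩ ⟨t, d, ht⟩
        exact ⟨s * t, c + d + y s t, by linear_combination hs + ht + h s t⟩
      neg_mem' := by
        rintro a ⟨s, c, hs⟩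
        obtain ⟨d, hd⟩ := h.dvd_inv_iff s
        exact ⟨s⁻¹, -c - d, by linear_combination -hs - hd⟩ }
  obtain ⟨d, hd⟩ := Int.subgroup_cyclic A
  have hmem : ∀ k, k ∈ A ↔ d ∣ k := fun k => by
    rw [hd, ← AddSubgroup.zmultiples_eq_closure, Int.mem_zmultiples_iff]
  have hdn : d ∣ ((p ^ n : ℕ) : ℤ) := (hmem _).1 ⟨1, by
    rw [h.apply_one]; exact ⟨1 - y 1 1, by ring⟩⟩
  have hd0 : d ≠ 0 := by
    rintro rfl
    rw [zero_dvd_iff] at hdn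
    exact pow_ne_zero n hp.ne_zero (by exact_mod_cast hdn)
  obtain ⟨k, hk, hdk⟩ := (Nat.dvd_prime_pow hp).1 (Int.natAbs_dvd_natAbs.2 hdn)
  have hdx : ∀ s, ((d.natAbs : ℕ) : ℤ) ∣ x s := fun s =>
    Int.natAbs_dvd.2 ((hmem _).1 ⟨s, by simp⟩)
  rw [hdk] at hdx
  have hpk : ((p ^ k : ℕ) : ℤ) ≠ 0 := by exact_mod_cast pow_ne_zero k hp.ne_zero
  obtain ⟨σ, c, hσ⟩ := (hmem ((p ^ k : ℕ) : ℤ)).2 (by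
    rw [← hdk]; exact Int.dvd_natAbs.2 dvd_rfl)
  have hpn : ((p ^ n : ℕ) : ℤ) = (p ^ k : ℕ) * (p ^ (n - k) : ℕ) := by
    rw [← Nat.cast_mul, ← pow_add, Nat.add_sub_cancel' hk]
  choose x' hx' using hdx
  have hdiv : ∀ s, x' s = x s / ((p ^ k : ℕ) : ℤ) := fun s => by
    rw [hx', Int.mul_ediv_cancel_left _ hpk]
  refine ⟨n - k, _, x', σ, hdiv, fun s t => ?_, ?_⟩
  · refine mul_left_cancel₀ hpk ?_
    rw [mul_sub, mul_add, ← hx', ← hx', ← hx', h, hpn]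
    ring
  · refine ⟨-c, mul_left_cancel₀ hpk ?_⟩
    rw [hx', hpn] at hσ
    linear_combination -hσ

end IsCarry

variable (Γ l) in
/-- The action on the group of units. -/
def unitsAut : Γ →* MulAut lˣ where
  toFun s := Units.mapEquiv (MulSemiringAction.toRingEquiv Γ l s : l ≃* l)
  map_one' := by ext; simp
  map_mul' s t := by ext; simp

/-- The cocycle attached to a norm from the cyclic extension cut out by a character is trivial. -/
theorem exists_coboundary_norm [TopologicalSpace Γ] {q : ℕ} {x : Γ → ℤ} {y : Γ → Γ → ℤ}
    (h : IsCarry q x y) (hx : IsLocallyConstant x) {σ : Γ} (hσ : (q : ℤ) ∣ x σ - 1) {M : Subfield l}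
    (hMs : ∀ s : Γ, ∀ x ∈ M, s • x ∈ M) {z : l} (hz0 : z ≠ 0) (hzM : z ∈ M)
    (hz : ∀ s ∈ h.kernel, s • z = z) :
    (∀ s : Γ, s • (∏ i ∈ Finset.range q, σ ^ i • z) = ∏ i ∈ Finset.range q, σ ^ i • z) ∧
    ∃ a : Γ → l, IsLocallyConstant a ∧ (∀ s, a s ∈ M) ∧ (∀ s, a s ≠ 0) ∧
      ∀ s t, mulCoboundary a s t = (∏ i ∈ Finset.range q, σ ^ i • z) ^ y s t := by
  -- Powers of (z, σ) in the semidirect product extend the partial norms z·σz·… to all integer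
  -- exponents: `A j` is the unit component of the j-th power. Then `A q` is the norm N, A(qj) =
  -- N^j, and s ↦ A(x s) has coboundary N^y.
  let G := lˣ ⋊[unitsAut Γ l] Γ
  let e : G := ⟨Units.mk0 z hz0, σ⟩
  let A : ℤ → l := fun j => ((e ^ j).left : l)
  have hright : ∀ j : ℤ, (e ^ j).right = σ ^ j := fun j =>
    map_zpow (SemidirectProduct.rightHom (φ := unitsAut Γ l)) e j
  have hA : ∀ i j, A (i + j) = A i * σ ^ i • A j := fun i j => by
    have h1 : (e ^ (i + j)).left = (e ^ i).left * unitsAut Γ l (e ^ i).right (e ^ j).left := by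
      rw [zpow_add]
      rfl
    rw [hright] at h1
    exact congrArg Units.val h1
  have hA0 : ∀ i, A i ≠ 0 := fun i => Units.ne_zero _
  have hAM : ∀ i, A i ∈ M := by
    let S : Subgroup G :=
      { carrier := {g | (g.left : l) ∈ M}
        one_mem' := M.one_mem
        mul_mem' := fun {a b} ha hb => M.mul_mem ha (hMs _ _ hb)
        inv_mem' := fun {a} ha => hMs _ _ (by
          rw [Units.val_inv_eq_inv_val]; exact M.inv_mem ha) }
    have he : e ∈ S := hzM
    exact fun i => S.zpow_mem he i
  have hAk : ∀ i, ∀ s ∈ h.kernel, s • A i = A i := by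
    have hconj : ∀ (g : Γ) (w : l), (∀ s ∈ h.kernel, s • w = w) →
        ∀ s ∈ h.kernel, s • g • w = g • w := fun g w hw s hs => by
      have h1 := hw (g⁻¹ * s * g) (by
        have := (inferInstance : h.kernel.Normal).conj_mem s hs g⁻¹
        rwa [inv_inv] at this)
      rw [← mul_smul]
      conv_rhs => rw [← h1, ← mul_smul]
      congr 1
      group
    let S : Subgroup G :=
      { carrier := {g | ∀ s ∈ h.kernel, s • (g.left : l) = g.left}
        one_mem' := fun s _ => smul_one s
        mul_mem' := fun {a b} ha hb s hs => by
          change s • ((a.left : l) * a.right • (b.left : l)) = (a.left : l) * a.right • (b.left : l)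
          rw [smul_mul', ha s hs, hconj _ _ hb s hs]
        inv_mem' := fun {a} ha => by
          refine hconj _ _ fun s hs => ?_
          rw [Units.val_inv_eq_inv_val, smul_inv'', ha s hs] }
    have he : e ∈ S := hz
    exact fun i => S.zpow_mem he i
  have hAn : ∀ n : ℕ, A n = ∏ i ∈ Finset.range n, σ ^ i • z := by
    intro n
    induction n with
    | zero => simp [A]
    | succ n ih =>
      rw [Finset.prod_range_succ, ← ih, Nat.cast_succ, hA, zpow_natCast]
      simp [A, e]
  have hσA : ∀ (s : Γ) (i : ℤ) {n : ℤ}, (q : ℤ) ∣ x s - n → s • A i = σ ^ n • A i := by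
    intro s i n hn
    have := hAk i _ (h.zpow_inv_mul_mem hσ hn)
    rw [mul_smul, inv_smul_eq_iff] at this
    exact this
  have hqA : ∀ i, σ ^ (q : ℤ) • A i = A i := fun i => by
    refine hAk i _ ?_
    rw [IsCarry.mem_kernel]
    obtain ⟨k, hk⟩ := h.zpow σ q
    exact ⟨k + x σ, by linear_combination hk⟩
  have hN1 : σ • A q = A q := by
    have h1 := hA 1 q
    have h2 := hA q 1
    rw [add_comm, h2, hqA, zpow_one, mul_comm] at h1
    exact (mul_left_cancel₀ (hA0 1) h1).symm
  have hNσ : ∀ n : ℤ, σ ^ n • A q = A q := fun n =>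
    (MulAction.stabilizer Γ (A q)).zpow_mem (x := σ) hN1 n
  have hNs : ∀ s : Γ, s • A q = A q := fun s => by rw [hσA s q (n := x s) (by simp), hNσ]
  have hAq : ∀ j : ℤ, A (q * j) = A q ^ j := by
    intro j
    induction j with
    | zero => simp [A]
    | succ j ih =>
      rw [mul_add, mul_one, add_comm, hA, hqA, ih, zpow_add_one₀ (hA0 q), mul_comm]
    | pred j ih =>
      have h1 := hA q (q * (-(j : ℤ) - 1))
      rw [hqA, show (q : ℤ) + q * (-(j : ℤ) - 1) = q * -(j : ℤ) by ring, ih] at h1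
      rw [zpow_sub_one₀ (hA0 q), h1, mul_comm (A q), mul_inv_cancel_right₀ (hA0 q)]
  rw [← hAn]
  refine ⟨hNs, fun s => A (x s), hx.comp A, fun s => hAM _, fun s => hA0 _, fun s t => ?_⟩
  have h1 : x s + x t = x (s * t) + q * y s t := by linear_combination h s t
  have h2 : ∀ (k n : ℤ), σ ^ n • A q ^ k = A q ^ k := fun k n => by
    simp [smul_zpow₀', hNσ]
  rw [mulCoboundary, hσA s _ (n := x s) (by simp), ← hA, h1, hA, hAq, h2,
    mul_div_cancel_left₀ _ (hA0 _)]

end Characters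

/-! ### Lifting characters of p-power order, and generators of cyclic extensions. -/

section Symbols

open Polynomial IntermediateField

theorem IsCarry.isLocallyConstant {Γ : Type*} [Group Γ] [TopologicalSpace Γ]
    [IsTopologicalGroup Γ] {q : ℕ} {x : Γ → ℤ} {y : Γ → Γ → ℤ} (h : IsCarry q x y)
    (hq : q ≠ 0) (hx : IsLocallyConstant x) : IsLocallyConstant fun z : Γ × Γ => y z.1 z.2 := by
  have h1 : IsLocallyConstant fun z : Γ × Γ => x z.1 := hx.comp_continuous (by fun_prop)
  have h2 : IsLocallyConstant fun z : Γ × Γ => x z.2 := hx.comp_continuous (by fun_prop)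
  have h3 : IsLocallyConstant fun z : Γ × Γ => x (z.1 * z.2) := hx.comp_continuous (by fun_prop)
  convert ((h1.prodMk h2).prodMk h3).comp fun w => (w.1.1 + w.1.2 - w.2) / (q : ℤ) using 2 with z
  exact h.eq_div hq z.1 z.2

variable {p : ℕ} [Fact p.Prime] {Γ l : Type*} [Group Γ] [Field l] [CharP l p]
  [MulSemiringAction Γ l] [TopologicalSpace Γ] [IsTopologicalGroup Γ] [CompactSpace Γ]

/-- Characters of `p`-power order are divisible by `p`. -/
theorem IsCarry.exists_lift [LocallyConstantSMul Γ l] (hT : HasTraceOne Γ (⊤ : Subfield l))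
    (hAS : ∀ a : l, ∃ x, x ^ p - x = a) {q : ℕ} (hq : q ≠ 0) {x : Γ → ℤ} {y : Γ → Γ → ℤ}
    (h : IsCarry q x y) (hx : IsLocallyConstant x) :
    ∃ w : Γ → ℤ, IsLocallyConstant w ∧ ∀ s t, (p : ℤ) ∣ y s t + (w s + w t - w (s * t)) := by
  classical
  have hint : ∀ (s : Γ) (n : ℤ), s • (n : l) = n := fun s n =>
    map_intCast (MulSemiringAction.toRingHom Γ l s) n
  -- This proves that the carry class vanishes in H²(Γ, 𝔽_p). In `l` the carries are ∂m; then m^p -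
  -- m is an additive 1-cocycle, split by some e. Correcting m by an Artin–Schreier root θ of e puts
  -- its values in the prime field.
  obtain ⟨m, hm, hym⟩ := exists_coboundary_of_additive_two_cocycle hT
    (c := fun s t => (y s t : l)) ((h.isLocallyConstant hq hx).comp fun n : ℤ => (n : l))
    (fun s g t => by
      rw [hint]
      have := congrArg (Int.cast : ℤ → l) (h.cocycle hq s g t)
      push_cast at this
      exact this)
  obtain ⟨e, -, he⟩ := exists_smul_sub_of_additive_cocycle (M := (⊤ : Subfield l)) hT
    (fun _ _ _ => trivial) (h := fun s => m s ^ p - m s) (hm.comp fun z => z ^ p - z)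
    (fun _ => trivial) (fun s t => by
      have h1 := hym s t
      have h2 : ((y s t : ℤ) : l) ^ p = y s t := _root_.map_intCast (frobenius l p) _
      have h3 := congrArg (· ^ p) h1
      simp only [sub_pow_char, add_pow_char, h2] at h3
      simp only [smul_sub, smul_pow']
      linear_combination h3 - h1)
  obtain ⟨θ, hθ⟩ := hAS e
  let F : l → ℤ := fun x => if hx : ∃ n : ℤ, (n : l) = x then hx.choose else 0
  have hF : ∀ s, (F (m s - (s • θ - θ)) : l) = m s - (s • θ - θ) := by
    intro s
    have hx : ∃ n : ℤ, (n : l) = m s - (s • θ - θ) := by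
      refine exists_intCast_of_pow_char_eq_self ?_
      have h1 := congrArg (s • ·) hθ
      simp only [smul_sub, smul_pow'] at h1
      rw [sub_pow_char, sub_pow_char]
      linear_combination he s - h1 + hθ
    simp only [F, dif_pos hx]
    exact hx.choose_spec
  refine ⟨fun s => -F (m s - (s • θ - θ)), ?_, fun s t => ?_⟩
  · exact (hm.prodMk (LocallyConstantSMul.isLocallyConstant_smul (Γ := Γ) θ)).comp
      fun z => -F (z.1 - (z.2 - θ))
  · rw [← CharP.intCast_eq_zero_iff l p]
    push_cast
    have h1 := hF t
    have h2 : s • (m t - (t • θ - θ)) = m t - (t • θ - θ) := by rw [← h1, hint]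
    rw [smul_sub, smul_sub, ← mul_smul] at h2
    rw [hF, hF, hF, hym]
    linear_combination h2

/-- The cyclic extension of degree `p ^ (n + 1)` cut out by a surjective character contains an
element with trivial stabilizer in the cyclic group. -/
theorem exists_injOn_smul (hT : HasTraceOne Γ (⊤ : Subfield l)) {n : ℕ} {x : Γ → ℤ}
    {y : Γ → Γ → ℤ} (h : IsCarry (p ^ (n + 1)) x y) (hx : IsLocallyConstant x) {σ : Γ}
    (hσ : ((p ^ (n + 1) : ℕ) : ℤ) ∣ x σ - 1) :
    ∃ u : l, (∀ s ∈ h.kernel, s • u = u) ∧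
      Set.InjOn (fun i : ℕ => σ ^ i • u) (Set.Iio (p ^ (n + 1))) := by
  classical
  have hp : p.Prime := Fact.out
  have hopen : IsOpen (h.kernel : Set Γ) := by
    convert (hx.comp fun k : ℤ => ((p ^ (n + 1) : ℕ) : ℤ) ∣ k).isOpen_fiber True using 1
    ext s
    simp only [SetLike.mem_coe, IsCarry.mem_kernel, Function.comp_apply, Set.mem_ofPred_eq, eq_iff_iff,
      iff_true]
  obtain ⟨t, -, ht, h1⟩ := hT _ hopen
  refine ⟨t, ht, ?_⟩
  have hmem : ∀ (k : ℤ) (s : Γ), ((p ^ (n + 1) : ℕ) : ℤ) ∣ x s - k → s • t = σ ^ k • t :=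
    fun k s hs => by
      have := ht _ (h.zpow_inv_mul_mem hσ hs)
      rwa [mul_smul, inv_smul_eq_iff] at this
  have hper : ∀ i : ℕ, (fun z : l => σ • z)^[i] t = σ ^ i • t := fun i => by
    rw [smul_iterate]
  have hq : σ ^ (p ^ (n + 1)) • t = t := by
    have := hmem 0 (σ ^ (p ^ (n + 1))) (by
      obtain ⟨k, hk⟩ := h.zpow σ ((p ^ (n + 1) : ℕ) : ℤ)
      rw [zpow_natCast] at hk
      exact ⟨k + x σ, by linear_combination hk⟩)
    simpa using this
  -- Otherwise the trace of `t`, a sum over p^(n+1) powers of σ, would be p times a sum over p^n of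
  -- them, hence 0 and not 1. A period dividing p^(n+1) but not p^n is p^(n+1).
  have hnot : σ ^ (p ^ n) • t ≠ t := by
    intro hfix
    have := finite_quotient_of_isOpen _ hopen
    have := Fintype.ofFinite (Γ ⧸ h.kernel)
    rw [finsum_eq_sum_of_fintype] at h1
    have hsum : ∑ q : Γ ⧸ h.kernel, q.out • t = ∑ i ∈ Finset.range (p ^ (n + 1)), σ ^ i • t := by
      symm
      refine Finset.sum_bij (fun i _ => ((σ ^ i : Γ) : Γ ⧸ h.kernel)) (fun _ _ => Finset.mem_univ _)
        (fun i hi j hj hij => ?_) (fun q _ => ?_) (fun i _ => ?_)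
      · rw [QuotientGroup.eq, IsCarry.mem_kernel, h.dvd_mul_iff] at hij
        obtain ⟨a, ha⟩ := hσ
        obtain ⟨b, hb⟩ := h.zpow σ i
        obtain ⟨c, hc⟩ := h.zpow σ j
        obtain ⟨d, hd⟩ := h.dvd_inv_iff (σ ^ i)
        obtain ⟨e, he⟩ := hij
        rw [zpow_natCast] at hb hc
        have hdvd : ((p ^ (n + 1) : ℕ) : ℤ) ∣ (i : ℤ) - j :=
          ⟨d - b + c - e - a * i + a * j, by
            linear_combination hd - hb + hc - he - i * ha + j * ha⟩
        have := (Nat.modEq_iff_dvd.2 hdvd)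
        exact (Nat.ModEq.eq_of_lt_of_lt this (Finset.mem_range.1 hj) (Finset.mem_range.1 hi)).symm
      · have hq0 : 0 < ((p ^ (n + 1) : ℕ) : ℤ) := by exact_mod_cast pow_pos hp.pos _
        refine ⟨(x q.out % ((p ^ (n + 1) : ℕ) : ℤ)).toNat, ?_, ?_⟩
        · rw [Finset.mem_range, Int.toNat_lt (Int.emod_nonneg _ hq0.ne')]
          exact Int.emod_lt_of_pos _ hq0
        · conv_rhs => rw [← QuotientGroup.out_eq' q]
          rw [QuotientGroup.eq, ← zpow_natCast, Int.toNat_of_nonneg (Int.emod_nonneg _ hq0.ne')]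
          exact h.zpow_inv_mul_mem hσ (Int.dvd_self_sub_emod)
      · obtain ⟨k, hk⟩ := QuotientGroup.mk_out_eq_mul h.kernel (σ ^ i)
        rw [hk, mul_smul, ht _ k.2]
    have hzero : ∀ k : ℕ, ∑ i ∈ Finset.range (p ^ n * k), σ ^ i • t =
        k * ∑ i ∈ Finset.range (p ^ n), σ ^ i • t := by
      intro k
      induction k with
      | zero => simp
      | succ k ih =>
        rw [mul_add, mul_one, Finset.sum_range_add, ih]
        have h2 : ∀ i, σ ^ (p ^ n * k + i) • t = σ ^ i • t := fun i => by
          rw [add_comm, pow_add, mul_smul, pow_mul]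
          congr 1
          exact (MulAction.stabilizer Γ t).pow_mem (x := σ ^ p ^ n) hfix k
        simp only [h2]
        push_cast
        ring
    rw [hsum, pow_succ, hzero, CharP.cast_eq_zero, zero_mul] at h1
    exact zero_ne_one h1
  have hmin : Function.minimalPeriod (fun z : l => σ • z) t = p ^ (n + 1) := by
    refine Function.minimalPeriod_eq_prime_pow ?_ ?_
    · rw [Function.IsPeriodicPt, Function.IsFixedPt, hper]; exact hnot
    · rw [Function.IsPeriodicPt, Function.IsFixedPt, hper]; exact hq
  have := Function.iterate_injOn_Iio_minimalPeriod (f := fun z : l => σ • z) (x := t)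
  rw [hmin] at this
  simpa only [hper] using this

end Symbols

/-! ### Descent of symbols along purely inseparable towers. -/

section Tower

open Polynomial IntermediateField

variable {p : ℕ} [Fact p.Prime] {Γ l : Type*} [Group Γ] [Field l] [CharP l p]
  [MulSemiringAction Γ l] [TopologicalSpace Γ] [IsTopologicalGroup Γ] [CompactSpace Γ]

theorem isIntegral_of_pow_mem {l : Type*} [Field l] {M : Subfield l} (hMp : ∀ x : l, x ^ p ∈ M) (v : l) :
    IsIntegral M v :=
  IsIntegral.of_pow (Fact.out : p.Prime).pos (isIntegral_algebraMap (x := (⟨v ^ p, hMp v⟩ : M)))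

/-- Any element outside `M` generates an extension of degree exactly p, so the inclusion of the two
fields is an equality. -/
theorem adjoin_simple_eq_of_pow_mem {M : Subfield l} (hMp : ∀ x : l, x ^ p ∈ M) {b v : l}
    (hb : b ∉ M) (hvM : v ∉ M) (hv : v ∈ adjoin M {b}) : adjoin M {v} = adjoin M {b} := by
  have : CharP M p := (algebraMap M l).charP (algebraMap M l).injective p
  have hdim : ∀ {w : l}, w ∉ M → Module.finrank M (adjoin M {w}) = p := fun {w} hw => by
    rw [adjoin.finrank (isIntegral_of_pow_mem hMp w), minpoly_of_pow_char_mem (p := p)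
      (a := (⟨w ^ p, hMp w⟩ : M)) rfl (by rintro ⟨z, rfl⟩; exact hw z.2), natDegree_X_pow_sub_C]
  have : FiniteDimensional M (adjoin M {b}) :=
    adjoin.finiteDimensional (isIntegral_of_pow_mem hMp b)
  refine eq_of_le_of_finrank_eq (adjoin_simple_le_iff.2 hv) ?_
  rw [hdim hb, hdim hvM]

/-- If `b ∉ M` and `M` contains all `p`-th powers, then `b` is not a root of unity. -/
theorem pow_injective_of_notMem {M : Subfield l} (hMp : ∀ x : l, x ^ p ∈ M) {b : l} (hb : b ∉ M) :
    Function.Injective fun n : ℕ => b ^ n := by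
  have hp : p.Prime := Fact.out
  have hb0 : b ≠ 0 := fun h => hb (h ▸ M.zero_mem)
  have hnfin : ¬ IsOfFinOrder b := by
    intro hfin
    have hpos := hfin.orderOf_pos
    -- A finite order is prime to p by injectivity of Frobenius. Then b is the p-th power of one of
    -- its own powers, which would put it in `M`.
    have hcop : (orderOf b).Coprime p := by
      refine Nat.Coprime.symm ((Nat.Prime.coprime_iff_not_dvd hp).2 ?_)
      rintro ⟨k, hk⟩
      have h1 : b ^ k = 1 := by
        have h2 : frobenius l p (b ^ k) = frobenius l p 1 := by
          rw [frobenius_def, frobenius_def, ← pow_mul, mul_comm, ← hk, pow_orderOf_eq_one, one_pow]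
        exact frobenius_inj l p h2
      have hk0 : 0 < k := by
        rcases Nat.eq_zero_or_pos k with rfl | h
        · simp [hk] at hpos
        · exact h
      have := orderOf_le_of_pow_eq_one hk0 h1
      have := hp.two_le
      nlinarith
    have hone : 1 < orderOf b := by
      refine lt_of_le_of_ne hpos fun h => hb ?_
      rw [orderOf_eq_one_iff.1 h.symm]
      exact M.one_mem
    obtain ⟨m, hm⟩ := Nat.exists_mul_mod_eq_one_of_coprime hcop.symm hone
    refine hb ?_
    have h1 : b = (b ^ m) ^ p := by
      conv_lhs => rw [← pow_one b]
      rw [← pow_mul, ← pow_mod_orderOf b (m * p), mul_comm, hm.2]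
    rw [h1]
    exact hMp _
  have hle : ∀ i j : ℕ, i ≤ j → b ^ i = b ^ j → i = j := fun i j hij h => by
    by_contra hne
    refine hnfin (isOfFinOrder_iff_pow_eq_one.2 ⟨j - i, by omega, ?_⟩)
    rw [← Nat.add_sub_cancel' hij, pow_add] at h
    exact (mul_eq_left₀ (pow_ne_zero i hb0)).1 h.symm
  intro i j hij
  rcases le_total i j with h | h
  · exact hle i j h hij
  · exact (hle j i h hij.symm).symm

/-- Norm elements outside the ground field for a cyclic extension of a purely inseparable
extension. -/
theorem exists_norm_notMem (hT : HasTraceOne Γ (⊤ : Subfield l)) {M : Subfield l}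
    (hMp : ∀ x : l, x ^ p ∈ M) (hMs : ∀ s : Γ, ∀ x ∈ M, s • x ∈ M) {b : l} (hbM : b ∉ M)
    (hb : ∀ s : Γ, s • b = b) {n : ℕ} {x : Γ → ℤ} {y : Γ → Γ → ℤ} (h : IsCarry (p ^ (n + 1)) x y)
    (hx : IsLocallyConstant x) {σ : Γ} (hσ : ((p ^ (n + 1) : ℕ) : ℤ) ∣ x σ - 1) :
    ∃ N ∈ adjoin M {b}, N ∉ M ∧ (∀ s : Γ, s • N = N) ∧
      ∃ a : Γ → l, IsLocallyConstant a ∧ (∀ s, a s ∈ adjoin M {b}) ∧ (∀ s, a s ≠ 0) ∧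
        ∀ s t, mulCoboundary a s t = N ^ y s t := by
  have hp : p.Prime := Fact.out
  have : CharP M p := (algebraMap M l).charP (algebraMap M l).injective p
  obtain ⟨u₀, hu₀, hinj₀⟩ := exists_injOn_smul hT h hx hσ
  -- The p-th power lies in `M` and, Frobenius being injective, still has p^(n+1) distinct
  -- conjugates.
  set u := u₀ ^ p with hu_def
  have hu : ∀ s ∈ h.kernel, s • u = u := fun s hs => by rw [hu_def, smul_pow', hu₀ s hs]
  have huM : u ∈ M := hMp u₀
  have hinj : ∀ i ∈ Finset.range (p ^ (n + 1)), ∀ j ∈ Finset.range (p ^ (n + 1)),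
      σ ^ i • u = σ ^ j • u → i = j := fun i hi j hj hij => by
    refine hinj₀ (Finset.mem_range.1 hi) (Finset.mem_range.1 hj) (frobenius_inj l p ?_)
    simpa only [frobenius_def, hu_def, smul_pow'] using hij
  let c : ℕ → M := fun i => ⟨σ ^ i • u, hMs _ _ huM⟩
  -- The norm of t - u is f(t) for every invariant t in `E`, and D(f(t)) = f'(t) D t. As f is
  -- separable, f' is nonzero, so one of the infinitely many t = w^(pj+1), all of which satisfy D t
  -- = t, is not a root of f'. For this t the norm is not a constant of `D`, so it lies outside `M`.
  let f : M[X] := ∏ i ∈ Finset.range (p ^ (n + 1)), (X - C (c i))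
  have hsep : f.Separable := separable_prod_X_sub_C_iff'.2 fun i hi j hj hij =>
    hinj i hi j hj (congrArg Subtype.val hij)
  have hq0 : 0 < p ^ (n + 1) := pow_pos hp.pos _
  have hder : derivative f ≠ 0 := by
    intro h0
    have h1 : aeval (c 0) f = 0 := by
      simp only [f, map_prod]
      exact Finset.prod_eq_zero (Finset.mem_range.2 hq0) (by simp)
    exact hsep.aeval_derivative_ne_zero h1 (by simp [h0])
  let E := adjoin M {b}
  let w : E := AdjoinSimple.gen M b
  have hwp : w ^ p = algebraMap M E ⟨b ^ p, hMp b⟩ := Subtype.ext rfl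
  have hwM : w ∉ Set.range (algebraMap M E) := by
    rintro ⟨z, hz⟩
    have := congrArg (algebraMap E l) hz
    exact hbM ((show (z : l) = b from this) ▸ z.2)
  have htop : Algebra.adjoin M {w} = ⊤ := adjoin_gen_eq_top (isIntegral_of_pow_mem hMp b)
  obtain ⟨D, hD⟩ := exists_derivation_apply_eq_self hwp hwM htop
  have hb0 : b ≠ 0 := fun h => hbM (h ▸ M.zero_mem)
  have hw0 : w ≠ 0 := fun h => hb0 (congrArg Subtype.val h)
  have hDt : ∀ j : ℕ, D (w ^ (p * j) * w) = w ^ (p * j) * w := fun j => by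
    have : w ^ (p * j) = algebraMap M E (⟨b ^ p, hMp b⟩ ^ j) := by rw [pow_mul, hwp, map_pow]
    rw [D.leibniz, this, D.map_algebraMap, hD]
    simp
  obtain ⟨j, hj⟩ : ∃ j : ℕ, aeval (w ^ (p * j) * w) (derivative f) ≠ 0 := by
    by_contra! hcon
    have hinf : (Set.range fun j : ℕ => w ^ (p * j) * w).Infinite := by
      refine Set.infinite_range_of_injective fun i j hij => ?_
      simp only [← pow_succ] at hij
      have h1 : b ^ (p * i + 1) = b ^ (p * j + 1) := congrArg (algebraMap E l) hij
      have h2 := pow_injective_of_notMem hMp hbM h1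
      exact Nat.eq_of_mul_eq_mul_left hp.pos (Nat.succ.inj h2)
    refine hder ((map_eq_zero_iff (mapRingHom (algebraMap M E))
      (map_injective _ (algebraMap M E).injective)).1 (eq_zero_of_infinite_isRoot _
        (hinf.mono ?_)))
    rintro _ ⟨j, rfl⟩
    change IsRoot _ _
    rw [IsRoot, coe_mapRingHom, eval_map_algebraMap, hcon]
  set t : E := w ^ (p * j) * w with ht
  have htfix : ∀ s : Γ, s • (t : l) = t := fun s => by
    change s • (b ^ (p * j) * b) = b ^ (p * j) * b
    rw [smul_mul', smul_pow', hb]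
  let z : l := t - u
  have hz0 : z ≠ 0 := by
    intro hz
    have h1 : t = algebraMap M E (c 0) := Subtype.ext (by
      change (t : l) = σ ^ 0 • u
      rw [pow_zero, one_smul]
      exact sub_eq_zero.1 hz)
    have h2 := hDt j
    rw [← ht, h1, D.map_algebraMap, ← h1, ht] at h2
    exact mul_ne_zero (pow_ne_zero _ hw0) hw0 h2.symm
  have hzE : z ∈ E.toSubfield := E.sub_mem t.2 (E.algebraMap_mem ⟨u, huM⟩)
  have hz : ∀ s ∈ h.kernel, s • z = z := fun s hs => by rw [smul_sub, htfix, hu s hs]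
  obtain ⟨hNfix, a, halc, haE, ha0, ha⟩ := exists_coboundary_norm h hx hσ (M := E.toSubfield)
    (fun s x hx => smul_mem_adjoin_simple hMs hb s hx) hz0 hzE hz
  have hN : (∏ i ∈ Finset.range (p ^ (n + 1)), σ ^ i • z) = ((aeval t f : E) : l) := by
    have h1 : (aeval t f : E) = ∏ i ∈ Finset.range (p ^ (n + 1)), (t - algebraMap M E (c i)) := by
      simp [f, map_prod]
    have h2 : ((aeval t f : E) : l) = algebraMap E l (aeval t f) := rfl
    rw [h2, h1, map_prod]
    refine Finset.prod_congr rfl fun i _ => ?_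
    rw [smul_sub, htfix, map_sub]
    rfl
  rw [hN] at hNfix ha
  refine ⟨_, (aeval t f : E).2, fun hM => ?_, hNfix, a, halc, haE, ha0, ha⟩
  have h1 : aeval t f = algebraMap M E ⟨_, hM⟩ := Subtype.ext rfl
  have h2 : D (aeval t f) = 0 := by rw [h1, D.map_algebraMap]
  rw [D.map_aeval, hDt, smul_eq_mul] at h2
  exact mul_ne_zero hj (mul_ne_zero (pow_ne_zero _ hw0) hw0) h2

/-- The two-cochain `β` is, up to the coboundary of a cochain in `M`, the cocycle attached to a
character of `p`-power order and an invariant element of `M`. -/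
def IsSymbolCochain (p : ℕ) (M : Subfield l) (β : Γ → Γ → l) : Prop :=
  ∃ (n : ℕ) (x : Γ → ℤ) (y : Γ → Γ → ℤ) (c : l) (h : Γ → l), IsLocallyConstant x ∧
    IsCarry (p ^ n) x y ∧ c ∈ M ∧ c ≠ 0 ∧ (∀ s : Γ, s • c = c) ∧ IsLocallyConstant h ∧
    (∀ s, h s ∈ M) ∧ (∀ s, h s ≠ 0) ∧ ∀ s t, β s t = c ^ y s t * mulCoboundary h s t

/-- A symbol cochain over `M(b)` may be rewritten with an element generating `M(b)`. -/
theorem IsSymbolCochain.exists_notMem (hT : HasTraceOne Γ (⊤ : Subfield l)) {M : Subfield l}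
    (hMp : ∀ x : l, x ^ p ∈ M) (hMs : ∀ s : Γ, ∀ x ∈ M, s • x ∈ M) {b : l} (hbM : b ∉ M)
    (hb : ∀ s : Γ, s • b = b) {β : Γ → Γ → l}
    (hβ : IsSymbolCochain p (adjoin M {b}).toSubfield β) :
    ∃ (n : ℕ) (x : Γ → ℤ) (y : Γ → Γ → ℤ) (v : l) (h : Γ → l), IsLocallyConstant x ∧
      IsCarry (p ^ n) x y ∧ v ∈ adjoin M {b} ∧ v ∉ M ∧ (∀ s : Γ, s • v = v) ∧
      IsLocallyConstant h ∧ (∀ s, h s ∈ adjoin M {b}) ∧ (∀ s, h s ≠ 0) ∧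
      ∀ s t, β s t = v ^ y s t * mulCoboundary h s t := by
  obtain ⟨n, x, y, c, h, hx, hxy, hcE, hc0, hc, hh, hhE, hh0, hβ⟩ := hβ
  by_cases hcM : c ∈ M
  swap
  · exact ⟨n, x, y, c, h, hx, hxy, hcE, hcM, hc, hh, hhE, hh0, hβ⟩
  have hb0 : b ≠ 0 := fun h => hbM (h ▸ M.zero_mem)
  obtain ⟨m, d, x', σ, hx', hx'y, hσ⟩ := hxy.exists_surjective
  have hx'lc : IsLocallyConstant x' := by
    have := hx.comp fun k : ℤ => k / d
    rwa [show (fun k : ℤ => k / d) ∘ x = x' from funext fun s => (hx' s).symm] at this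
  -- For m = 0 the carries are an integral coboundary, so c can be exchanged for b at the cost of a
  -- coboundary. Otherwise c is multiplied by a norm N outside `M` from the cyclic extension; this
  -- changes the cocycle only by a coboundary, and cN ∉ M since c ∈ M.
  rcases m with _ | m
  · have hy : ∀ s t, y s t = x' s + x' t - x' (s * t) := fun s t => by
      have := hx'y s t
      simpa using this.symm
    have hcb0 : c / b ≠ 0 := div_ne_zero hc0 hb0
    have hcb : ∀ s : Γ, s • (c / b) = c / b := fun s => by rw [smul_div₀', hc, hb]
    have hbE : b ∈ adjoin M {b} := mem_adjoin_simple_self M b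
    refine ⟨0, x', y, b, fun s => (c / b) ^ x' s * h s, hx'lc, hx'y, hbE, hbM, hb,
      (hx'lc.comp fun k => (c / b) ^ k).mul hh,
      fun s => mul_mem (zpow_mem (div_mem hcE hbE) _) (hhE s),
      fun s => mul_ne_zero (zpow_ne_zero _ hcb0) (hh0 s), fun s t => ?_⟩
    rw [hβ, mulCoboundary_mul, mulCoboundary_zpow hcb0 hcb, ← hy, ← mul_assoc, ← mul_zpow,
      mul_div_cancel₀ _ hb0]
  · obtain ⟨N, hNE, hNM, hN, a, ha, haE, ha0, haN⟩ :=
      exists_norm_notMem hT hMp hMs hbM hb hx'y hx'lc hσ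
    have hN0 : N ≠ 0 := fun h => hNM (h ▸ M.zero_mem)
    refine ⟨m + 1, x', y, c * N, fun s => (a s)⁻¹ * h s, hx'lc, hx'y, mul_mem hcE hNE, fun hm => ?_,
      fun s => by rw [smul_mul', hc, hN], ha.inv.mul hh,
      fun s => mul_mem (inv_mem (haE s)) (hhE s),
      fun s => mul_ne_zero (inv_ne_zero (ha0 s)) (hh0 s), fun s t => ?_⟩
    · refine hNM ?_
      have := M.mul_mem (M.inv_mem hcM) hm
      rwa [inv_mul_cancel_left₀ hc0] at this
    · rw [hβ, mulCoboundary_mul, mulCoboundary_inv, haN, mul_zpow, mul_assoc,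
        mul_inv_cancel_left₀ (zpow_ne_zero _ hN0)]

variable [LocallyConstantSMul Γ l]

/-- Rewrite the symbol with an element v generating M(b). Since characters lift, y = p y' - ∂w, so
v^y equals (v^p)^y' up to a coboundary, where v^p ∈ M. What is left over is a coboundary from M(v)
with values in `M`, hence a symbol with the same element v^p. Because the element is the same, the
two characters add up and a single symbol remains. -/
theorem IsSymbolCochain.descend (hT : HasTraceOne Γ (⊤ : Subfield l))
    (hAS : ∀ a : l, ∃ x, x ^ p - x = a) {M : Subfield l}
    (hMp : ∀ x : l, x ^ p ∈ M) (hMs : ∀ s : Γ, ∀ x ∈ M, s • x ∈ M) {b : l} (hbM : b ∉ M)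
    (hb : ∀ s : Γ, s • b = b) {β : Γ → Γ → l} (hβM : ∀ s t, β s t ∈ M)
    (hβ : IsSymbolCochain p (adjoin M {b}).toSubfield β) : IsSymbolCochain p M β := by
  have hp : p.Prime := Fact.out
  obtain ⟨n, x, y, v, h, hx, hxy, hvE, hvM, hv, hh, hhE, hh0, hβ⟩ :=
    hβ.exists_notMem hT hMp hMs hbM hb
  have hv0 : v ≠ 0 := fun h => hvM (h ▸ M.zero_mem)
  rw [← adjoin_simple_eq_of_pow_mem hMp hbM hvM hvE] at hhE
  obtain ⟨w, hw, hyw⟩ := hxy.exists_lift hT hAS (pow_ne_zero n hp.ne_zero) hx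
  choose y' hy' using hyw
  let h₁ : Γ → l := fun s => v ^ (-w s) * h s
  have hvp0 : v ^ p ≠ 0 := pow_ne_zero p hv0
  have key : ∀ s t, β s t = (v ^ p) ^ y' s t * mulCoboundary h₁ s t := fun s t => by
    rw [hβ, mulCoboundary_mul, mulCoboundary_zpow hv0 hv, ← mul_assoc, ← zpow_natCast, ← zpow_mul,
      ← zpow_add₀ hv0, ← hy']
    congr 2
    ring
  obtain ⟨η, y'', h₂, hη, hh₂, hηy, hh₂M, hh₂0, hsymb⟩ := exists_symbol_of_coboundary_mem hMp hMs
    hvM hv hT hAS (g := h₁) ((hw.comp fun k => v ^ (-k)).mul hh)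
    (fun s => mul_ne_zero (zpow_ne_zero _ hv0) (hh0 s))
    (fun s => mul_mem (zpow_mem (mem_adjoin_simple_self M v) _) (hhE s)) (fun s t => by
      have h1 : mulCoboundary h₁ s t = ((v ^ p) ^ y' s t)⁻¹ * β s t := by
        rw [key, inv_mul_cancel_left₀ (zpow_ne_zero _ hvp0)]
      change mulCoboundary h₁ s t ∈ M
      rw [h1]
      exact mul_mem (inv_mem (zpow_mem (hMp v) _)) (hβM s t))
  -- x + p^n w is a character modulo p^(n+1) with carries y', and p^n η is the character η of order
  -- p viewed modulo p^(n+1), with carries y''.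
  refine ⟨n + 1, fun s => x s + (p ^ n : ℕ) * w s + (p ^ n : ℕ) * η s, fun s t => y' s t + y'' s t,
    v ^ p, h₂, ((hx.prodMk hw).prodMk hη).comp fun z => z.1.1 + (p ^ n : ℕ) * z.1.2 +
      (p ^ n : ℕ) * z.2, fun s t => ?_, hMp v, hvp0, fun s => by rw [smul_pow', hv], hh₂, hh₂M,
    hh₂0, fun s t => ?_⟩
  · have h1 := hxy s t
    have h2 := hηy s t
    have h3 := hy' s t
    push_cast at h1 ⊢
    linear_combination h1 + (p : ℤ) ^ n * h2 + (p : ℤ) ^ n * h3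
  · rw [key, zpow_add₀ hvp0, mul_assoc]
    congr 1
    exact hsymb s t

/-- Induction on `B` with `M` varying: the induction hypothesis is used over M(b), and
`IsSymbolCochain.descend` returns to `M`. For empty `B` the cochain g is already in `M`, which is a
symbol with c = 1. -/
theorem isSymbolCochain_of_coboundary (hT : HasTraceOne Γ (⊤ : Subfield l))
    (hAS : ∀ a : l, ∃ x, x ^ p - x = a) (B : Finset l) (hB : ∀ b ∈ B, ∀ s : Γ, s • b = b)
    {M : Subfield l} (hMp : ∀ x : l, x ^ p ∈ M) (hMs : ∀ s : Γ, ∀ x ∈ M, s • x ∈ M)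
    {β : Γ → Γ → l} (hβM : ∀ s t, β s t ∈ M) {g : Γ → l} (hg : IsLocallyConstant g)
    (hg0 : ∀ s, g s ≠ 0) (hgB : ∀ s, g s ∈ Subfield.closure (M ∪ B : Set l))
    (hβ : ∀ s t, β s t = mulCoboundary g s t) : IsSymbolCochain p M β := by
  classical
  induction B using Finset.induction_on generalizing M with
  | empty =>
    refine ⟨0, 0, 0, 1, g, IsLocallyConstant.const 0, fun s t => by simp, M.one_mem, one_ne_zero,
      fun s => smul_one s, hg, fun s => ?_, hg0, fun s t => by simpa using hβ s t⟩
    have := hgB s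
    rwa [Finset.coe_empty, Set.union_empty, Subfield.closure_eq] at this
  | insert b B hbB ih =>
    have hBfix : ∀ b ∈ B, ∀ s : Γ, s • b = b := fun c hc => hB c (Finset.mem_insert_of_mem hc)
    have hb : ∀ s : Γ, s • b = b := hB b (Finset.mem_insert_self b B)
    by_cases hbM : b ∈ M
    · refine ih hBfix hMp hMs hβM fun s => ?_
      have := hgB s
      rwa [Finset.coe_insert, Set.union_insert, Set.insert_eq_of_mem (Set.mem_union_left (B : Set l) hbM)] at this
    · have hle : M ≤ (adjoin M {b}).toSubfield := fun x hx =>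
        (adjoin M {b}).algebraMap_mem ⟨x, hx⟩
      refine IsSymbolCochain.descend hT hAS hMp hMs hbM hb hβM (ih hBfix (fun x => hle (hMp x))
        (fun s x hx => smul_mem_adjoin_simple hMs hb s hx) (fun s t => hle (hβM s t)) fun s => ?_)
      refine Subfield.closure_le.2 ?_ (hgB s)
      rw [Finset.coe_insert]
      rintro x (hx | rfl | hx)
      · exact Subfield.subset_closure (Or.inl (hle hx))
      · exact Subfield.subset_closure (Or.inl (mem_adjoin_simple_self M x))
      · exact Subfield.subset_closure (Or.inr hx)

/-- A two-cocycle whose `p`-th power is trivial is cohomologous to the cocycle of a symbol. -/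
theorem exists_symbol_of_pow_coboundary (hT : HasTraceOne Γ (⊤ : Subfield l))
    (hAS : ∀ a : l, ∃ x, x ^ p - x = a)
    (hS : ∀ x : l, ∃ B : Finset l, (∀ b ∈ B, ∀ s : Γ, s • b = b) ∧
      x ∈ Subfield.closure (Set.range (frobenius l p) ∪ B : Set l))
    {α : Γ → Γ → l} {g : Γ → l} (hg : IsLocallyConstant g)
    (hg0 : ∀ s, g s ≠ 0) (hα : ∀ s t, α s t ^ p = mulCoboundary g s t) :
    IsSymbolCochain p (⊤ : Subfield l) α := by
  classical
  choose B hBfix hB using hS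
  -- The p-th power of α has values in M = l^p and is trivial over M(B); `B` can be finite because g
  -- takes finitely many values. Frobenius is injective and equivariant, so the resulting symbol
  -- over l^p yields one for α.
  obtain ⟨n, x, y, c, h, hx, hxy, hcM, hc0, hc, hh, hhM, hh0, hβ⟩ :=
    isSymbolCochain_of_coboundary hT hAS (hg.range_finite.toFinset.biUnion B)
      (by
        intro b hb
        obtain ⟨x, -, hx⟩ := Finset.mem_biUnion.1 hb
        exact hBfix x b hx) (M := (frobenius l p).fieldRange) (fun x => ⟨x, rfl⟩)
      (by
        rintro s _ ⟨x, rfl⟩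
        exact ⟨s • x, by rw [frobenius_def, frobenius_def, smul_pow']⟩)
      (β := fun s t => α s t ^ p) (fun s t => ⟨α s t, rfl⟩) hg hg0
      (fun s => by
        refine Subfield.closure_mono ?_ (hB (g s))
        rw [RingHom.coe_fieldRange]
        refine Set.union_subset_union_right _ ?_
        exact_mod_cast Finset.subset_biUnion_of_mem B
          (hg.range_finite.mem_toFinset.2 ⟨s, rfl⟩)) hα
  obtain ⟨c, rfl⟩ := hcM
  choose k hk using hhM
  have hinj := frobenius_inj l p
  refine ⟨n, x, y, c, k, hx, hxy, trivial, fun h0 => hc0 (by rw [h0, map_zero]), fun s => ?_, ?_,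
    fun _ => trivial, fun s h0 => hh0 s (by rw [← hk, h0, map_zero]), fun s t => ?_⟩
  · refine hinj ?_
    have := hc s
    rw [frobenius_def, smul_pow'] at this
    exact this
  · refine IsLocallyConstant.desc k (frobenius l p) ?_ hinj
    rwa [show frobenius l p ∘ k = h from funext hk]
  · refine hinj ?_
    rw [map_mul, map_zpow₀]
    refine (hβ s t).trans ?_
    congr 1
    simp only [mulCoboundary, map_mul, map_div₀, hk]
    rw [← hk t, frobenius_def, frobenius_def, smul_pow']

end Tower

/-! ### Galois descent and Hilbert 90 for GL_n over an infinite Galois extension. -/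

section GaloisDescent

variable {K Ω : Type*} [Field K] [Field Ω] [Algebra K Ω]

instance [IsGalois K Ω] : LocallyConstantSMul (Ω ≃ₐ[K] Ω) Ω where
  isLocallyConstant_smul x := by
    rw [IsLocallyConstant.iff_exists_open]
    intro g
    refine ⟨(fun h => g⁻¹ * h) ⁻¹' (MulAction.stabilizer (Ω ≃ₐ[K] Ω) x : Set (Ω ≃ₐ[K] Ω)),
      (stabilizer_isOpen_of_isIntegral x).preimage (continuous_const_mul g⁻¹), ?_, fun h hh => ?_⟩
    · simp
    · have : (g⁻¹ * h) • x = x := hh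
      calc h • x = g • (g⁻¹ * h) • x := by rw [smul_smul, mul_inv_cancel_left]
        _ = g • x := by rw [this]

/-- Galois descent: the vectors fixed by a smooth semilinear action of the Galois group span. -/
theorem span_fixed_eq_top [IsGalois K Ω] {V : Type*} [AddCommGroup V] [Module Ω V]
    (ρ : (Ω ≃ₐ[K] Ω) →* AddMonoid.End V)
    (hsl : ∀ s (a : Ω) v, ρ s (a • v) = s a • ρ s v)
    (hlc : ∀ v, IsLocallyConstant fun s => ρ s v) :
    Submodule.span Ω {v : V | ∀ s, ρ s v = v} = ⊤ := by
  by_contra hne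
  obtain ⟨ℓ, hℓ0, hℓ⟩ := Submodule.exists_le_ker_of_lt_top _ (lt_top_iff_ne_top.2 hne)
  refine hℓ0 (LinearMap.ext fun v => ?_)
  obtain ⟨N, hNo, hN⟩ := IsLocallyConstant.exists_open_subgroup (Y := Unit)
    (f := fun z : Unit × (Ω ≃ₐ[K] Ω) => ρ z.2 v)
    ((hlc v).comp_continuous (f := fun z : Unit × (Ω ≃ₐ[K] Ω) => z.2) continuous_snd)
  replace hN : ∀ n ∈ N, ρ n v = v := fun n hn => by simpa using hN () 1 n hn
  let L := IntermediateField.fixedField N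
  have := finite_quotient_of_isOpen N hNo
  have := Fintype.ofFinite ((Ω ≃ₐ[K] Ω) ⧸ N)
  let φ : (Ω ≃ₐ[K] Ω) ⧸ N → (L →* Ω) := fun q =>
    (((q.out : Ω ≃ₐ[K] Ω) : Ω →ₐ[K] Ω).comp L.val : L →ₐ[K] Ω)
  have hφ : Function.Injective φ := by
    intro q q' h
    rw [← q.out_eq', ← q'.out_eq']
    refine QuotientGroup.eq.2 ?_
    have h1 : (q.out)⁻¹ * q'.out ∈ L.fixingSubgroup := by
      rw [IntermediateField.mem_fixingSubgroup_iff]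
      intro x hx
      have := DFunLike.congr_fun h ⟨x, hx⟩
      change q.out x = q'.out x at this
      rw [AlgEquiv.mul_apply, ← this, ← AlgEquiv.mul_apply, inv_mul_cancel, AlgEquiv.one_apply]
    have h2 : L.fixingSubgroup = N := InfiniteGalois.fixingSubgroup_fixedField
      (⟨N, N.isClosed_of_isOpen hNo⟩ : ClosedSubgroup (Ω ≃ₐ[K] Ω))
    rwa [h2] at h1
  -- The functional ℓ kills fixed vectors, in particular the traces of x v for x in `L`. This is a
  -- linear relation between distinct embeddings of `L` with coefficients ℓ(q v), so Dedekind's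
  -- independence forces ℓ(v) = 0.
  have hsum : ∀ x : L, ∑ q, ℓ (ρ q.out v) * φ q x = 0 := by
    intro x
    have hx : ∀ n ∈ N, (n : Ω ≃ₐ[K] Ω) (x : Ω) = x := fun n hn => x.2 ⟨n, hn⟩
    have h1 : ∀ g, ∑ q : (Ω ≃ₐ[K] Ω) ⧸ N, ρ (g * q.out) ((x : Ω) • v) =
        ∑ q : (Ω ≃ₐ[K] Ω) ⧸ N, ρ q.out ((x : Ω) • v) := fun g =>
      sum_out_mul_left N (fun g => ρ g ((x : Ω) • v)) (fun g n hn => by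
        rw [map_mul]
        change ρ g (ρ n ((x : Ω) • v)) = _
        rw [hsl, hN n hn, hx n hn]) g
    have h2 : ∑ q : (Ω ≃ₐ[K] Ω) ⧸ N, ρ q.out ((x : Ω) • v) ∈ LinearMap.ker ℓ := by
      refine hℓ (Submodule.subset_span fun s => ?_)
      rw [map_sum]
      rw [← h1 s]
      refine Finset.sum_congr rfl fun q _ => ?_
      rw [map_mul]
      rfl
    rw [LinearMap.mem_ker, map_sum] at h2
    rw [← h2]
    refine Finset.sum_congr rfl fun q _ => ?_
    rw [hsl, map_smul, smul_eq_mul, mul_comm]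
    rfl
  have hli := (linearIndependent_monoidHom L Ω).comp φ hφ
  have hz := Fintype.linearIndependent_iff.1 hli (fun q => ℓ (ρ q.out v)) (by
    ext x
    simpa [Finset.sum_apply] using hsum x) ((1 : Ω ≃ₐ[K] Ω) : (Ω ≃ₐ[K] Ω) ⧸ N)
  have h1 : ((1 : Ω ≃ₐ[K] Ω) : (Ω ≃ₐ[K] Ω) ⧸ N).out ∈ N := by
    obtain ⟨n, hn⟩ := QuotientGroup.mk_out_eq_mul N 1
    rw [hn, one_mul]
    exact n.2
  rw [hN _ h1] at hz
  simpa using hz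

variable {ι : Type*} [Fintype ι] [DecidableEq ι]

/-- The entrywise action of the Galois group on matrices. -/
abbrev galMatrix (s : Ω ≃ₐ[K] Ω) : Matrix ι ι Ω →ₐ[K] Matrix ι ι Ω :=
  (s : Ω →ₐ[K] Ω).mapMatrix

theorem galMatrix_mul (s t : Ω ≃ₐ[K] Ω) (X : Matrix ι ι Ω) :
    galMatrix (s * t) X = galMatrix s (galMatrix t X) := by
  ext; simp

theorem galMatrix_one (X : Matrix ι ι Ω) : galMatrix (1 : Ω ≃ₐ[K] Ω) X = X := by
  ext; simp

theorem galMatrix_smul (s : Ω ≃ₐ[K] Ω) (a : Ω) (X : Matrix ι ι Ω) :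
    galMatrix s (a • X) = s a • galMatrix s X := by
  ext; simp

theorem isLocallyConstant_pi {X Y κ : Type*} [TopologicalSpace X] [Finite κ] {f : X → κ → Y}
    (hf : ∀ k, IsLocallyConstant fun x => f x k) : IsLocallyConstant f := by
  rw [IsLocallyConstant.iff_eventually_eq]
  intro x
  have := Filter.eventually_all.2 fun k => (hf k).eventually_eq x
  exact this.mono fun y hy => funext hy

theorem isLocallyConstant_galMatrix [IsGalois K Ω] (X : Matrix ι ι Ω) :
    IsLocallyConstant fun s : Ω ≃ₐ[K] Ω => galMatrix s X :=
  isLocallyConstant_pi fun i => isLocallyConstant_pi fun j =>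
    LocallyConstantSMul.isLocallyConstant_smul (Γ := Ω ≃ₐ[K] Ω) (X i j)

/-- Hilbert's Theorem 90 for the general linear group. -/
theorem exists_units_of_matrix_cocycle [IsGalois K Ω] (u : (Ω ≃ₐ[K] Ω) → Matrix ι ι Ω)
    (hlc : IsLocallyConstant u) (hu : ∀ s, IsUnit (u s))
    (hmul : ∀ s t, u s * galMatrix s (u t) = u (s * t)) :
    ∃ g : (Matrix ι ι Ω)ˣ, ∀ s, u s * galMatrix s (g : Matrix ι ι Ω) = g := by
  have hu1 : u 1 = 1 := by
    have := hmul 1 1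
    rw [galMatrix_one, mul_one] at this
    exact (hu 1).mul_left_cancel (by rw [this, mul_one])
  have hcomp : ∀ (s t : Ω ≃ₐ[K] Ω) (v : ι → Ω),
      s ∘ (u t).mulVec (t ∘ v) = (galMatrix s (u t)).mulVec ((s * t : Ω ≃ₐ[K] Ω) ∘ v) := by
    intro s t v
    ext i
    simp [Matrix.mulVec, dotProduct]
  -- The semilinear action twisted by u; a basis of fixed vectors supplies the columns of g.
  let ρ : (Ω ≃ₐ[K] Ω) →* AddMonoid.End (ι → Ω) :=
    { toFun := fun s =>
        { toFun := fun v => (u s).mulVec (s ∘ v)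
          map_zero' := by
            have : s ∘ (0 : ι → Ω) = 0 := by ext; simp
            rw [this, Matrix.mulVec_zero]
          map_add' := fun v w => by
            have : s ∘ (v + w) = s ∘ v + s ∘ w := by ext; simp
            rw [this, Matrix.mulVec_add] }
      map_one' := by
        refine AddMonoidHom.ext fun v => ?_
        change (u 1).mulVec ((1 : Ω ≃ₐ[K] Ω) ∘ v) = v
        rw [hu1, Matrix.one_mulVec]
        rfl
      map_mul' := fun s t => by
        refine AddMonoidHom.ext fun v => ?_
        change (u (s * t)).mulVec _ = (u s).mulVec (s ∘ (u t).mulVec (t ∘ v))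
        rw [hcomp, Matrix.mulVec_mulVec, hmul] }
  have hspan := span_fixed_eq_top ρ (fun s a v => by
    have : s ∘ (a • v) = s a • (s ∘ v) := by ext; simp
    change (u s).mulVec (s ∘ (a • v)) = s a • (u s).mulVec (s ∘ v)
    rw [this, Matrix.mulVec_smul]) (fun v => by
      have h1 : IsLocallyConstant fun s : Ω ≃ₐ[K] Ω => (s ∘ v : ι → Ω) :=
        isLocallyConstant_pi fun i =>
          LocallyConstantSMul.isLocallyConstant_smul (Γ := Ω ≃ₐ[K] Ω) (v i)
      exact hlc.comp₂ h1 fun X v => X.mulVec v)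
  let b₀ := Module.Basis.ofSpan hspan.ge
  let b := b₀.reindex (b₀.indexEquiv (Pi.basisFun Ω ι))
  have hb : ∀ i s, ρ s (b i) = b i := fun i s => by
    rw [Module.Basis.reindex_apply]
    exact Module.Basis.ofSpan_subset hspan.ge (Set.mem_range_self _) s
  let c := Pi.basisFun Ω ι
  refine ⟨⟨c.toMatrix b, b.toMatrix c, c.toMatrix_mul_toMatrix_flip b,
    b.toMatrix_mul_toMatrix_flip c⟩, fun s => ?_⟩
  ext i j
  exact congrFun (hb j s) i

end GaloisDescent

/-! ### Central simple algebras as twisted forms of matrix algebras. -/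

section TwistedForms

variable {K Ω : Type*} [Field K] [Field Ω] [Algebra K Ω]

/-- Skolem–Noether for matrix algebras. -/
theorem exists_units_conj_of_matrix_algEquiv {ι : Type*} [Fintype ι] [DecidableEq ι]
    (f : Matrix ι ι Ω ≃ₐ[Ω] Matrix ι ι Ω) :
    ∃ g : (Matrix ι ι Ω)ˣ, ∀ X, f X * g = g * X := by
  let e := Matrix.toLinAlgEquiv' (R := Ω) (n := ι)
  obtain ⟨T, hT⟩ := ((e.symm.trans f).trans e).eq_linearEquivConjAlgEquiv
  refine ⟨⟨e.symm T.toLinearMap, e.symm T.symm.toLinearMap, ?_, ?_⟩, fun X => ?_⟩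
  · rw [← map_mul, Module.End.mul_eq_comp, LinearEquiv.comp_symm]
    exact map_one _
  · rw [← map_mul, Module.End.mul_eq_comp, LinearEquiv.symm_comp]
    exact map_one _
  · apply e.injective
    have := DFunLike.congr_fun hT (e X)
    simp only [AlgEquiv.trans_apply, AlgEquiv.symm_apply_apply] at this
    change e (f X * e.symm T.toLinearMap) = e (e.symm T.toLinearMap * X)
    rw [map_mul, map_mul, this]
    ext
    simp [LinearEquiv.conjAlgEquiv_apply, Module.End.mul_apply]

section Split

variable {A : Type*} [Ring A] [Algebra K A]
  {ι : Type*} [Fintype ι] [DecidableEq ι]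

/-- The linear extension of a representation of `A` by matrices over an extension field. -/
noncomputable def extendScalars (θ : A →ₐ[K] Matrix ι ι Ω) : Ω ⊗[K] A →ₐ[Ω] Matrix ι ι Ω :=
  Algebra.TensorProduct.lift (Algebra.ofId Ω _) θ fun x y => Algebra.commutes x (θ y)

theorem extendScalars_one_tmul (θ : A →ₐ[K] Matrix ι ι Ω) (a : A) :
    extendScalars θ (1 ⊗ₜ a) = θ a := by
  exact (Algebra.TensorProduct.lift_tmul _ _ _ _ _).trans (by simp)

variable [Algebra.IsCentral K A] [IsSimpleRing A] [FiniteDimensional K A]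

theorem nonempty_of_finrank_eq_sq (hd : Module.finrank K A = Fintype.card ι ^ 2) : Nonempty ι := by
  rw [← Fintype.card_pos_iff]
  have : 0 < Module.finrank K A := Module.finrank_pos
  by_contra h
  simp [hd, Nat.eq_zero_of_not_pos h] at this

theorem extendScalars_bijective (hd : Module.finrank K A = Fintype.card ι ^ 2)
    (θ : A →ₐ[K] Matrix ι ι Ω) : Function.Bijective (extendScalars θ) := by
  have := nonempty_of_finrank_eq_sq hd
  have hinj : Function.Injective (extendScalars θ) := (extendScalars θ).toRingHom.injective
  refine ⟨hinj, (LinearMap.injective_iff_surjective_of_finrank_eq_finrank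
    (f := (extendScalars θ).toLinearMap) ?_).1 hinj⟩
  rw [Module.finrank_baseChange, Module.finrank_matrix, hd, Module.finrank_self, mul_one, sq]

/-- Two representations of a central simple algebra of dimension `d ^ 2` by matrices of size `d`
are conjugate. -/
theorem exists_units_conj (hd : Module.finrank K A = Fintype.card ι ^ 2)
    (θ θ' : A →ₐ[K] Matrix ι ι Ω) :
    ∃ g : (Matrix ι ι Ω)ˣ, ∀ a, θ' a * g = g * θ a := by
  -- By dimension both representations extend to isomorphisms from Ω ⊗ A onto the matrix algebra;
  -- they differ by an automorphism, which is inner.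
  let e := AlgEquiv.ofBijective _ (extendScalars_bijective hd θ)
  let e' := AlgEquiv.ofBijective _ (extendScalars_bijective hd θ')
  obtain ⟨g, hg⟩ := exists_units_conj_of_matrix_algEquiv (e.symm.trans e')
  refine ⟨g, fun a => ?_⟩
  have := hg (θ a)
  have h1 : e.symm (θ a) = 1 ⊗ₜ a := by
    rw [AlgEquiv.symm_apply_eq]
    exact (extendScalars_one_tmul θ a).symm
  rw [AlgEquiv.trans_apply, h1] at this
  rwa [← extendScalars_one_tmul θ']

theorem exists_eq_smul_one_of_commute (hd : Module.finrank K A = Fintype.card ι ^ 2)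
    (θ : A →ₐ[K] Matrix ι ι Ω) {X : Matrix ι ι Ω} (hX : ∀ a, X * θ a = θ a * X) :
    ∃ c : Ω, X = c • 1 := by
  have := nonempty_of_finrank_eq_sq hd
  have : X ∈ Subalgebra.center Ω (Matrix ι ι Ω) := by
    rw [Subalgebra.mem_center_iff]
    intro Y
    obtain ⟨z, rfl⟩ := (extendScalars_bijective hd θ).2 Y
    induction z with
    | zero => simp
    | add y z hy hz => rw [map_add, add_mul, mul_add, hy, hz]
    | tmul w a =>
      have : extendScalars θ (w ⊗ₜ a) = w • θ a :=
        (Algebra.TensorProduct.lift_tmul _ _ _ _ _).trans (Algebra.smul_def _ _).symm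
      rw [this, smul_mul_assoc, mul_smul_comm, hX]
  obtain ⟨c, hc⟩ := (Algebra.IsCentral.mem_center_iff Ω).1 this
  exact ⟨c, by rw [hc, Algebra.algebraMap_eq_smul_one]⟩

end Split

/-- The data `(θ, u)` present the algebra `A` as a form of a matrix algebra over `Ω`, twisted by
the two-cochain `α` of the Galois group. -/
structure IsTwistedForm {A : Type*} [Ring A] [Algebra K A] {ι : Type*} [Fintype ι] [DecidableEq ι]
    (θ : A →ₐ[K] Matrix ι ι Ω) (u : (Ω ≃ₐ[K] Ω) → Matrix ι ι Ω)
    (α : (Ω ≃ₐ[K] Ω) → (Ω ≃ₐ[K] Ω) → Ω) : Prop where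
  finrank_eq : Module.finrank K A = Fintype.card ι ^ 2
  isLocallyConstant : IsLocallyConstant u
  isUnit : ∀ s, IsUnit (u s)
  intertwine : ∀ s a, u s * galMatrix s (θ a) = θ a * u s
  mul : ∀ s t, u s * galMatrix s (u t) = α s t • u (s * t)

namespace IsTwistedForm

variable {A : Type*} [Ring A] [Algebra K A] {ι : Type*} [Fintype ι] [DecidableEq ι]
  {θ : A →ₐ[K] Matrix ι ι Ω} {u : (Ω ≃ₐ[K] Ω) → Matrix ι ι Ω}
  {α : (Ω ≃ₐ[K] Ω) → (Ω ≃ₐ[K] Ω) → Ω}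

theorem smul_cancel [Nonempty ι] {X : Matrix ι ι Ω} (hX : IsUnit X) {a b : Ω}
    (h : a • X = b • X) : a = b := by
  obtain ⟨i⟩ := ‹Nonempty ι›
  have h1 : (a • (1 : Matrix ι ι Ω)) = b • 1 := by
    refine hX.mul_right_cancel ?_
    rw [smul_mul_assoc, smul_mul_assoc, one_mul, h]
  simpa using congr_fun (congr_fun h1 i) i

theorem isUnit_galMatrix (h : IsTwistedForm θ u α) (s t : Ω ≃ₐ[K] Ω) :
    IsUnit (galMatrix s (u t)) :=
  (h.isUnit t).map (galMatrix s)

theorem ne_zero [Nonempty ι] (h : IsTwistedForm θ u α) (s t : Ω ≃ₐ[K] Ω) : α s t ≠ 0 := by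
  intro h0
  have := h.mul s t
  rw [h0, zero_smul] at this
  exact ((h.isUnit s).mul (h.isUnit_galMatrix s t)).ne_zero this

theorem cocycle [Nonempty ι] (h : IsTwistedForm θ u α) (s t r : Ω ≃ₐ[K] Ω) :
    s (α t r) * α s (t * r) = α (s * t) r * α s t := by
  refine smul_cancel (h.isUnit (s * (t * r))) ?_
  calc (s (α t r) * α s (t * r)) • u (s * (t * r))
      = s (α t r) • (u s * galMatrix s (u (t * r))) := by rw [h.mul s, smul_smul]
    _ = u s * galMatrix s (u t * galMatrix t (u r)) := by
        rw [h.mul t r, galMatrix_smul, mul_smul_comm]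
    _ = (u s * galMatrix s (u t)) * galMatrix (s * t) (u r) := by
        rw [map_mul, galMatrix_mul, mul_assoc]
    _ = (α (s * t) r * α s t) • u (s * (t * r)) := by
        rw [h.mul, smul_mul_assoc, h.mul, smul_smul, mul_assoc s, mul_comm (α s t)]

theorem isLocallyConstant_cochain [IsGalois K Ω] [Nonempty ι] (h : IsTwistedForm θ u α) :
    IsLocallyConstant fun z : (Ω ≃ₐ[K] Ω) × (Ω ≃ₐ[K] Ω) => α z.1 z.2 := by
  obtain ⟨i⟩ := ‹Nonempty ι›
  have h1 : ∀ z : (Ω ≃ₐ[K] Ω) × (Ω ≃ₐ[K] Ω),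
      α z.1 z.2 = (u z.1 * galMatrix z.1 (u z.2) * (u (z.1 * z.2))⁻¹) i i := fun z => by
    rw [h.mul, smul_mul_assoc, Matrix.mul_nonsing_inv _ ((Matrix.isUnit_iff_isUnit_det _).1
      (h.isUnit _))]
    simp
  have hu1 : IsLocallyConstant fun z : (Ω ≃ₐ[K] Ω) × (Ω ≃ₐ[K] Ω) => u z.1 :=
    h.isLocallyConstant.comp_continuous continuous_fst
  have hu2 : IsLocallyConstant fun z : (Ω ≃ₐ[K] Ω) × (Ω ≃ₐ[K] Ω) => u (z.1 * z.2) :=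
    h.isLocallyConstant.comp_continuous continuous_mul
  have hu3 : IsLocallyConstant fun z : (Ω ≃ₐ[K] Ω) × (Ω ≃ₐ[K] Ω) => galMatrix z.1 (u z.2) :=
    isLocallyConstant_pi fun j => isLocallyConstant_pi fun k =>
      IsLocallyConstant.smul_of_continuous (Γ := Ω ≃ₐ[K] Ω) (φ := Prod.fst) continuous_fst
        ((h.isLocallyConstant.comp_continuous continuous_snd).comp fun X => X j k)
  simp only [h1]
  exact (hu1.prodMk (hu3.prodMk hu2)).comp fun X => (X.1 * X.2.1 * X.2.2⁻¹) i i

theorem kronecker {B : Type*} [Ring B] [Algebra K B] {κ : Type*} [Fintype κ] [DecidableEq κ]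
    {η : B →ₐ[K] Matrix κ κ Ω} {v : (Ω ≃ₐ[K] Ω) → Matrix κ κ Ω}
    {β : (Ω ≃ₐ[K] Ω) → (Ω ≃ₐ[K] Ω) → Ω}
    (h : IsTwistedForm θ u α) (h' : IsTwistedForm η v β) :
    ∃ ψ : A ⊗[K] B →ₐ[K] Matrix (ι × κ) (ι × κ) Ω,
      IsTwistedForm ψ (fun s => Matrix.kroneckerMap (· * ·) (u s) (v s))
        (fun s t => α s t * β s t) := by
  let f : A →ₐ[K] Matrix (ι × κ) (ι × κ) Ω := AlgHom.ofLinearMap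
    { toFun := fun a => Matrix.kroneckerMap (· * ·) (θ a) (1 : Matrix κ κ Ω)
      map_add' := fun a b => by rw [map_add, Matrix.add_kronecker]
      map_smul' := fun c a => by rw [map_smul, Matrix.smul_kronecker]; rfl }
    (by simp) (fun a b => by simp [← Matrix.mul_kronecker_mul])
  let g : B →ₐ[K] Matrix (ι × κ) (ι × κ) Ω := AlgHom.ofLinearMap
    { toFun := fun a => Matrix.kroneckerMap (· * ·) (1 : Matrix ι ι Ω) (η a)
      map_add' := fun a b => by rw [map_add, Matrix.kronecker_add]
      map_smul' := fun c a => by rw [map_smul, Matrix.kronecker_smul]; rfl }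
    (by simp) (fun a b => by simp [← Matrix.mul_kronecker_mul])
  have hf : ∀ a, f a = Matrix.kroneckerMap (· * ·) (θ a) (1 : Matrix κ κ Ω) := fun _ => rfl
  have hg : ∀ b, g b = Matrix.kroneckerMap (· * ·) (1 : Matrix ι ι Ω) (η b) := fun _ => rfl
  have hgal : ∀ (s : Ω ≃ₐ[K] Ω) (X : Matrix ι ι Ω) (Y : Matrix κ κ Ω),
      galMatrix s (Matrix.kroneckerMap (· * ·) X Y) =
        Matrix.kroneckerMap (· * ·) (galMatrix s X) (galMatrix s Y) := fun s X Y => by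
    ext; simp
  refine ⟨Algebra.TensorProduct.lift f g fun a b => ?_, ?_, ?_, fun s => ?_, fun s z => ?_,
    fun s t => ?_⟩
  · rw [commute_iff_eq, hf, hg, ← Matrix.mul_kronecker_mul, ← Matrix.mul_kronecker_mul]
    simp
  · rw [Module.finrank_tensorProduct, h.finrank_eq, h'.finrank_eq, Fintype.card_prod, mul_pow]
  · exact h.isLocallyConstant.comp₂ h'.isLocallyConstant fun X Y => Matrix.kroneckerMap (· * ·) X Y
  · obtain ⟨X, hX⟩ := h.isUnit s
    obtain ⟨Y, hY⟩ := h'.isUnit s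
    rw [← hX, ← hY]
    refine IsUnit.of_mul_eq_one
      (Matrix.kroneckerMap (· * ·) (↑X⁻¹ : Matrix ι ι Ω) (↑Y⁻¹ : Matrix κ κ Ω)) ?_
    rw [← Matrix.mul_kronecker_mul, Units.mul_inv, Units.mul_inv, Matrix.one_kronecker_one]
  · induction z with
    | zero => simp
    | add y z hy hz => rw [map_add, map_add, mul_add, add_mul, hy, hz]
    | tmul a b =>
      rw [Algebra.TensorProduct.lift_tmul, hf, hg, ← Matrix.mul_kronecker_mul, mul_one, one_mul,
        hgal, ← Matrix.mul_kronecker_mul, ← Matrix.mul_kronecker_mul, h.intertwine, h'.intertwine]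
  · rw [hgal, ← Matrix.mul_kronecker_mul, h.mul, h'.mul, Matrix.smul_kronecker,
      Matrix.kronecker_smul, smul_smul]

end IsTwistedForm

end TwistedForms

/-! ### The dictionary between Brauer classes split by Ω and 2-cocycles. -/

section RepresentedClasses

variable {K Ω : Type u} [Field K] [Field Ω] [Algebra K Ω]

theorem IsTwistedForm.comp_algEquiv {A B : Type*} [Ring A] [Algebra K A] [Ring B] [Algebra K B]
    {ι : Type*} [Fintype ι] [DecidableEq ι]
    {θ : A →ₐ[K] Matrix ι ι Ω} {u : (Ω ≃ₐ[K] Ω) → Matrix ι ι Ω}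
    {α : (Ω ≃ₐ[K] Ω) → (Ω ≃ₐ[K] Ω) → Ω} (h : IsTwistedForm θ u α) (e : B ≃ₐ[K] A) :
    IsTwistedForm (θ.comp (e : B →ₐ[K] A)) u α :=
  ⟨e.toLinearEquiv.finrank_eq.trans h.finrank_eq, h.isLocallyConstant, h.isUnit,
    fun s b => h.intertwine s (e b), h.mul⟩

/-- The entrywise inclusion of matrices over `K` into matrices over `Ω`. -/
abbrev matrixInclusion (K Ω : Type*) [Field K] [Field Ω] [Algebra K Ω]
    (ι : Type*) [Fintype ι] [DecidableEq ι] :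
    Matrix ι ι K →ₐ[K] Matrix ι ι Ω :=
  (Algebra.ofId K Ω).mapMatrix

theorem galMatrix_matrixInclusion {ι : Type*} [Fintype ι] [DecidableEq ι] (s : Ω ≃ₐ[K] Ω)
    (X : Matrix ι ι K) : galMatrix s (matrixInclusion K Ω ι X) = matrixInclusion K Ω ι X := by
  ext i j
  exact s.commutes (X i j)

theorem isTwistedForm_matrixInclusion (ι : Type*) [Fintype ι] [DecidableEq ι] :
    IsTwistedForm (matrixInclusion K Ω ι) (fun _ => 1) (fun _ _ => 1) where
  finrank_eq := by rw [Module.finrank_matrix, Module.finrank_self, mul_one, sq]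
  isLocallyConstant := IsLocallyConstant.const 1
  isUnit _ := isUnit_one
  intertwine s X := by rw [galMatrix_matrixInclusion, one_mul, mul_one]
  mul s t := by rw [map_one, one_mul, one_smul]

/-- The Brauer class `x` is represented by the two-cochain `α` of the Galois group of `Ω / K`. -/
def IsRepresentedBy (x : BrauerGroup.{u, u} K) (α : (Ω ≃ₐ[K] Ω) → (Ω ≃ₐ[K] Ω) → Ω) : Prop :=
  ∃ (A : CSA.{u, u} K) (ι : Type) (_ : Fintype ι) (_ : DecidableEq ι) (θ : A →ₐ[K] Matrix ι ι Ω)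
    (u : (Ω ≃ₐ[K] Ω) → Matrix ι ι Ω), brauerClass K A = x ∧ IsTwistedForm θ u α

theorem IsTwistedForm.isRepresentedBy {A : Type u} [Ring A] [Algebra K A] [Algebra.IsCentral K A]
    [IsSimpleRing A] [FiniteDimensional K A] {ι : Type} [Fintype ι] [DecidableEq ι]
    {θ : A →ₐ[K] Matrix ι ι Ω} {u : (Ω ≃ₐ[K] Ω) → Matrix ι ι Ω}
    {α : (Ω ≃ₐ[K] Ω) → (Ω ≃ₐ[K] Ω) → Ω} (h : IsTwistedForm θ u α) :
    IsRepresentedBy (brauerClass K A) α :=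
  ⟨{ toAlgCat := AlgCat.of K A }, ι, inferInstance, inferInstance, θ, u, rfl, h⟩

theorem brauerClass_matrix (A : Type u) [Ring A] [Algebra K A] [Algebra.IsCentral K A]
    [IsSimpleRing A] [FiniteDimensional K A] (n : Type) [Fintype n] [DecidableEq n] [Nonempty n] :
    brauerClass K (Matrix n n A) = brauerClass K A :=
  brauerClass_eq_of_matrix (m := Unit) (n := n) (Matrix.uniqueAlgEquiv (R := K) (A := Matrix n n A))

theorem brauerClass_eq_zero_of_algEquiv {A : Type u} [Ring A] [Algebra K A] [Algebra.IsCentral K A]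
    [IsSimpleRing A] [FiniteDimensional K A] {n : Type} [Fintype n] [DecidableEq n] [Nonempty n]
    (e : A ≃ₐ[K] Matrix n n K) : brauerClass K A = 0 :=
  (brauerClass_eq_of_algEquiv e).trans (brauerClass_matrix K n)

namespace IsRepresentedBy

theorem zero : IsRepresentedBy (0 : BrauerGroup.{u, u} K)
    (fun _ _ => 1 : (Ω ≃ₐ[K] Ω) → (Ω ≃ₐ[K] Ω) → Ω) := by
  rw [← brauerClass_eq_zero_of_algEquiv (K := K) (n := Unit) AlgEquiv.refl]
  exact (isTwistedForm_matrixInclusion Unit).isRepresentedBy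

theorem add {x y : BrauerGroup.{u, u} K} {α β : (Ω ≃ₐ[K] Ω) → (Ω ≃ₐ[K] Ω) → Ω}
    (hx : IsRepresentedBy x α) (hy : IsRepresentedBy y β) :
    IsRepresentedBy (x + y) fun s t => α s t * β s t := by
  obtain ⟨A, ι, _, _, θ, u, rfl, h⟩ := hx
  obtain ⟨B, κ, _, _, η, v, rfl, h'⟩ := hy
  obtain ⟨ψ, hψ⟩ := h.kronecker h'
  exact hψ.isRepresentedBy

theorem nsmul {x : BrauerGroup.{u, u} K} {α : (Ω ≃ₐ[K] Ω) → (Ω ≃ₐ[K] Ω) → Ω}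
    (hx : IsRepresentedBy x α) (n : ℕ) : IsRepresentedBy (n • x) fun s t => α s t ^ n := by
  induction n with
  | zero => simpa using zero
  | succ n ih =>
    rw [succ_nsmul]
    simpa [pow_succ] using ih.add hx

section Cochain

variable {x : BrauerGroup.{u, u} K} {α : (Ω ≃ₐ[K] Ω) → (Ω ≃ₐ[K] Ω) → Ω}

theorem ne_zero (hx : IsRepresentedBy x α) (s t : Ω ≃ₐ[K] Ω) : α s t ≠ 0 := by
  obtain ⟨A, ι, _, _, θ, u, rfl, h⟩ := hx
  have := nonempty_of_finrank_eq_sq h.finrank_eq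
  exact h.ne_zero s t

theorem cocycle (hx : IsRepresentedBy x α) (s t r : Ω ≃ₐ[K] Ω) :
    s (α t r) * α s (t * r) = α (s * t) r * α s t := by
  obtain ⟨A, ι, _, _, θ, u, rfl, h⟩ := hx
  have := nonempty_of_finrank_eq_sq h.finrank_eq
  exact h.cocycle s t r

theorem isLocallyConstant [IsGalois K Ω] (hx : IsRepresentedBy x α) :
    IsLocallyConstant fun z : (Ω ≃ₐ[K] Ω) × (Ω ≃ₐ[K] Ω) => α z.1 z.2 := by
  obtain ⟨A, ι, _, _, θ, u, rfl, h⟩ := hx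
  have := nonempty_of_finrank_eq_sq h.finrank_eq
  exact h.isLocallyConstant_cochain

theorem mem_relativeBrauerGroup (hx : IsRepresentedBy x α) : x ∈ relativeBrauerGroup K Ω := by
  obtain ⟨A, ι, _, _, θ, u, rfl, h⟩ := hx
  have := nonempty_of_finrank_eq_sq h.finrank_eq
  rw [relativeBrauerGroup, AddMonoidHom.mem_ker, brauerBaseChange_class]
  exact brauerClass_eq_zero_of_algEquiv
    (AlgEquiv.ofBijective _ (extendScalars_bijective h.finrank_eq θ))

/-- A class represented by a coboundary is trivial. -/
theorem eq_zero [IsGalois K Ω] {h : (Ω ≃ₐ[K] Ω) → Ω} (hlc : IsLocallyConstant h)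
    (h0 : ∀ s, h s ≠ 0) (hx : IsRepresentedBy x (mulCoboundary h)) : x = 0 := by
  obtain ⟨A, ι, _, _, θ, u, rfl, hu⟩ := hx
  have := nonempty_of_finrank_eq_sq hu.finrank_eq
  -- Dividing u by h gives a genuine 1-cocycle in GL, so Hilbert 90 applies. Conjugating θ by g
  -- makes all its matrices Galois-invariant, so `A` maps to matrices over `K`, isomorphically by
  -- dimension.
  obtain ⟨g, hg⟩ := exists_units_of_matrix_cocycle (fun s => (h s)⁻¹ • u s)
    (hlc.comp₂ hu.isLocallyConstant fun a X => a⁻¹ • X)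
    (fun s => by
      have h1 : IsUnit ((h s)⁻¹ • (1 : Matrix ι ι Ω)) :=
        Algebra.algebraMap_eq_smul_one (A := Matrix ι ι Ω) (h s)⁻¹ ▸
          (isUnit_iff_ne_zero.2 (inv_ne_zero (h0 s))).map (algebraMap Ω (Matrix ι ι Ω))
      simpa using h1.mul (hu.isUnit s))
    (fun s t => by
      have hst : s (h t) ≠ 0 := by simpa using h0 t
      rw [galMatrix_smul, smul_mul_assoc, mul_smul_comm, hu.mul, smul_smul, smul_smul]
      congr 1
      have h1 := h0 s
      have h2 := h0 (s * t)
      rw [mulCoboundary, AlgEquiv.smul_def, map_inv₀]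
      field_simp)
  have hg' : ∀ s, u s * galMatrix s (g : Matrix ι ι Ω) = h s • (g : Matrix ι ι Ω) := fun s => by
    conv_rhs => rw [← hg s]
    rw [smul_mul_assoc, smul_smul, mul_inv_cancel₀ (h0 s), one_smul]
  let ψ : A →ₐ[K] Matrix ι ι Ω :=
    { toFun := fun a => (↑g⁻¹ : Matrix ι ι Ω) * θ a * g
      map_one' := by simp
      map_mul' := fun a b => by simp [mul_assoc]
      map_zero' := by simp
      map_add' := fun a b => by simp [mul_add, add_mul]
      commutes' := fun c => by
        rw [AlgHom.commutes, mul_assoc, Algebra.commutes, ← mul_assoc, Units.inv_mul, one_mul] }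
  have hψ : ∀ a, (g : Matrix ι ι Ω) * ψ a = θ a * g := fun a => by
    change (g : Matrix ι ι Ω) * ((↑g⁻¹ : Matrix ι ι Ω) * θ a * g) = _
    rw [mul_assoc, Units.mul_inv_cancel_left]
  have hfix : ∀ s a, galMatrix s (ψ a) = ψ a := fun s a => by
    refine g.isUnit.mul_left_cancel (IsUnit.smul_left_cancel
      (isUnit_iff_ne_zero.2 (h0 s)) |>.1 ?_)
    calc h s • ((g : Matrix ι ι Ω) * galMatrix s (ψ a))
        = u s * galMatrix s ((g : Matrix ι ι Ω) * ψ a) := by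
          rw [← smul_mul_assoc, ← hg', map_mul, mul_assoc]
      _ = h s • ((g : Matrix ι ι Ω) * ψ a) := by
          rw [hψ, map_mul, ← mul_assoc, hu.intertwine, mul_assoc, hg', mul_smul_comm]
  have hrange : ∀ a, ψ a ∈ (matrixInclusion K Ω ι).range := fun a => by
    have : ∀ i j, ∃ c, algebraMap K Ω c = ψ a i j := fun i j =>
      (InfiniteGalois.mem_range_algebraMap_iff_fixed _).2 fun s =>
        congr_fun (congr_fun (hfix s a) i) j
    choose c hc using this
    exact ⟨Matrix.of c, by ext i j; exact hc i j⟩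
  have hinj : Function.Injective (matrixInclusion K Ω ι) :=
    (matrixInclusion K Ω ι).toRingHom.injective
  let φ : A →ₐ[K] Matrix ι ι K :=
    ((AlgEquiv.ofInjective _ hinj).symm : _ →ₐ[K] Matrix ι ι K).comp (ψ.codRestrict _ hrange)
  have hφ : Function.Injective φ := φ.toRingHom.injective
  exact brauerClass_eq_zero_of_algEquiv (AlgEquiv.ofBijective φ ⟨hφ,
    (LinearMap.injective_iff_surjective_of_finrank_eq_finrank (f := φ.toLinearMap) (by
      rw [hu.finrank_eq, Module.finrank_matrix, Module.finrank_self, mul_one, sq])).1 hφ⟩)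

end Cochain

end IsRepresentedBy

/-- By Skolem–Noether, θ is conjugate by some g to the standard inclusion, whose image is
Galois-invariant. The matrix g⁻¹ u(s) s(g) then commutes with all matrices over `K`, so it is a
scalar h(s), and the multiplication rule for u becomes α = ∂h. -/
theorem IsTwistedForm.exists_coboundary_of_matrix [IsGalois K Ω] {κ : Type*} [Fintype κ]
    [DecidableEq κ] [Nonempty κ] {θ : Matrix κ κ K →ₐ[K] Matrix κ κ Ω}
    {u : (Ω ≃ₐ[K] Ω) → Matrix κ κ Ω}
    {α : (Ω ≃ₐ[K] Ω) → (Ω ≃ₐ[K] Ω) → Ω} (hu : IsTwistedForm θ u α) :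
    ∃ h : (Ω ≃ₐ[K] Ω) → Ω, IsLocallyConstant h ∧ (∀ s, h s ≠ 0) ∧ α = mulCoboundary h := by
  obtain ⟨g, hg⟩ := exists_units_conj hu.finrank_eq (matrixInclusion K Ω κ) θ
  have hunit : ∀ s, IsUnit ((↑g⁻¹ : Matrix κ κ Ω) * (u s * galMatrix s (g : Matrix κ κ Ω))) :=
    fun s => g⁻¹.isUnit.mul ((hu.isUnit s).mul (g.isUnit.map _))
  have hscal : ∀ s, ∃ c : Ω, (↑g⁻¹ : Matrix κ κ Ω) * (u s * galMatrix s (g : Matrix κ κ Ω)) =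
      c • 1 := fun s => by
    refine exists_eq_smul_one_of_commute hu.finrank_eq (matrixInclusion K Ω κ) fun X => ?_
    calc (↑g⁻¹ : Matrix κ κ Ω) * (u s * galMatrix s (g : Matrix κ κ Ω)) * matrixInclusion K Ω κ X
        = ↑g⁻¹ * (u s * galMatrix s ((g : Matrix κ κ Ω) * matrixInclusion K Ω κ X)) := by
          rw [map_mul, galMatrix_matrixInclusion, mul_assoc, mul_assoc]
      _ = ↑g⁻¹ * (θ X * g) * ↑g⁻¹ * u s * galMatrix s (g : Matrix κ κ Ω) := by
          rw [← hg, map_mul, ← mul_assoc (u s), hu.intertwine, mul_assoc (↑g⁻¹ : Matrix κ κ Ω),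
            mul_assoc (θ X) (g : Matrix κ κ Ω), Units.mul_inv, mul_one]
          simp only [mul_assoc]
      _ = matrixInclusion K Ω κ X * (↑g⁻¹ * (u s * galMatrix s (g : Matrix κ κ Ω))) := by
          rw [hg, Units.inv_mul_cancel_left]
          simp only [mul_assoc]
  choose h hh using hscal
  have hgh : ∀ s, u s * galMatrix s (g : Matrix κ κ Ω) = h s • (g : Matrix κ κ Ω) := fun s => by
    rw [g.inv_mul_eq_iff_eq_mul.1 (hh s), mul_smul_comm, mul_one]
  have h0 : ∀ s, h s ≠ 0 := fun s h0 => by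
    have := hunit s
    rw [hh, h0, zero_smul] at this
    exact not_isUnit_zero this
  obtain ⟨i⟩ := ‹Nonempty κ›
  have : Nonempty κ := ⟨i⟩
  refine ⟨h, ?_, h0, ?_⟩
  · have : h = fun s => ((↑g⁻¹ : Matrix κ κ Ω) * (u s * galMatrix s (g : Matrix κ κ Ω))) i i :=
      funext fun s => by rw [hh]; simp
    rw [this]
    exact hu.isLocallyConstant.comp₂ (isLocallyConstant_galMatrix (g : Matrix κ κ Ω))
      fun X Y => ((↑g⁻¹ : Matrix κ κ Ω) * (X * Y)) i i
  · funext s t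
    rw [mulCoboundary, eq_div_iff (h0 _)]
    refine IsTwistedForm.smul_cancel g.isUnit ?_
    calc (α s t * h (s * t)) • (g : Matrix κ κ Ω)
        = α s t • (u (s * t) * galMatrix (s * t) (g : Matrix κ κ Ω)) := by rw [hgh, smul_smul]
      _ = u s * galMatrix s (u t * galMatrix t (g : Matrix κ κ Ω)) := by
          rw [← smul_mul_assoc, ← hu.mul, map_mul, galMatrix_mul, mul_assoc]
      _ = (h s * s • h t) • (g : Matrix κ κ Ω) := by
          rw [hgh, galMatrix_smul, mul_smul_comm, hgh, smul_smul, mul_comm, AlgEquiv.smul_def]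

/-- A cochain representing the trivial class is a coboundary. -/
theorem IsRepresentedBy.exists_coboundary [IsGalois K Ω]
    {α : (Ω ≃ₐ[K] Ω) → (Ω ≃ₐ[K] Ω) → Ω} (hx : IsRepresentedBy (0 : BrauerGroup.{u, u} K) α) :
    ∃ h : (Ω ≃ₐ[K] Ω) → Ω, IsLocallyConstant h ∧ (∀ s, h s ≠ 0) ∧ α = mulCoboundary h := by
  obtain ⟨A, ι, _, _, θ, u, hA, hu⟩ := hx
  have := nonempty_of_finrank_eq_sq hu.finrank_eq
  obtain ⟨n, m, hn, hm, ⟨e⟩⟩ :=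
    (brauerClass_eq_iff A { toAlgCat := AlgCat.of K K }).1 hA
  have := NeZero.mk hn
  -- Tensoring with a matrix algebra over `K` leaves the cochain unchanged and turns `A` into a
  -- matrix algebra.
  obtain ⟨ψ, hψ⟩ := hu.kronecker (isTwistedForm_matrixInclusion (K := K) (Ω := Ω) (Fin n))
  let e' : Matrix (Fin m) (Fin m) K ≃ₐ[K] A ⊗[K] Matrix (Fin n) (Fin n) K :=
    e.symm.trans (matrixEquivTensor (Fin n) K A)
  have hcard : Fintype.card (ι × Fin n) = m := by
    have := hψ.finrank_eq
    rw [← e'.toLinearEquiv.finrank_eq, Module.finrank_matrix, Module.finrank_self, mul_one,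
      ← sq, Fintype.card_fin] at this
    exact (Nat.pow_left_injective two_ne_zero this).symm
  have h2 := hψ.comp_algEquiv
    ((Matrix.reindexAlgEquiv K K (Fintype.equivFinOfCardEq hcard)).trans e')
  obtain ⟨h, h1, h0, heq⟩ := h2.exists_coboundary_of_matrix
  exact ⟨h, h1, h0, by simpa using heq⟩

/-- Every class split by `Ω` is represented by a cochain. -/
theorem exists_isRepresentedBy [IsGalois K Ω] {x : BrauerGroup.{u, u} K}
    (hx : x ∈ relativeBrauerGroup K Ω) :
    ∃ α : (Ω ≃ₐ[K] Ω) → (Ω ≃ₐ[K] Ω) → Ω, IsRepresentedBy x α := by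
  induction x using Quotient.inductionOn with | h A => ?_
  obtain ⟨n, m, hn, hm, ⟨e⟩⟩ :=
    (brauerClass_eq_iff { toAlgCat := AlgCat.of Ω (Ω ⊗[K] A) } { toAlgCat := AlgCat.of Ω Ω }).1 hx
  have := NeZero.mk hn
  have := NeZero.mk hm
  let e' : Matrix (Fin n) (Fin n) (Ω ⊗[K] A) ≃ₐ[Ω] Matrix (Fin m) (Fin m) Ω := e
  let θ : Matrix (Fin n) (Fin n) A →ₐ[K] Matrix (Fin m) (Fin m) Ω :=
    ((e'.restrictScalars K : _ ≃ₐ[K] _) : _ →ₐ[K] Matrix (Fin m) (Fin m) Ω).comp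
      (Algebra.TensorProduct.includeRight : A →ₐ[K] Ω ⊗[K] A).mapMatrix
  have hd : Module.finrank K (Matrix (Fin n) (Fin n) A) = Fintype.card (Fin m) ^ 2 := by
    have := e'.toLinearEquiv.finrank_eq
    rw [Module.finrank_matrix, Module.finrank_baseChange, Module.finrank_matrix,
      Module.finrank_self, mul_one] at this
    rw [Module.finrank_matrix, this, sq]
  -- The intertwiner is chosen as a function of the representation, not of s. Thus s ↦ u s factors
  -- through the locally constant map s ↦ s ∘ θ.
  choose g hg using fun η : Matrix (Fin n) (Fin n) A →ₐ[K] Matrix (Fin m) (Fin m) Ω =>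
    exists_units_conj hd η θ
  have hlc : IsLocallyConstant fun s : Ω ≃ₐ[K] Ω => (galMatrix s).comp θ := by
    let b := Module.finBasis K (Matrix (Fin n) (Fin n) A)
    have h1 : IsLocallyConstant fun s : Ω ≃ₐ[K] Ω => fun i => galMatrix s (θ (b i)) :=
      isLocallyConstant_pi fun i => isLocallyConstant_galMatrix (θ (b i))
    rw [IsLocallyConstant.iff_eventually_eq] at h1 ⊢
    intro s
    filter_upwards [h1 s] with t ht
    exact AlgHom.toLinearMap_injective (b.ext fun i => congr_fun ht i)
  have hlc' := hlc.comp fun η => (g η : Matrix (Fin m) (Fin m) Ω)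
  have hu : ∀ (s : Ω ≃ₐ[K] Ω) a, θ a * g ((galMatrix s).comp θ) =
      g ((galMatrix s).comp θ) * galMatrix s (θ a) := fun s a => hg _ a
  have hscal : ∀ s t : Ω ≃ₐ[K] Ω, ∃ c : Ω,
      (g ((galMatrix s).comp θ) : Matrix (Fin m) (Fin m) Ω) *
        galMatrix s (g ((galMatrix t).comp θ) : Matrix (Fin m) (Fin m) Ω) *
        (↑(g ((galMatrix (s * t)).comp θ))⁻¹ : Matrix (Fin m) (Fin m) Ω) = c • 1 := fun s t => by
    refine exists_eq_smul_one_of_commute hd θ fun a => ?_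
    have h1 : SemiconjBy (g ((galMatrix s).comp θ) : Matrix (Fin m) (Fin m) Ω)
        (galMatrix s (θ a)) (θ a) := (hu s a).symm
    have h2 : SemiconjBy (galMatrix s (g ((galMatrix t).comp θ) : Matrix (Fin m) (Fin m) Ω))
        (galMatrix (s * t) (θ a)) (galMatrix s (θ a)) := by
      rw [galMatrix_mul]
      exact SemiconjBy.map (hu t a).symm (galMatrix s)
    have h3 : SemiconjBy (g ((galMatrix (s * t)).comp θ) : Matrix (Fin m) (Fin m) Ω)
        (galMatrix (s * t) (θ a)) (θ a) := (hu (s * t) a).symm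
    exact (h1.mul_left h2).mul_left h3.units_inv_symm_left
  choose α hα using hscal
  have : brauerClass K (Matrix (Fin n) (Fin n) A) = Quotient.mk _ A := brauerClass_matrix A (Fin n)
  refine ⟨α, ?_⟩
  change IsRepresentedBy (brauerClass K A) α
  rw [← brauerClass_matrix A (Fin n)]
  exact IsTwistedForm.isRepresentedBy (θ := θ)
    (u := fun s => (g ((galMatrix s).comp θ) : Matrix (Fin m) (Fin m) Ω))
    ⟨hd, hlc', fun s => Units.isUnit _, fun s a => (hu s a).symm, fun s t => by
      rw [(Units.mul_inv_eq_iff_eq_mul _).1 (hα s t), smul_mul_assoc, one_mul]⟩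

end RepresentedClasses

/-! ### K-forms of matrix algebras are central simple. -/

section DescendedAlgebra

variable {K Ω : Type*} [Field K] [Field Ω] [Algebra K Ω] {ι : Type*} [Fintype ι] [DecidableEq ι]
  {C : Subalgebra K (Matrix ι ι Ω)}

theorem isCentral_of_span_eq_top [Nonempty ι] (hspan : Submodule.span Ω (C : Set (Matrix ι ι Ω)) = ⊤)
    (hsc : ∀ c : Ω, c • (1 : Matrix ι ι Ω) ∈ C → ∃ k, algebraMap K Ω k = c) :
    Algebra.IsCentral K C where
  out z hz := by
    have hz' : (z : Matrix ι ι Ω) ∈ Subalgebra.center Ω (Matrix ι ι Ω) := by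
      rw [Subalgebra.mem_center_iff]
      intro Y
      have hY : Y ∈ Submodule.span Ω (C : Set (Matrix ι ι Ω)) := by rw [hspan]; trivial
      induction hY using Submodule.span_induction with
      | mem y hy => exact congrArg Subtype.val ((Subalgebra.mem_center_iff).1 hz ⟨y, hy⟩)
      | zero => simp
      | add x y _ _ hx hy => rw [add_mul, mul_add, hx, hy]
      | smul a x _ hx => rw [smul_mul_assoc, mul_smul_comm, hx]
    obtain ⟨c, hc⟩ := (Algebra.IsCentral.mem_center_iff Ω).1 hz'
    rw [Algebra.algebraMap_eq_smul_one] at hc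
    obtain ⟨k, hk⟩ := hsc c (hc ▸ z.2)
    refine Algebra.mem_bot.2 ⟨k, Subtype.ext ?_⟩
    rw [hc, ← hk, algebraMap_smul]
    exact Algebra.algebraMap_eq_smul_one k

/-- The Ω-span of a nonzero two-sided ideal I of `C` is a two-sided ideal of the matrix ring, hence
everything. So a K-basis of I has at least as many elements as dim C. -/
theorem isSimpleRing_of_span_eq_top [Nonempty ι] [FiniteDimensional K C]
    (hd : Module.finrank K C = Fintype.card ι ^ 2)
    (hspan : Submodule.span Ω (C : Set (Matrix ι ι Ω)) = ⊤) : IsSimpleRing C := by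
  refine IsSimpleRing.of_eq_bot_or_eq_top fun I => ?_
  rw [or_iff_not_imp_left]
  intro hI
  let S : Submodule Ω (Matrix ι ι Ω) := Submodule.span Ω (Subtype.val '' (I : Set C))
  let IK : Submodule K C :=
    { carrier := I
      zero_mem' := I.zero_mem
      add_mem' := I.add_mem
      smul_mem' := fun k x hx => by
        rw [Algebra.smul_def]
        exact I.mul_mem_left _ _ hx }
  have hmem : ∀ z, z ∈ IK ↔ z ∈ I := fun z => Iff.rfl
  have hl : ∀ Y : Matrix ι ι Ω, ∀ x ∈ S, Y * x ∈ S := fun Y x hx => by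
    have hY : Y ∈ Submodule.span Ω (C : Set (Matrix ι ι Ω)) := by rw [hspan]; trivial
    induction hY using Submodule.span_induction with
    | zero => simp
    | add y z _ _ hy hz => rw [add_mul]; exact S.add_mem hy hz
    | smul a y _ hy => rw [smul_mul_assoc]; exact S.smul_mem a hy
    | mem y hy =>
      induction hx using Submodule.span_induction with
      | zero => simp
      | add w z _ _ hw hz => rw [mul_add]; exact S.add_mem hw hz
      | smul a w _ hw => rw [mul_smul_comm]; exact S.smul_mem a hw
      | mem w hw =>
        obtain ⟨w, hw, rfl⟩ := hw
        exact Submodule.subset_span ⟨⟨y, hy⟩ * w, I.mul_mem_left _ _ hw, rfl⟩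
  have hr : ∀ Y : Matrix ι ι Ω, ∀ x ∈ S, x * Y ∈ S := fun Y x hx => by
    have hY : Y ∈ Submodule.span Ω (C : Set (Matrix ι ι Ω)) := by rw [hspan]; trivial
    induction hY using Submodule.span_induction with
    | zero => simp
    | add y z _ _ hy hz => rw [mul_add]; exact S.add_mem hy hz
    | smul a y _ hy => rw [mul_smul_comm]; exact S.smul_mem a hy
    | mem y hy =>
      induction hx using Submodule.span_induction with
      | zero => simp
      | add w z _ _ hw hz => rw [add_mul]; exact S.add_mem hw hz
      | smul a w _ hw => rw [smul_mul_assoc]; exact S.smul_mem a hw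
      | mem w hw =>
        obtain ⟨w, hw, rfl⟩ := hw
        exact Submodule.subset_span ⟨w * ⟨y, hy⟩, I.mul_mem_right _ _ hw, rfl⟩
  let J : TwoSidedIdeal (Matrix ι ι Ω) := TwoSidedIdeal.mk' (S : Set (Matrix ι ι Ω)) S.zero_mem
    S.add_mem S.neg_mem (fun {x y} hy => hl x y hy) (fun {x y} hx => hr y x hx)
  have hJ : ∀ x, x ∈ J ↔ x ∈ S := fun x => by simp [J]
  obtain ⟨x, hxI, hx0⟩ := SetLike.exists_of_lt (bot_lt_iff_ne_bot.mpr hI : ⊥ < I)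
  have hJtop : S = ⊤ := by
    rcases eq_bot_or_eq_top J with h | h
    · refine absurd (Subtype.ext ?_) hx0
      have : (x : Matrix ι ι Ω) ∈ J := (hJ _).2 (Submodule.subset_span ⟨x, hxI, rfl⟩)
      rw [h] at this
      simpa using this
    · rw [eq_top_iff]
      intro y _
      rw [← hJ, h]
      trivial
  have : Module.Free K IK := Module.Free.of_divisionRing K IK
  let b := Module.finBasis K IK
  have hle : S ≤ Submodule.span Ω (Set.range fun i => ((b i : C) : Matrix ι ι Ω)) := by
    refine Submodule.span_le.2 ?_
    rintro _ ⟨w, hw, rfl⟩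
    have h1 := congrArg (fun v : IK => ((v : C) : Matrix ι ι Ω)) (b.sum_repr ⟨w, hw⟩)
    simp only at h1
    rw [← h1]
    simp only [Submodule.coe_smul, AddSubmonoidClass.coe_finsetSum,
      Subalgebra.coe_smul]
    refine Submodule.sum_mem _ fun i _ => ?_
    rw [← algebraMap_smul Ω]
    exact Submodule.smul_mem _ _ (Submodule.subset_span ⟨i, rfl⟩)
  have hcard : Fintype.card ι ^ 2 ≤ Module.finrank K IK := by
    have h1 := finrank_range_le_card (R := Ω) fun i => ((b i : C) : Matrix ι ι Ω)
    have h2 : Submodule.span Ω (Set.range fun i => ((b i : C) : Matrix ι ι Ω)) = ⊤ :=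
      eq_top_iff.2 (hJtop ▸ hle)
    rw [Set.finrank, h2, finrank_top, Module.finrank_matrix,
      Module.finrank_self, mul_one, ← sq, Fintype.card_fin] at h1
    exact h1
  have htop : IK = ⊤ := Submodule.eq_top_of_finrank_eq
    (le_antisymm (Submodule.finrank_le _) (hd ▸ hcard))
  rw [← I.one_mem_iff, ← hmem, htop]
  trivial

end DescendedAlgebra

/-! ### Matrices of twisted cyclic shifts. -/

section ShiftMatrices

variable {F : Type*} [Field F]

theorem exists_fin_dvd_sub (q : ℕ) [NeZero q] (z : ℤ) : ∃ j : Fin q, (q : ℤ) ∣ z - (j : ℕ) := by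
  have hq : (0 : ℤ) < q := by exact_mod_cast Nat.pos_of_neZero q
  have h0 := Int.emod_nonneg z hq.ne'
  have h1 := Int.emod_lt_of_pos z hq
  refine ⟨⟨(z % q).toNat, by omega⟩, ?_⟩
  simp only [Int.toNat_of_nonneg h0]
  exact Int.dvd_self_sub_emod

theorem fin_eq_of_dvd_sub {q : ℕ} {i j : Fin q} (h : (q : ℤ) ∣ (i : ℕ) - (j : ℕ)) : i = j := by
  have := Int.eq_zero_of_abs_lt_dvd h (by
    have := i.2; have := j.2
    rw [abs_lt]
    omega)
  exact Fin.ext (by omega)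

/-- The matrix of the shift by `i` on the functions `f` on the integers such that
`f (j + q) = b * f j`. -/
def shiftMatrix (q : ℕ) (b : F) (i : ℤ) : Matrix (Fin q) (Fin q) F :=
  Matrix.of fun r j => if (q : ℤ) ∣ i + (j : ℕ) - (r : ℕ) then b ^ ((i + (j : ℕ) - (r : ℕ)) / q)
    else 0

variable {q : ℕ} {b : F}

theorem shiftMatrix_apply (i : ℤ) (r j : Fin q) : shiftMatrix q b i r j =
    if (q : ℤ) ∣ i + (j : ℕ) - (r : ℕ) then b ^ ((i + (j : ℕ) - (r : ℕ)) / q) else 0 := rfl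

theorem shiftMatrix_apply_eq {i m : ℤ} {r j : Fin q} (hq : q ≠ 0)
    (h : i + (j : ℕ) - (r : ℕ) = q * m) : shiftMatrix q b i r j = b ^ m := by
  rw [shiftMatrix_apply, if_pos ⟨m, h⟩, h, Int.mul_ediv_cancel_left]
  exact_mod_cast hq

theorem shiftMatrix_mul_apply {i : ℤ} {r j : Fin q} (h : (q : ℤ) ∣ i + (j : ℕ) - (r : ℕ))
    (X : Matrix (Fin q) (Fin q) F) (c : Fin q) :
    (shiftMatrix q b i * X) r c = shiftMatrix q b i r j * X j c := by
  rw [Matrix.mul_apply, Finset.sum_eq_single j]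
  · intro k _ hk
    rw [shiftMatrix_apply, if_neg, zero_mul]
    intro h'
    refine hk (fin_eq_of_dvd_sub ?_)
    have := dvd_sub h' h
    ring_nf at this ⊢
    exact this
  · simp

theorem mul_shiftMatrix_apply {i : ℤ} {r j : Fin q} (h : (q : ℤ) ∣ i + (j : ℕ) - (r : ℕ))
    (X : Matrix (Fin q) (Fin q) F) (c : Fin q) :
    (X * shiftMatrix q b i) c j = X c r * shiftMatrix q b i r j := by
  rw [Matrix.mul_apply, Finset.sum_eq_single r]
  · intro k _ hk
    rw [shiftMatrix_apply, if_neg, mul_zero]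
    intro h'
    refine hk (fin_eq_of_dvd_sub ?_)
    have := dvd_sub h h'
    ring_nf at this ⊢
    exact this
  · simp

theorem shiftMatrix_apply_ne_zero (hb : b ≠ 0) {i : ℤ} {r j : Fin q}
    (h : (q : ℤ) ∣ i + (j : ℕ) - (r : ℕ)) : shiftMatrix q b i r j ≠ 0 := by
  rw [shiftMatrix_apply, if_pos h]
  exact zpow_ne_zero _ hb

variable [NeZero q]

theorem exists_dvd_row (i : ℤ) (r : Fin q) : ∃ j : Fin q, (q : ℤ) ∣ i + (j : ℕ) - (r : ℕ) := by
  obtain ⟨j, m, hm⟩ := exists_fin_dvd_sub q ((r : ℕ) - i)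
  exact ⟨j, -m, by linear_combination -hm⟩

theorem shiftMatrix_mul (hb : b ≠ 0) (i k : ℤ) :
    shiftMatrix q b i * shiftMatrix q b k = shiftMatrix q b (i + k) := by
  ext r c
  obtain ⟨j, m, hm⟩ := exists_dvd_row i r
  rw [shiftMatrix_mul_apply ⟨m, hm⟩, shiftMatrix_apply_eq (NeZero.ne q) hm]
  by_cases h : (q : ℤ) ∣ k + (c : ℕ) - (j : ℕ)
  · obtain ⟨n, hn⟩ := h
    rw [shiftMatrix_apply_eq (NeZero.ne q) hn, ← zpow_add₀ hb,
      shiftMatrix_apply_eq (m := m + n) (NeZero.ne q) (by rw [mul_add]; linarith)]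
  · rw [shiftMatrix_apply, if_neg h, mul_zero, shiftMatrix_apply, if_neg]
    intro h'
    refine h ?_
    have := dvd_sub h' ⟨m, hm⟩
    ring_nf at this ⊢
    exact this

theorem shiftMatrix_mul_right (m : ℤ) :
    shiftMatrix q b (q * m) = b ^ m • 1 := by
  ext r c
  by_cases h : r = c
  · subst h
    rw [shiftMatrix_apply_eq (m := m) (NeZero.ne q) (by ring)]
    simp
  · rw [shiftMatrix_apply, if_neg]
    · simp [h]
    · intro h'
      refine h (fin_eq_of_dvd_sub ?_).symm
      have := dvd_sub h' ⟨m, rfl⟩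
      ring_nf at this ⊢
      exact this

theorem shiftMatrix_zero : shiftMatrix q b 0 = 1 := by
  simpa using shiftMatrix_mul_right (q := q) (b := b) 0

theorem shiftMatrix_natCast (hb : b ≠ 0) (n : ℕ) :
    shiftMatrix q b n = shiftMatrix q b 1 ^ n := by
  induction n with
  | zero => simpa using shiftMatrix_zero
  | succ n ih => rw [pow_succ, ← ih, shiftMatrix_mul hb]; push_cast; rfl

theorem isUnit_shiftMatrix (hb : b ≠ 0) (i : ℤ) : IsUnit (shiftMatrix q b i) :=
  IsUnit.of_mul_eq_one (shiftMatrix q b (-i)) (by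
    rw [shiftMatrix_mul hb, add_neg_cancel, shiftMatrix_zero])

end ShiftMatrices

/-! ### Cyclic algebras realising the symbol cocycles. -/

section CyclicAlgebras

variable {K Ω : Type u} [Field K] [Field Ω] [Algebra K Ω]

/-- The matrices fixed by a twisted Galois action. -/
def twistedFixed {ι : Type*} [Fintype ι] [DecidableEq ι] (u : (Ω ≃ₐ[K] Ω) → Matrix ι ι Ω) :
    Subalgebra K (Matrix ι ι Ω) where
  carrier := {X | ∀ s, u s * galMatrix s X = X * u s}
  mul_mem' {X Y} hX hY s := by
    rw [map_mul, ← mul_assoc, hX, mul_assoc, hY, mul_assoc]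
  add_mem' {X Y} hX hY s := by rw [map_add, mul_add, hX, hY, add_mul]
  algebraMap_mem' k s := by rw [AlgHom.commutes, Algebra.commutes]

/-- Applying s and then conjugating by u s is a genuine semilinear action, because the scalars `α s
t` cancel in a conjugation; Galois descent applies to it. -/
theorem span_twistedFixed [IsGalois K Ω] {ι : Type*} [Fintype ι] [DecidableEq ι]
    {u : (Ω ≃ₐ[K] Ω) → Matrix ι ι Ω} {α : (Ω ≃ₐ[K] Ω) → (Ω ≃ₐ[K] Ω) → Ω}
    (hlc : IsLocallyConstant u) (hu : ∀ s, IsUnit (u s)) (hα : ∀ s t, α s t ≠ 0)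
    (hmul : ∀ s t, u s * galMatrix s (u t) = α s t • u (s * t)) :
    Submodule.span Ω (twistedFixed u : Set (Matrix ι ι Ω)) = ⊤ := by
  let r : (Ω ≃ₐ[K] Ω) → Matrix ι ι Ω → Matrix ι ι Ω := fun s X => u s * galMatrix s X * (u s)⁻¹
  have hr : ∀ s X, r s X * u s = u s * galMatrix s X := fun s X =>
    Matrix.nonsing_inv_mul_cancel_right _ _ ((Matrix.isUnit_iff_isUnit_det _).1 (hu s))
  have hr' : ∀ s {X Y}, Y * u s = u s * galMatrix s X → r s X = Y := fun s {X Y} hY =>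
    (hu s).mul_right_cancel ((hr s X).trans hY.symm)
  have hrmul : ∀ s t X, r (s * t) X = r s (r t X) := fun s t X => hr' _ (by
    refine IsUnit.smul_left_cancel (isUnit_iff_ne_zero.2 (hα s t)) |>.1 ?_
    rw [← mul_smul_comm, ← hmul, ← smul_mul_assoc, ← hmul, ← mul_assoc, hr, mul_assoc, ← map_mul,
      hr, map_mul, galMatrix_mul, mul_assoc])
  have hr1 : ∀ X, r 1 X = X := fun X => by
    have h1 : u 1 = α 1 1 • 1 := by
      refine (hu 1).mul_left_cancel ?_
      have := hmul 1 1
      rw [galMatrix_one, mul_one] at this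
      rw [this, mul_smul_comm, mul_one]
    exact hr' 1 (by rw [h1, galMatrix_one, mul_smul_comm, smul_mul_assoc, mul_one, one_mul])
  have := span_fixed_eq_top (K := K) (Ω := Ω) (V := Matrix ι ι Ω)
    { toFun := fun s =>
        { toFun := r s
          map_zero' := by simp [r]
          map_add' := fun X Y => by simp only [r, map_add, mul_add, add_mul] }
      map_one' := AddMonoidHom.ext hr1
      map_mul' := fun s t => AddMonoidHom.ext (hrmul s t) }
    (fun s a X => by
      change r s (a • X) = s a • r s X
      simp only [r, galMatrix_smul, mul_smul_comm, smul_mul_assoc])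
    (fun X => hlc.comp₂ (isLocallyConstant_galMatrix X) fun U Y => U * Y * U⁻¹)
  rw [← this]
  congr 1
  ext X
  refine forall_congr' fun s => ?_
  change _ ↔ r s X = X
  exact ⟨fun h => hr' s h.symm, fun h => by rw [← hr s X, h]⟩

/-- The diagonal matrix of the iterated conjugates of an element. -/
def conjugatesDiagonal (σ : Ω ≃ₐ[K] Ω) (q : ℕ) : Ω →ₐ[K] Matrix (Fin q) (Fin q) Ω :=
  (Matrix.diagonalAlgHom K).comp
    (AlgHom.pi fun i : Fin q => ((σ ^ (i : ℕ) : Ω ≃ₐ[K] Ω) : Ω →ₐ[K] Ω))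

namespace IsCarry

variable [IsGalois K Ω] {q : ℕ} {x : (Ω ≃ₐ[K] Ω) → ℤ} {y : (Ω ≃ₐ[K] Ω) → (Ω ≃ₐ[K] Ω) → ℤ}
  {σ : Ω ≃ₐ[K] Ω}

theorem isOpen_kernel (h : IsCarry q x y) (hx : IsLocallyConstant x) :
    IsOpen (h.kernel : Set (Ω ≃ₐ[K] Ω)) :=
  hx {n | (q : ℤ) ∣ n}

theorem isGalois_fixedField (h : IsCarry q x y) :
    IsGalois K (IntermediateField.fixedField h.kernel) :=
  IsGalois.of_fixedField_normal_subgroup h.kernel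

theorem fixingSubgroup_fixedField_kernel (h : IsCarry q x y) (hx : IsLocallyConstant x) :
    (IntermediateField.fixedField h.kernel).fixingSubgroup = h.kernel :=
  InfiniteGalois.fixingSubgroup_fixedField
    (⟨h.kernel, h.kernel.isClosed_of_isOpen (h.isOpen_kernel hx)⟩ :
      ClosedSubgroup (Ω ≃ₐ[K] Ω))

theorem finiteDimensional_fixedField (h : IsCarry q x y) (hx : IsLocallyConstant x) :
    FiniteDimensional K (IntermediateField.fixedField h.kernel) := by
  rw [← InfiniteGalois.isOpen_iff_finite, h.fixingSubgroup_fixedField_kernel hx]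
  exact h.isOpen_kernel hx

theorem mem_zpowers_restrictNormalHom (h : IsCarry q x y) (hσ : (q : ℤ) ∣ x σ - 1)
    [IsGalois K (IntermediateField.fixedField h.kernel)]
    (τ : IntermediateField.fixedField h.kernel ≃ₐ[K] IntermediateField.fixedField h.kernel) :
    τ ∈ Subgroup.zpowers
      (AlgEquiv.restrictNormalHom (IntermediateField.fixedField h.kernel) σ) := by
  obtain ⟨s, rfl⟩ := AlgEquiv.restrictNormalHom_surjective (F := K) Ω τ
  refine ⟨x s, ?_⟩
  have h1 : (σ ^ x s)⁻¹ * s ∈ h.kernel := h.zpow_inv_mul_mem hσ (by simp)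
  have h2 := IntermediateField.le_iff_le _ _ |>.1 le_rfl h1
  rw [← IntermediateField.restrictNormalHom_ker, MonoidHom.mem_ker, map_mul, map_inv, map_zpow,
    inv_mul_eq_one] at h2
  exact h2

/-- The degree is the order of σ restricted to the fixed field, and σ^n acts trivially there exactly
when q divides x(σ^n), which is congruent to n. -/
theorem finrank_fixedField (h : IsCarry q x y) (hx : IsLocallyConstant x)
    (hσ : (q : ℤ) ∣ x σ - 1) :
    Module.finrank K (IntermediateField.fixedField h.kernel) = q := by
  have := h.isGalois_fixedField
  have := h.finiteDimensional_fixedField hx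
  rw [← IsGalois.card_aut_eq_finrank,
    ← orderOf_eq_card_of_forall_mem_zpowers (h.mem_zpowers_restrictNormalHom hσ)]
  refine Nat.dvd_right_iff_eq.1 fun n => ?_
  rw [orderOf_dvd_iff_pow_eq_one, ← map_pow, ← MonoidHom.mem_ker,
    IntermediateField.restrictNormalHom_ker, h.fixingSubgroup_fixedField_kernel hx, mem_kernel]
  have h1 := h.zpow σ n
  obtain ⟨k, hk⟩ := hσ
  rw [zpow_natCast] at h1
  have h2 : (q : ℤ) ∣ x (σ ^ n) - n := by
    have := h1.add (Dvd.intro (n * k) rfl : (q : ℤ) ∣ q * (n * k))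
    rwa [show x (σ ^ n) - n * x σ + q * (n * k) = x (σ ^ n) - n by linear_combination (n : ℤ) * (-hk)]
      at this
  rw [← Int.natCast_dvd_natCast]
  constructor
  · intro h3; simpa using h3.sub h2
  · intro h3; simpa using h2.add h3

theorem galMatrix_shiftMatrix (b : K) (s : Ω ≃ₐ[K] Ω) (i : ℤ) :
    galMatrix s (shiftMatrix q (algebraMap K Ω b) i) = shiftMatrix q (algebraMap K Ω b) i := by
  ext r j
  simp only [AlgHom.mapMatrix_apply, Matrix.map_apply, shiftMatrix_apply]
  split_ifs <;> simp

section Construction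

variable [NeZero q] {b : K}

theorem shiftMatrix_twisted (hb : algebraMap K Ω b ≠ 0) (h : IsCarry q x y) (s t : Ω ≃ₐ[K] Ω) :
    shiftMatrix q (algebraMap K Ω b) (x s) * galMatrix s (shiftMatrix q (algebraMap K Ω b) (x t)) =
      algebraMap K Ω b ^ y s t • shiftMatrix q (algebraMap K Ω b) (x (s * t)) := by
  rw [galMatrix_shiftMatrix, shiftMatrix_mul hb,
    show x s + x t = q * y s t + x (s * t) by rw [← h]; ring, ← shiftMatrix_mul hb,
    shiftMatrix_mul_right, smul_mul_assoc, one_mul]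

/-- For s in the kernel the shift matrix is a scalar, so twisted invariance is entrywise invariance.
-/
theorem row_mem_fixedField (hb : algebraMap K Ω b ≠ 0) (h : IsCarry q x y) {X : Matrix (Fin q) (Fin q) Ω}
    (hX : X ∈ twistedFixed fun s => shiftMatrix q (algebraMap K Ω b) (x s)) (i j : Fin q) :
    X i j ∈ IntermediateField.fixedField h.kernel := by
  rintro ⟨s, m, hm⟩
  have h1 := hX s
  simp only [hm, shiftMatrix_mul_right, smul_mul_assoc, mul_smul_comm, one_mul, mul_one] at h1
  have h2 := IsUnit.smul_left_cancel (isUnit_iff_ne_zero.2 (zpow_ne_zero m hb)) |>.1 h1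
  exact congr_fun (congr_fun h2 i) j

/-- Invariance under σ^r expresses the entries of row r as multiples of conjugates of entries of row
0, since x(σ^r) is congruent to r. -/
theorem eq_zero_of_row_eq_zero (hb : algebraMap K Ω b ≠ 0) (h : IsCarry q x y) (hσ : (q : ℤ) ∣ x σ - 1)
    {X : Matrix (Fin q) (Fin q) Ω}
    (hX : X ∈ twistedFixed fun s => shiftMatrix q (algebraMap K Ω b) (x s))
    (h0 : ∀ j, X 0 j = 0) : X = 0 := by
  ext r k
  let s := σ ^ (r : ℕ)
  have hs : (q : ℤ) ∣ x s + ((0 : Fin q) : ℕ) - (r : ℕ) := by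
    have h1 := h.zpow σ (r : ℕ)
    rw [zpow_natCast] at h1
    have h2 := h1.add (hσ.mul_left ((r : ℕ) : ℤ))
    rwa [show x (σ ^ (r : ℕ)) - ((r : ℕ) : ℤ) * x σ + (r : ℕ) * (x σ - 1) =
      x s + ((0 : Fin q) : ℕ) - (r : ℕ) by simp only [Fin.val_zero, s]; push_cast; ring] at h2
  obtain ⟨j, hj⟩ := exists_dvd_row (x s) k
  have h1 := congr_fun (congr_fun (hX s) r) j
  rw [shiftMatrix_mul_apply hs, mul_shiftMatrix_apply hj] at h1
  have h2 : galMatrix s X 0 j = 0 := by simp [h0]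
  rw [h2, mul_zero, zero_eq_mul] at h1
  exact h1.resolve_right (shiftMatrix_apply_ne_zero hb hj)

theorem diagonal_mem_twistedFixed (h : IsCarry q x y) (hσ : (q : ℤ) ∣ x σ - 1)
    {e : Ω} (he : e ∈ IntermediateField.fixedField h.kernel) :
    Matrix.diagonal (fun i : Fin q => (σ ^ (i : ℕ)) e) ∈
      twistedFixed fun s => shiftMatrix q (algebraMap K Ω b) (x s) := by
  intro s
  ext r j
  have h0 : galMatrix s (Matrix.diagonal fun i : Fin q => (σ ^ (i : ℕ)) e) =
      Matrix.diagonal fun i : Fin q => s ((σ ^ (i : ℕ)) e) := by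
    simp [Matrix.diagonal_map]
  rw [h0, Matrix.mul_diagonal, Matrix.diagonal_mul]
  change shiftMatrix q (algebraMap K Ω b) (x s) r j * _ =
    _ * shiftMatrix q (algebraMap K Ω b) (x s) r j
  rw [shiftMatrix_apply]
  split_ifs with hd
  · rw [mul_comm]
    congr 1
    have h1 : (σ ^ ((r : ℕ) : ℤ))⁻¹ * (s * σ ^ (j : ℕ)) ∈ h.kernel := by
      refine h.zpow_inv_mul_mem hσ ?_
      have h2 := h.zpow σ (j : ℕ)
      rw [zpow_natCast] at h2
      have h3 := (h2.add (hσ.mul_left ((j : ℕ) : ℤ))).add (hd.sub (Dvd.intro (y s (σ ^ (j : ℕ))) rfl))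
      rw [← h] at h3
      obtain ⟨k, hk⟩ := h3
      exact ⟨k, by linear_combination hk⟩
    have h2 := he ⟨_, h1⟩
    change ((σ ^ ((r : ℕ) : ℤ))⁻¹ * (s * σ ^ (j : ℕ))) e = e at h2
    rw [AlgEquiv.mul_apply, AlgEquiv.mul_apply, zpow_natCast] at h2
    conv_rhs => rw [← h2]
    exact (AlgEquiv.apply_symm_apply (σ ^ (r : ℕ)) _).symm
  · rw [zero_mul, mul_zero]

set_option maxHeartbeats 400000 in
/-- The twisted form attached to a character and an element of the base field is cyclic. -/
theorem isCyclicAlgebra_twistedFixed (hb : algebraMap K Ω b ≠ 0) (h : IsCarry q x y)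
    (hx : IsLocallyConstant x) (hσ : (q : ℤ) ∣ x σ - 1) :
    FiniteDimensional K (twistedFixed fun s => shiftMatrix q (algebraMap K Ω b) (x s)) ∧
    Module.finrank K (twistedFixed fun s => shiftMatrix q (algebraMap K Ω b) (x s)) = q ^ 2 ∧
    IsCyclicAlgebra K (twistedFixed fun s => shiftMatrix q (algebraMap K Ω b) (x s)) := by
  set C := twistedFixed fun s => shiftMatrix q (algebraMap K Ω b) (x s) with hC
  let E := IntermediateField.fixedField h.kernel
  have hEgal := h.isGalois_fixedField
  have hEfin := h.finiteDimensional_fixedField hx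
  have hEq : Module.finrank K E = q := h.finrank_fixedField hx hσ
  let τ : E ≃ₐ[K] E := AlgEquiv.restrictNormalHom E σ
  have hτ : ∀ e : E, ((τ e : E) : Ω) = σ e := fun e => AlgEquiv.restrictNormal_commutes σ E e
  let f : E →ₐ[K] C := ((conjugatesDiagonal σ q).comp E.val).codRestrict C
    fun e => h.diagonal_mem_twistedFixed (b := b) hσ e.2
  have hf : ∀ e, (f e : Matrix (Fin q) (Fin q) Ω) =
    Matrix.diagonal fun i : Fin q => (σ ^ (i : ℕ)) (e : Ω) := fun e => rfl
  let Y : C := ⟨shiftMatrix q (algebraMap K Ω b) 1, fun s => by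
    rw [galMatrix_shiftMatrix, shiftMatrix_mul hb, shiftMatrix_mul hb, add_comm]⟩
  have hY : ∀ n : ℕ, ((Y ^ n : C) : Matrix (Fin q) (Fin q) Ω) =
      shiftMatrix q (algebraMap K Ω b) n := fun n => by
    rw [shiftMatrix_natCast hb]; rfl
  -- Bijectivity of `Z` is read off row 0, which determines an element of `C`. In that row the i-th
  -- summand has a single possible nonzero position, the column congruent to -i.
  let Z : (Fin q → E) →ₗ[K] C :=
    { toFun := fun c => ∑ i, f (c i) * Y ^ (i : ℕ)
      map_add' := fun c d => by simp [add_mul, Finset.sum_add_distrib]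
      map_smul' := fun k c => by simp [Finset.smul_sum] }
  have hZ : ∀ c i j, (q : ℤ) ∣ ((i : Fin q) : ℕ) + ((j : Fin q) : ℕ) - ((0 : Fin q) : ℕ) →
      (Z c : Matrix (Fin q) (Fin q) Ω) 0 j =
        c i * shiftMatrix q (algebraMap K Ω b) ((i : ℕ) : ℤ) 0 j := by
    intro c i j hij
    have h1 : (Z c : Matrix (Fin q) (Fin q) Ω) = ∑ i, (f (c i) : Matrix (Fin q) (Fin q) Ω) *
        shiftMatrix q (algebraMap K Ω b) ((i : ℕ) : ℤ) := by
      simp only [← hY]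
      change C.val (∑ i, f (c i) * Y ^ (i : ℕ)) = _
      rw [map_sum]
      rfl
    rw [h1, Matrix.sum_apply, Finset.sum_eq_single i]
    · rw [hf, Matrix.diagonal_mul]
      simp
    · intro k _ hk
      rw [hf, Matrix.diagonal_mul, shiftMatrix_apply, if_neg, mul_zero]
      intro h'
      refine hk (fin_eq_of_dvd_sub ?_)
      have := dvd_sub h' hij
      ring_nf at this ⊢
      exact this
    · simp
  have hcol : ∀ i : Fin q, ∃ j : Fin q, (q : ℤ) ∣ (i : ℕ) + (j : ℕ) - ((0 : Fin q) : ℕ) :=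
    fun i => exists_dvd_row _ _
  choose col hcol using hcol
  have hrow : ∀ j : Fin q, ∃ i : Fin q, (q : ℤ) ∣ (i : ℕ) + (j : ℕ) - ((0 : Fin q) : ℕ) :=
    fun j => by
      obtain ⟨i, hi⟩ := exists_dvd_row (j : ℕ) (0 : Fin q)
      exact ⟨i, by rwa [add_comm ((i : ℕ) : ℤ)]⟩
  have hbij : Function.Bijective Z := by
    constructor
    · intro c d hcd
      funext i
      have h1 := hZ c i (col i) (hcol i)
      rw [hcd, hZ d i (col i) (hcol i)] at h1
      exact (Subtype.ext (mul_right_cancel₀ (shiftMatrix_apply_ne_zero hb (hcol i)) h1)).symm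
    · intro X
      have hdE : ∀ i, (X : Matrix (Fin q) (Fin q) Ω) 0 (col i) *
          (shiftMatrix q (algebraMap K Ω b) ((i : ℕ) : ℤ) 0 (col i))⁻¹ ∈ E := fun i =>
        E.mul_mem (h.row_mem_fixedField hb X.2 _ _) (E.inv_mem (by
          rw [shiftMatrix_apply, if_pos (hcol i), ← map_zpow₀]
          exact E.algebraMap_mem _))
      refine ⟨fun i => ⟨_, hdE i⟩, ?_⟩
      rw [← sub_eq_zero]
      refine Subtype.ext (h.eq_zero_of_row_eq_zero hb hσ (Subtype.prop _) fun j => ?_)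
      obtain ⟨i, hi⟩ := hrow j
      have hji : col i = j := fin_eq_of_dvd_sub (by
        have := dvd_sub (hcol i) hi
        ring_nf at this ⊢
        exact this)
      change (Z _ : Matrix (Fin q) (Fin q) Ω) 0 j - (X : Matrix (Fin q) (Fin q) Ω) 0 j = 0
      rw [hZ _ i j hi]
      subst hji
      rw [inv_mul_cancel_right₀ (shiftMatrix_apply_ne_zero hb (hcol i)), sub_self]
  let e := LinearEquiv.ofBijective Z hbij
  -- Conjugation by the shift by one acts on the diagonal copy of `E` as the inverse of σ, so the
  -- generator recorded is τ⁻¹.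
  refine ⟨Module.Finite.equiv e, ?_, E, inferInstance, inferInstance, hEfin, hEgal, τ⁻¹, f, b, Y,
    ?_, ?_, ?_, ?_, ?_⟩
  · rw [← e.finrank_eq, Module.finrank_pi_fintype, hEq]
    simp [sq]
  · intro ρ
    rw [Subgroup.zpowers_inv]
    exact h.mem_zpowers_restrictNormalHom hσ ρ
  · rintro rfl
    exact hb (map_zero _)
  · rw [hEq]
    refine Subtype.ext ?_
    rw [hY]
    have := shiftMatrix_mul_right (q := q) (b := algebraMap K Ω b) 1
    rw [mul_one, zpow_one] at this
    rw [this, algebraMap_smul]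
    exact (Algebra.algebraMap_eq_smul_one b).symm
  · intro v
    refine Subtype.ext ?_
    ext r j
    change (shiftMatrix q (algebraMap K Ω b) 1 * (f v : Matrix (Fin q) (Fin q) Ω)) r j =
      ((f (τ⁻¹ v) : Matrix (Fin q) (Fin q) Ω) * shiftMatrix q (algebraMap K Ω b) 1) r j
    rw [hf, hf, Matrix.mul_diagonal, Matrix.diagonal_mul, shiftMatrix_apply]
    split_ifs with hd
    · rw [mul_comm]
      congr 1
      have h1 : (σ ^ (((r : ℕ) : ℤ)))⁻¹ * (σ * σ ^ (j : ℕ)) ∈ h.kernel := by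
        refine h.zpow_inv_mul_mem hσ ?_
        have h2 := h.zpow σ (1 + (j : ℕ))
        rw [zpow_add, zpow_one, zpow_natCast] at h2
        obtain ⟨k, hk⟩ := (h2.add (hσ.mul_left (1 + (j : ℕ)))).add hd
        exact ⟨k, by linear_combination hk⟩
      have h2 := (τ⁻¹ v).2 ⟨_, h1⟩
      change ((σ ^ ((r : ℕ) : ℤ))⁻¹ * (σ * σ ^ (j : ℕ))) (τ⁻¹ v : E) = (τ⁻¹ v : E) at h2
      rw [AlgEquiv.mul_apply, ← pow_succ', pow_succ, AlgEquiv.mul_apply, ← hτ,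
        ← AlgEquiv.mul_apply τ, mul_inv_cancel, AlgEquiv.one_apply, zpow_natCast] at h2
      conv_rhs => rw [← h2]
      exact (AlgEquiv.apply_symm_apply (σ ^ (r : ℕ)) _).symm
    · rw [zero_mul, mul_zero]
  · rw [hEq]
    intro a
    obtain ⟨c, hc, huniq⟩ := Function.bijective_iff_existsUnique Z |>.1 hbij a
    exact ⟨c, hc.symm, fun d hd => huniq d hd.symm⟩

end Construction

/-- The cyclic classes attached to characters and elements of the base field. -/
theorem exists_isCyclicBrauerClass {K Ω : Type u} [Field K] [Field Ω] [Algebra K Ω] [IsGalois K Ω]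
    {q : ℕ} {x : (Ω ≃ₐ[K] Ω) → ℤ} {y : (Ω ≃ₐ[K] Ω) → (Ω ≃ₐ[K] Ω) → ℤ}
    {σ : Ω ≃ₐ[K] Ω} (h : IsCarry q x y) (hq : q ≠ 0)
    (hx : IsLocallyConstant x) (hσ : (q : ℤ) ∣ x σ - 1) {b : K} (hb : b ≠ 0) :
    ∃ z : BrauerGroup.{u, u} K, IsCyclicBrauerClass z ∧
      IsRepresentedBy z fun s t => algebraMap K Ω b ^ y s t := by
  have := NeZero.mk hq
  have hb' : algebraMap K Ω b ≠ 0 := by simpa using hb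
  have hlc : IsLocallyConstant fun s => shiftMatrix q (algebraMap K Ω b) (x s) :=
    hx.comp (shiftMatrix q (algebraMap K Ω b))
  obtain ⟨hfin, hrank, hcyc⟩ := h.isCyclicAlgebra_twistedFixed hb' hx hσ
  set C := twistedFixed fun s => shiftMatrix q (algebraMap K Ω b) (x s)
  have hspan := span_twistedFixed hlc (fun s => isUnit_shiftMatrix hb' _)
    (fun s t => zpow_ne_zero _ hb') (h.shiftMatrix_twisted hb')
  have hcent : Algebra.IsCentral K C := isCentral_of_span_eq_top hspan fun c hc => by
    refine (InfiniteGalois.mem_range_algebraMap_iff_fixed _).2 fun s => ?_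
    have h1 := hc s
    rw [galMatrix_smul, map_one, mul_smul_comm, smul_mul_assoc, one_mul, mul_one] at h1
    exact IsTwistedForm.smul_cancel (isUnit_shiftMatrix hb' _) h1
  have hsimp : IsSimpleRing C := isSimpleRing_of_span_eq_top (by simpa using hrank) hspan
  refine ⟨brauerClass K C, ⟨_, hcyc, rfl⟩, IsTwistedForm.isRepresentedBy (θ := C.val)
    (u := fun s => shiftMatrix q (algebraMap K Ω b) (x s)) ⟨by simpa using hrank, hlc,
      fun s => isUnit_shiftMatrix hb' _, fun s a => a.2 s, h.shiftMatrix_twisted hb'⟩⟩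

end IsCarry

end CyclicAlgebras

/-! ### Finite unramified domains over a complete discrete valuation ring. -/

section UnramifiedOverComplete

open IsLocalRing Polynomial

/-- A finite module over a Noetherian complete ring is precomplete. -/
theorem isPrecomplete_of_finite {O : Type*} [CommRing O] (I : Ideal O) [IsAdicComplete I O]
    (M : Type*) [AddCommGroup M] [Module O M] [Module.Finite O M] : IsPrecomplete I M := by
  rw [← AdicCompletion.of_surjective_iff]
  intro y
  obtain ⟨z, rfl⟩ := AdicCompletion.ofTensorProduct_surjective_of_finite I M y
  induction z with
  | zero => exact ⟨0, by simp⟩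
  | add a b ha hb =>
    obtain ⟨a', ha⟩ := ha
    obtain ⟨b', hb⟩ := hb
    exact ⟨a' + b', by rw [map_add, map_add, ha, hb]⟩
  | tmul r m =>
    obtain ⟨r, rfl⟩ := AdicCompletion.of_surjective I O r
    refine ⟨r • m, ?_⟩
    rw [AdicCompletion.ofTensorProduct_tmul, map_smul]
    ext n
    rfl

/-- In an Artinian reduced ring with only trivial idempotents each element is zero or a unit. -/
theorem isUnit_or_eq_zero_of_idempotents {A : Type*} [CommRing A] [IsArtinianRing A] [IsReduced A]
    (h : ∀ e : A, e * e = e → e = 0 ∨ e = 1) (a : A) : IsUnit a ∨ a = 0 := by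
  obtain ⟨n, y, hy⟩ := IsArtinian.exists_pow_succ_smul_dvd a (1 : A)
  simp only [smul_eq_mul, mul_one] at hy
  have h1 : a = a * a * y := by
    rw [← sub_eq_zero]
    refine IsReduced.eq_zero _ ⟨n + 1, ?_⟩
    rw [show a - a * a * y = a * (1 - a * y) by ring, mul_pow, pow_succ (1 - a * y),
      show a ^ (n + 1) * ((1 - a * y) ^ n * (1 - a * y)) =
        (1 - a * y) ^ n * (a * (a ^ n - a ^ (n + 1) * y)) by ring, hy]
    ring
  rcases h (a * y) (by rw [show a * y * (a * y) = a * a * y * y by ring, ← h1]) with h0 | h0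
  · right
    rw [h1, mul_assoc, h0, mul_zero]
  · left
    exact IsUnit.of_mul_eq_one y h0

variable {O S : Type*} [CommRing O] [IsDomain O] [IsDiscreteValuationRing O]
  [IsAdicComplete (maximalIdeal O) O] [CommRing S] [IsDomain S] [Algebra O S] [FaithfulSMul O S]
  [Module.Finite O S]

theorem map_maximalIdeal_ne_top : (maximalIdeal O).map (algebraMap O S) ≠ ⊤ := by
  intro h
  obtain ⟨Q, hQ, hQO⟩ := Ideal.exists_ideal_over_maximal_of_isIntegral (S := S) (maximalIdeal O)
    (by rw [(RingHom.injective_iff_ker_eq_bot _).1 (FaithfulSMul.algebraMap_injective O S)]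
        exact bot_le)
  exact hQ.ne_top (eq_top_iff.2 (h ▸ Ideal.map_le_iff_le_comap.2 hQO.ge))

theorem isAdicComplete_map_maximalIdeal :
    IsAdicComplete ((maximalIdeal O).map (algebraMap O S)) S := by
  have : IsNoetherianRing S := IsNoetherianRing.of_finite O S
  have h1 : IsHausdorff ((maximalIdeal O).map (algebraMap O S)) S :=
    IsHausdorff.of_isDomain _ map_maximalIdeal_ne_top
  have h2 : IsPrecomplete ((maximalIdeal O).map (algebraMap O S)) S :=
    IsPrecomplete.map_algebraMap_iff.2 (isPrecomplete_of_finite _ _)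
  exact {}

theorem isArtinianRing_isReduced_of_formallyUnramified [Algebra.FormallyUnramified O S] :
    IsArtinianRing (S ⧸ (maximalIdeal O).map (algebraMap O S)) ∧
      IsReduced (S ⧸ (maximalIdeal O).map (algebraMap O S)) := by
  let _ := Ideal.Quotient.field (maximalIdeal O)
  have : Module.Finite (O ⧸ maximalIdeal O) (S ⧸ (maximalIdeal O).map (algebraMap O S)) :=
    Module.Finite.of_restrictScalars_finite O _ _
  exact ⟨isArtinian_of_tower (O ⧸ maximalIdeal O) inferInstance,
    Algebra.FormallyUnramified.isReduced_of_field (O ⧸ maximalIdeal O) _⟩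

/-- Hensel's lemma for X(X - 1): at an idempotent modulo `I` the derivative 2X - 1 has square one.
The lifted root is 0 or 1 because `R` is a domain. -/
theorem eq_zero_or_one_of_idempotent_of_isAdicComplete {R : Type*} [CommRing R] [IsDomain R]
    (I : Ideal R) [IsAdicComplete I R] (e : R ⧸ I) (he : e * e = e) : e = 0 ∨ e = 1 := by
  obtain ⟨a, rfl⟩ := Ideal.Quotient.mk_surjective e
  have he' : a * a - a ∈ I := by
    rw [← Ideal.Quotient.eq_zero_iff_mem, map_sub, map_mul, he, sub_self]
  have h1 : (X * (X - C 1) : R[X]).Monic := monic_X.mul (monic_X_sub_C 1)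
  have h2 : (X * (X - C 1) : R[X]).eval a ∈ I := by
    rwa [eval_mul, eval_sub, eval_X, eval_C, mul_sub, mul_one]
  have h3 : (X * (X - C 1) : R[X]).derivative.eval a = 2 * a - 1 := by
    simp only [derivative_mul, derivative_sub, derivative_X, derivative_C, eval_add, eval_mul,
      eval_sub, eval_X, eval_C, eval_one, eval_zero]
    ring
  have h4 : IsUnit (Ideal.Quotient.mk I ((X * (X - C 1) : R[X]).derivative.eval a)) := by
    rw [h3]
    refine IsUnit.of_mul_eq_one (Ideal.Quotient.mk I (2 * a - 1)) ?_
    rw [← map_mul, ← map_one (Ideal.Quotient.mk I), Ideal.Quotient.mk_eq_mk_iff_sub_mem,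
      show (2 * a - 1) * (2 * a - 1) - 1 = 4 * (a * a - a) by ring]
    exact I.mul_mem_left _ he'
  have hH : HenselianRing R I := inferInstance
  obtain ⟨b, hb, hba⟩ := hH.is_henselian _ h1 a h2 h4
  have hb' : b * (b - 1) = 0 := by
    rwa [IsRoot, eval_mul, eval_sub, eval_X, eval_C] at hb
  rw [← Ideal.Quotient.mk_eq_mk_iff_sub_mem] at hba
  rcases mul_eq_zero.1 hb' with h | h
  · left
    rw [← hba, h, map_zero]
  · right
    rw [← hba, sub_eq_zero.1 h, map_one]

/-- Modulo the maximal ideal of `O`, `S` is Artinian, reduced by unramifiedness, and has no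
nontrivial idempotents, so each class is zero or a unit. Units lift because the extended ideal lies
in the Jacobson radical. -/
theorem isUnit_or_mem_of_formallyUnramified [Algebra.FormallyUnramified O S] (x : S) :
    IsUnit x ∨ x ∈ (maximalIdeal O).map (algebraMap O S) := by
  have hcomp : IsAdicComplete ((maximalIdeal O).map (algebraMap O S)) S :=
    isAdicComplete_map_maximalIdeal
  obtain ⟨_, _⟩ := isArtinianRing_isReduced_of_formallyUnramified (O := O) (S := S)
  rcases isUnit_or_eq_zero_of_idempotents
    (eq_zero_or_one_of_idempotent_of_isAdicComplete ((maximalIdeal O).map (algebraMap O S)))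
    (Ideal.Quotient.mk _ x) with h | h
  · left
    have := isLocalHom_of_le_jacobson_bot _
      (IsAdicComplete.le_jacobson_bot ((maximalIdeal O).map (algebraMap O S)))
    exact this.map_nonunit x h
  · right
    exact Ideal.Quotient.eq_zero_iff_mem.1 h

theorem isLocalRing_of_formallyUnramified [Algebra.FormallyUnramified O S] : IsLocalRing S := by
  refine IsLocalRing.of_isUnit_or_isUnit_one_sub_self fun x => ?_
  rw [or_iff_not_imp_left]
  intro hx
  have h1 := (isUnit_or_mem_of_formallyUnramified (O := O) x).resolve_left hx
  refine ((isUnit_or_mem_of_formallyUnramified (O := O) (1 - x))).resolve_right fun h2 => ?_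
  refine map_maximalIdeal_ne_top (O := O) (S := S) ((Ideal.eq_top_iff_one _).2 ?_)
  simpa using Ideal.add_mem _ h1 h2

theorem isDiscreteValuationRing_of_formallyUnramified [Algebra.FormallyUnramified O S] :
    IsDiscreteValuationRing S := by
  have : IsLocalRing S := isLocalRing_of_formallyUnramified (O := O)
  have : IsNoetherianRing S := IsNoetherianRing.of_finite O S
  obtain ⟨π, hπ⟩ := IsDiscreteValuationRing.exists_irreducible O
  have hmax : maximalIdeal S = Ideal.span {algebraMap O S π} := by
    have h1 : (maximalIdeal O).map (algebraMap O S) = Ideal.span {algebraMap O S π} := by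
      rw [(IsDiscreteValuationRing.irreducible_iff_uniformizer π).1 hπ, Ideal.map_span,
        Set.image_singleton]
    rw [← h1]
    refine le_antisymm (fun x hx => ?_) (le_maximalIdeal map_maximalIdeal_ne_top)
    exact (isUnit_or_mem_of_formallyUnramified (O := O) x).resolve_left hx
  have hne : ¬ IsField S := by
    intro hf
    rw [IsLocalRing.isField_iff_maximalIdeal_eq, hmax, Ideal.span_singleton_eq_bot,
      map_eq_zero_iff _ (FaithfulSMul.algebraMap_injective O S)] at hf
    exact hπ.ne_zero hf
  refine ((IsDiscreteValuationRing.TFAE S hne).out 0 4).2 ?_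
  rw [hmax]
  exact ⟨⟨_, rfl⟩⟩

end UnramifiedOverComplete

/-! ### Unramified subalgebras of a field, handled through derivations. -/

section UnramifiedSubalgebras

open IsLocalRing

theorem Derivation.eq_zero_of_formallyUnramified {O R M : Type*} [CommRing O] [CommRing R]
    [Algebra O R] [AddCommGroup M] [Module O M] [Module R M] [IsScalarTower O R M]
    [Algebra.FormallyUnramified O R] (D : Derivation O R M) : D = 0 := by
  rw [← D.liftKaehlerDifferential_comp]
  ext x
  have : KaehlerDifferential.D O R x = 0 := Subsingleton.elim _ _
  simp [this]

theorem formallyUnramified_of_derivation_eq_zero {O R : Type*} [CommRing O] [CommRing R]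
    [Algebra O R] (h : KaehlerDifferential.D O R = 0) : Algebra.FormallyUnramified O R := by
  constructor
  have h1 := KaehlerDifferential.span_range_derivation O R
  have h2 : Set.range (KaehlerDifferential.D O R) ⊆ {0} := by
    rintro _ ⟨x, rfl⟩
    simp [h]
  rw [← Submodule.subsingleton_iff R, ← subsingleton_iff_bot_eq_top, ← h1, eq_comm,
    Submodule.span_eq_bot]
  exact h2

variable {O Ω : Type*} [CommRing O] [Field Ω] [Algebra O Ω]

/-- `D` restricts to a derivation of the unramified algebra `R`, hence to zero. Together with
`derivation_eq_zero_of_adjoin` this lets unramifiedness be checked on generators. -/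
theorem derivation_eq_zero_of_le {R R' : Subalgebra O Ω} (h : R ≤ R')
    [Algebra.FormallyUnramified O R] {M : Type*} [AddCommGroup M] [Module O M] [Module R' M]
    [IsScalarTower O R' M] (D : Derivation O R' M) {x : Ω} (hx : x ∈ R) : D ⟨x, h hx⟩ = 0 := by
  let : Algebra R R' := (Subalgebra.inclusion h).toAlgebra
  let : Module R M := Module.compHom M (algebraMap R R')
  have h1 : IsScalarTower O R R' := IsScalarTower.of_algebraMap_eq fun _ => rfl
  have h2 : IsScalarTower R R' M := ⟨fun a b m => mul_smul (algebraMap R R' a) b m⟩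
  have h3 : IsScalarTower O R M := ⟨fun a b m => by
    change algebraMap R R' (a • b) • m = a • algebraMap R R' b • m
    rw [Algebra.smul_def, map_mul, ← IsScalarTower.algebraMap_apply, ← Algebra.smul_def,
      smul_assoc]⟩
  exact DFunLike.congr_fun (D.compAlgebraMap R).eq_zero_of_formallyUnramified ⟨x, hx⟩

theorem derivation_eq_zero_of_adjoin {R : Subalgebra O Ω} {s : Set Ω}
    (hR : R = Algebra.adjoin O s) {M : Type*} [AddCommGroup M] [Module O M] [Module R M]
    [IsScalarTower O R M] (D : Derivation O R M)
    (h : ∀ x ∈ s, ∀ hx : x ∈ R, D ⟨x, hx⟩ = 0) : D = 0 := by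
  suffices ∀ x ∈ Algebra.adjoin O s, ∀ hx : x ∈ R, D ⟨x, hx⟩ = 0 from
    Derivation.ext fun x => this x (hR ▸ x.2) x.2
  intro x hx
  induction hx using Algebra.adjoin_induction with
  | mem x hx => exact h x hx
  | algebraMap r => exact fun hx => D.map_algebraMap r
  | add x y hx hy ihx ihy =>
    intro hxy
    have := D.map_add ⟨x, hR ▸ hx⟩ ⟨y, hR ▸ hy⟩
    rw [ihx, ihy, add_zero] at this
    exact this
  | mul x y hx hy ihx ihy =>
    intro hxy
    have := D.leibniz ⟨x, hR ▸ hx⟩ ⟨y, hR ▸ hy⟩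
    rw [ihx, ihy, smul_zero, smul_zero, add_zero] at this
    exact this

/-- A subalgebra which is finite and unramified over the base. -/
structure Subalgebra.IsUnramified (R : Subalgebra O Ω) : Prop where
  finite : Module.Finite O R
  formallyUnramified : Algebra.FormallyUnramified O R

namespace Subalgebra.IsUnramified

variable {R R₁ R₂ : Subalgebra O Ω}

theorem sup (h₁ : R₁.IsUnramified) (h₂ : R₂.IsUnramified) : (R₁ ⊔ R₂).IsUnramified := by
  have := h₁.finite
  have := h₂.finite
  have := h₁.formallyUnramified
  have := h₂.formallyUnramified
  refine ⟨Subalgebra.finite_sup R₁ R₂, formallyUnramified_of_derivation_eq_zero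
    (derivation_eq_zero_of_adjoin (s := R₁ ∪ R₂) ?_ _ ?_)⟩
  · rw [Algebra.adjoin_union, Algebra.adjoin_eq, Algebra.adjoin_eq]
  · rintro x (hx | hx) _
    · exact derivation_eq_zero_of_le le_sup_left _ hx
    · exact derivation_eq_zero_of_le le_sup_right _ hx

theorem map {Ω' : Type*} [Field Ω'] [Algebra O Ω'] (h : R.IsUnramified) (f : Ω →ₐ[O] Ω') :
    (R.map f).IsUnramified := by
  have := h.finite
  have := h.formallyUnramified
  let e := R.equivMapOfInjective f f.toRingHom.injective
  exact ⟨Module.Finite.equiv e.toLinearEquiv, Algebra.FormallyUnramified.of_equiv e⟩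

theorem bot : (⊥ : Subalgebra O Ω).IsUnramified := by
  let f : O →ₐ[O] (⊥ : Subalgebra O Ω) := Algebra.ofId _ _
  have hf : Function.Surjective f := fun x => by
    obtain ⟨r, hr⟩ := Algebra.mem_bot.1 x.2
    exact ⟨r, Subtype.ext hr⟩
  exact ⟨Module.Finite.of_surjective f.toLinearMap hf, Algebra.FormallyUnramified.of_surjective f hf⟩

variable [IsDomain O] [IsDiscreteValuationRing O] [IsAdicComplete (maximalIdeal O) O]
  [FaithfulSMul O Ω]

theorem isDiscreteValuationRing (h : R.IsUnramified) : IsDiscreteValuationRing R := by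
  have := h.finite
  have := h.formallyUnramified
  exact isDiscreteValuationRing_of_formallyUnramified (O := O)

theorem irreducible (h : R.IsUnramified) {π : O} (hπ : Irreducible π) :
    Irreducible (algebraMap O R π) := by
  have := h.finite
  have := h.formallyUnramified
  have := h.isDiscreteValuationRing
  rw [IsDiscreteValuationRing.irreducible_iff_uniformizer] at hπ ⊢
  rw [← Set.image_singleton, ← Ideal.map_span, ← hπ]
  refine le_antisymm (fun x hx => ?_) (le_maximalIdeal map_maximalIdeal_ne_top)
  exact (isUnit_or_mem_of_formallyUnramified (O := O) x).resolve_left hx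

/-- An unramified subalgebra is integrally closed in the ambient field. -/
theorem mem_of_isIntegral (h : R.IsUnramified) {x : Ω} (hx : IsIntegral O x) {k : O} (hk : k ≠ 0)
    (hkx : k • x ∈ R) : x ∈ R := by
  have := h.isDiscreteValuationRing
  have hk' : algebraMap O R k ≠ 0 := by
    rwa [ne_eq, map_eq_zero_iff _ (FaithfulSMul.algebraMap_injective O R)]
  let := FractionRing.liftAlgebra R Ω
  have hkΩ : algebraMap O Ω k ≠ 0 := by
    rwa [ne_eq, map_eq_zero_iff _ (FaithfulSMul.algebraMap_injective O Ω)]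
  let z : FractionRing R := algebraMap R _ ⟨k • x, hkx⟩ / algebraMap R _ (algebraMap O R k)
  have hz : algebraMap (FractionRing R) Ω z = x := by
    rw [map_div₀, ← IsScalarTower.algebraMap_apply, ← IsScalarTower.algebraMap_apply]
    change (k • x) / algebraMap O Ω k = x
    rw [Algebra.smul_def]
    field_simp
  have h1 : IsIntegral R x := hx.tower_top
  rw [← hz, isIntegral_algebraMap_iff (algebraMap (FractionRing R) Ω).injective,
    IsIntegrallyClosed.isIntegral_iff] at h1
  obtain ⟨y, hy⟩ := h1
  rw [← hz, ← hy, ← IsScalarTower.algebraMap_apply]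
  exact y.2

/-- Adjoining a root of an Artin–Schreier equation to an unramified subalgebra. -/
theorem exists_adjoin_root (h : R.IsUnramified) {p : ℕ} (hp : p.Prime)
    (hpm : (p : O) ∈ maximalIdeal O) {a θ : Ω}
    (ha : a ∈ R) (hθ : θ ^ p - θ = a) : ∃ R' : Subalgebra O Ω, R'.IsUnramified ∧ θ ∈ R' := by
  have := h.finite
  have := h.formallyUnramified
  have hint : IsIntegral O θ := by
    have hdeg : (Polynomial.X : Polynomial O).degree < p := by
      rw [Polynomial.degree_X]
      exact_mod_cast hp.one_lt
    refine IsIntegral.of_aeval_monic (p := Polynomial.X ^ p - Polynomial.X)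
      (Polynomial.monic_X_pow_sub hdeg) ?_ ?_
    · rw [Polynomial.natDegree_sub_eq_left_of_natDegree_lt, Polynomial.natDegree_X_pow]
      · exact hp.ne_zero
      · rw [Polynomial.natDegree_X_pow, Polynomial.natDegree_X]
        exact hp.one_lt
    · rw [map_sub, map_pow, Polynomial.aeval_X, hθ]
      exact (Algebra.IsIntegral.isIntegral (R := O) (⟨a, ha⟩ : R)).algebraMap (B := Ω)
  have := Algebra.finite_adjoin_simple_of_isIntegral hint
  let R' := R ⊔ Algebra.adjoin O {θ}
  have hR' : Module.Finite O R' := Subalgebra.finite_sup R _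
  have hθR' : θ ∈ R' := (le_sup_right : Algebra.adjoin O {θ} ≤ R') (Algebra.subset_adjoin rfl)
  refine ⟨R', ⟨hR', formallyUnramified_of_derivation_eq_zero
    (derivation_eq_zero_of_adjoin (s := R ∪ {θ}) ?_ _ ?_)⟩, hθR'⟩
  · rw [Algebra.adjoin_union, Algebra.adjoin_eq]
  · rintro x (hx | rfl) _
    · exact derivation_eq_zero_of_le le_sup_left _ hx
    · let t : R' := ⟨x, hθR'⟩
      have h1 : KaehlerDifferential.D O R' (t ^ p - t) = 0 := by
        have h2 : t ^ p - t = ⟨a, (le_sup_left : R ≤ R') ha⟩ := Subtype.ext hθ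
        rw [h2]
        exact derivation_eq_zero_of_le le_sup_left _ ha
      have hcomp : IsAdicComplete ((maximalIdeal O).map (algebraMap O R')) R' :=
        isAdicComplete_map_maximalIdeal
      -- Differentiating t^p - t = a gives (1 - p t^(p-1)) dt = 0, and this factor is a unit because
      -- p lies in the Jacobson radical.
      have hunit : IsUnit ((p : R') * (-t ^ (p - 1)) + 1) := by
        refine Ideal.mem_jacobson_bot.1 (IsAdicComplete.le_jacobson_bot
          ((maximalIdeal O).map (algebraMap O R')) ?_) _
        have := Ideal.mem_map_of_mem (algebraMap O R') hpm
        rwa [map_natCast] at this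
      rw [map_sub, Derivation.leibniz_pow, ← Nat.cast_smul_eq_nsmul R', smul_smul,
        sub_eq_zero] at h1
      have h2 : ((p : R') * (-t ^ (p - 1)) + 1) • KaehlerDifferential.D O R' t = 0 := by
        rw [add_smul, one_smul, mul_neg, neg_smul, h1, neg_add_cancel]
      exact (hunit.smul_eq_zero).1 h2

end Subalgebra.IsUnramified

end UnramifiedSubalgebras

/-! ### The maximal unramified extension as a union of fraction fields of unramified subalgebras. -/

section MaximalUnramified

open IsLocalRing

/-- The definition builds its own `O`-algebra structure on `L`; this exchanges it for any compatible
one. -/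
theorem isUnramifiedExtension_iff {O K L : Type*} [CommRing O] [Field K] [Algebra O K] [Field L]
    [Algebra K L] [inst : Algebra O L] [IsScalarTower O K L] :
    IsUnramifiedExtension O K L ↔ Algebra.FormallyUnramified O (integralClosure O L) := by
  have h : Algebra.compHom L (algebraMap O K) = inst :=
    Algebra.algebra_ext _ _ fun r => (IsScalarTower.algebraMap_apply O K L r).symm
  subst h
  rfl

variable {O K Ω : Type*} [CommRing O] [Field K] [Algebra O K] [Field Ω] [Algebra K Ω]
  [Algebra O Ω] [IsScalarTower O K Ω]

variable [IsDomain O] [IsFractionRing O K] [Algebra.IsAlgebraic K Ω]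

variable (K) in
/-- The field of fractions, over the base field, of a subalgebra over the ring of integers. -/
def Subalgebra.fractionSubfield (R : Subalgebra O Ω) : IntermediateField K Ω :=
  Subalgebra.toIntermediateField
    { carrier := {x | ∃ k : O, k ≠ 0 ∧ k • x ∈ R}
      mul_mem' := by
        rintro x y ⟨k, hk, hx⟩ ⟨m, hm, hy⟩
        refine ⟨k * m, mul_ne_zero hk hm, ?_⟩
        rw [← smul_mul_smul_comm]
        exact R.mul_mem hx hy
      add_mem' := by
        rintro x y ⟨k, hk, hx⟩ ⟨m, hm, hy⟩
        refine ⟨k * m, mul_ne_zero hk hm, ?_⟩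
        rw [smul_add]
        refine R.add_mem ?_ ?_
        · rw [mul_comm, mul_smul]
          exact R.smul_mem hx m
        · rw [mul_smul]
          exact R.smul_mem hy k
      algebraMap_mem' := fun c => by
        obtain ⟨a, b, hb, rfl⟩ := IsFractionRing.div_surjective (A := O) c
        have hb0 : algebraMap O K b ≠ 0 := by
          rw [ne_eq, map_eq_zero_iff _ (IsFractionRing.injective O K)]
          exact nonZeroDivisors.ne_zero hb
        refine ⟨b, nonZeroDivisors.ne_zero hb, ?_⟩
        rw [Algebra.smul_def, IsScalarTower.algebraMap_apply O K Ω, ← map_mul,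
          mul_div_cancel₀ _ hb0, ← IsScalarTower.algebraMap_apply]
        exact R.algebraMap_mem a }
    (fun x hx => Subalgebra.inv_mem_of_algebraic _ (x := ⟨x, hx⟩) (Algebra.IsAlgebraic.isAlgebraic x))

theorem Subalgebra.le_fractionSubfield {R : Subalgebra O Ω} {x : Ω} (hx : x ∈ R) :
    x ∈ R.fractionSubfield K := ⟨1, one_ne_zero, by rwa [one_smul]⟩

theorem Subalgebra.fractionSubfield_mono {R R' : Subalgebra O Ω} (h : R ≤ R') :
    R.fractionSubfield K ≤ R'.fractionSubfield K := fun _ ⟨k, hk, hx⟩ => ⟨k, hk, h hx⟩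

theorem Subalgebra.finiteDimensional_fractionSubfield (R : Subalgebra O Ω) [Module.Finite O R] :
    FiniteDimensional K (R.fractionSubfield K) := by
  obtain ⟨s, hs⟩ := Module.Finite.fg_top (R := O) (M := R)
  have hle : (R.fractionSubfield K).toSubalgebra.toSubmodule ≤
      Submodule.span K (Subtype.val '' (s : Set R)) := by
    rintro x ⟨k, hk, hx⟩
    have h1 : (⟨k • x, hx⟩ : R) ∈ Submodule.span O (s : Set R) := by rw [hs]; trivial
    have h2 : ∀ z ∈ Submodule.span O (s : Set R),
        (z : Ω) ∈ Submodule.span K (Subtype.val '' (s : Set R)) := by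
      intro z hz
      induction hz using Submodule.span_induction with
      | mem z hz => exact Submodule.subset_span ⟨z, hz, rfl⟩
      | zero => exact Submodule.zero_mem _
      | add y z _ _ hy hz => exact Submodule.add_mem _ hy hz
      | smul a z _ hz =>
        change a • (z : Ω) ∈ _
        rw [← algebraMap_smul K]
        exact Submodule.smul_mem _ _ hz
    have h3 : algebraMap O K k • x ∈ Submodule.span K (Subtype.val '' (s : Set R)) := by
      rw [algebraMap_smul]
      exact h2 _ h1
    have hk0 : algebraMap O K k ≠ 0 := by
      rwa [ne_eq, map_eq_zero_iff _ (IsFractionRing.injective O K)]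
    have h4 := Submodule.smul_mem _ (algebraMap O K k)⁻¹ h3
    rwa [smul_smul, inv_mul_cancel₀ hk0, one_smul] at h4
  have hfin : Module.Finite K (Submodule.span K (Subtype.val '' (s : Set R))) :=
    Module.Finite.span_of_finite K (s.finite_toSet.image _)
  exact Submodule.finiteDimensional_of_le hle

/-- The image of the integers of a finite extension is finite over the base. -/
theorem IntermediateField.finite_integralClosure [IsIntegrallyClosed O] [IsNoetherianRing O]
    [CharZero K] (L : IntermediateField K Ω) [FiniteDimensional K L] :
    Module.Finite O (integralClosure O L) :=
  IsIntegralClosure.finite O K L (integralClosure O L)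

variable [IsDiscreteValuationRing O] [IsAdicComplete (maximalIdeal O) O]

/-- By `mem_of_isIntegral`, `R` contains every integral element of its fraction field, so it is the
full ring of integers there. -/
theorem Subalgebra.IsUnramified.isUnramifiedExtension {R : Subalgebra O Ω} [FaithfulSMul O Ω]
    (h : R.IsUnramified) : IsUnramifiedExtension O K (R.fractionSubfield K) := by
  rw [isUnramifiedExtension_iff]
  let f : R.fractionSubfield K →ₐ[O] Ω := (R.fractionSubfield K).val.restrictScalars O
  have hf : Function.Injective f := f.toRingHom.injective
  have h1 : (integralClosure O (R.fractionSubfield K)).map f = R := by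
    ext x
    constructor
    · rintro ⟨y, hy, rfl⟩
      obtain ⟨k, hk, hx⟩ := y.2
      exact h.mem_of_isIntegral ((isIntegral_algHom_iff f hf).2 hy) hk hx
    · intro hx
      have := h.finite
      have hi : IsIntegral O x :=
        (Algebra.IsIntegral.isIntegral (R := O) (⟨x, hx⟩ : R)).algebraMap (B := Ω)
      exact ⟨⟨x, Subalgebra.le_fractionSubfield hx⟩, (isIntegral_algHom_iff f hf).1 hi, rfl⟩
  have h2 := h.formallyUnramified
  rw [← h1] at h2
  exact Algebra.FormallyUnramified.of_equiv
    ((integralClosure O (R.fractionSubfield K)).equivMapOfInjective f hf).symm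

theorem isUnramified_map_integralClosure [CharZero K] {L : IntermediateField K Ω}
    [FiniteDimensional K L] (h : IsUnramifiedExtension O K L) :
    ((integralClosure O L).map (L.val.restrictScalars O)).IsUnramified := by
  rw [isUnramifiedExtension_iff] at h
  have hf : Function.Injective (L.val.restrictScalars O) := L.val.toRingHom.injective
  let e := (integralClosure O L).equivMapOfInjective (L.val.restrictScalars O) hf
  have := L.finite_integralClosure (O := O)
  exact ⟨Module.Finite.equiv e.toLinearEquiv, Algebra.FormallyUnramified.of_equiv e⟩

theorem le_fractionSubfield_map_integralClosure (L : IntermediateField K Ω) :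
    L ≤ ((integralClosure O L).map (L.val.restrictScalars O)).fractionSubfield K := by
  intro x hx
  have h1 : Algebra.IsAlgebraic O Ω :=
    (IsFractionRing.comap_isAlgebraic_iff (A := O) (K := K) (C := Ω)).2 inferInstance
  obtain ⟨k, hk, hi⟩ := (h1.isAlgebraic x).exists_integral_multiple
  refine ⟨k, hk, ⟨k • ⟨x, hx⟩, ?_, rfl⟩⟩
  exact (isIntegral_algHom_iff (L.val.restrictScalars O) L.val.toRingHom.injective).1 hi

/-- An extension of the base field all whose elements are fractions of elements of unramified
subalgebras, and which contains the roots of integral Artin–Schreier equations. -/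
structure IsUnramifiedClosed (O Ω : Type*) [CommRing O] [Field Ω] [Algebra O Ω] (p : ℕ) : Prop where
  exists_smul_mem : ∀ x : Ω, ∃ R : Subalgebra O Ω, R.IsUnramified ∧ ∃ k : O, k ≠ 0 ∧ k • x ∈ R
  exists_root : ∀ a : Ω, IsIntegral O a → ∃ θ : Ω, θ ^ p - θ = a

section SeparableClosure

variable {O : Type*} {K : Type u} [CommRing O] [IsDomain O]
    [IsDiscreteValuationRing O] [IsAdicComplete (maximalIdeal O) O]
    [Field K] [Algebra O K] [IsFractionRing O K] [CharZero K]

theorem faithfulSMul_of_isFractionRing {Ω : Type*} [Field Ω] [Algebra K Ω]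
    [Algebra O Ω] [IsScalarTower O K Ω] : FaithfulSMul O Ω := by
  rw [faithfulSMul_iff_algebraMap_injective, IsScalarTower.algebraMap_eq O K Ω]
  exact (algebraMap K Ω).injective.comp (IsFractionRing.injective O K)

/-- Unramified subalgebras are stable under joins, so the union of their fraction fields is a field.
It contains each finite unramified extension, hence the compositum. -/
theorem mem_maximalUnramifiedExtension_iff {x : SeparableClosure K} :
    x ∈ maximalUnramifiedExtension O K ↔
      ∃ R : Subalgebra O (SeparableClosure K), R.IsUnramified ∧ x ∈ R.fractionSubfield K := by
  have : FaithfulSMul O (SeparableClosure K) := faithfulSMul_of_isFractionRing (K := K)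
  constructor
  · intro hx
    let U : IntermediateField K (SeparableClosure K) := Subalgebra.toIntermediateField
      { carrier := {x | ∃ R : Subalgebra O (SeparableClosure K), R.IsUnramified ∧
          x ∈ R.fractionSubfield K}
        mul_mem' := by
          rintro x y ⟨R, hR, hx⟩ ⟨R', hR', hy⟩
          exact ⟨_, hR.sup hR', mul_mem (Subalgebra.fractionSubfield_mono le_sup_left hx)
            (Subalgebra.fractionSubfield_mono le_sup_right hy)⟩
        add_mem' := by
          rintro x y ⟨R, hR, hx⟩ ⟨R', hR', hy⟩
          exact ⟨_, hR.sup hR', add_mem (Subalgebra.fractionSubfield_mono le_sup_left hx)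
            (Subalgebra.fractionSubfield_mono le_sup_right hy)⟩
        algebraMap_mem' := fun c => ⟨⊥, .bot, algebraMap_mem _ c⟩ }
      (by rintro x ⟨R, hR, hx⟩; exact ⟨R, hR, inv_mem hx⟩)
    have hle : maximalUnramifiedExtension O K ≤ U := by
      refine iSup_le fun L => iSup_le fun hL => iSup_le fun hu => fun y hy => ?_
      exact ⟨_, isUnramified_map_integralClosure hu, le_fractionSubfield_map_integralClosure L hy⟩
    exact hle hx
  · rintro ⟨R, hR, hx⟩
    have := hR.finite
    exact (le_iSup_of_le (R.fractionSubfield K) (le_iSup_of_le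
      R.finiteDimensional_fractionSubfield (le_iSup_of_le hR.isUnramifiedExtension le_rfl)) :
        R.fractionSubfield K ≤ maximalUnramifiedExtension O K) hx

instance isGalois_maximalUnramifiedExtension :
    IsGalois K (maximalUnramifiedExtension O K) := by
  have : Normal K (maximalUnramifiedExtension O K) := by
    rw [IntermediateField.normal_iff_forall_map_le]
    rintro σ _ ⟨x, hx, rfl⟩
    obtain ⟨R, hR, k, hk, hkx⟩ := mem_maximalUnramifiedExtension_iff.1 hx
    refine mem_maximalUnramifiedExtension_iff.2 ⟨_, hR.map (σ.restrictScalars O), k, hk, ?_⟩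
    exact ⟨k • x, hkx, (σ.restrictScalars O).toLinearMap.map_smul k x⟩
  exact {}

theorem isUnramifiedClosed_maximalUnramifiedExtension {p : ℕ} (hp : p.Prime)
    (hpm : (p : O) ∈ maximalIdeal O) :
    IsUnramifiedClosed O (maximalUnramifiedExtension O K) p := by
  have : FaithfulSMul O (SeparableClosure K) := faithfulSMul_of_isFractionRing (K := K)
  let f : maximalUnramifiedExtension O K →ₐ[O] SeparableClosure K :=
    (maximalUnramifiedExtension O K).val.restrictScalars O
  have hf : Function.Injective f := f.toRingHom.injective
  constructor
  · intro x
    obtain ⟨R, hR, k, hk, hkx⟩ := mem_maximalUnramifiedExtension_iff.1 x.2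
    have hmap : (R.comap f).map f = R := by
      refine le_antisymm (Subalgebra.map_le.2 le_rfl) fun y hy => ?_
      have hyM : y ∈ maximalUnramifiedExtension O K :=
        mem_maximalUnramifiedExtension_iff.2 ⟨R, hR, Subalgebra.le_fractionSubfield hy⟩
      exact ⟨⟨y, hyM⟩, hy, rfl⟩
    refine ⟨R.comap f, ?_, k, hk, hkx⟩
    have h1 := hR.finite
    have h2 := hR.formallyUnramified
    rw [← hmap] at h1 h2
    let e := (R.comap f).equivMapOfInjective f hf
    exact ⟨Module.Finite.equiv e.symm.toLinearEquiv, Algebra.FormallyUnramified.of_equiv e.symm⟩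
  · intro a ha
    obtain ⟨R, hR, k, hk, hkx⟩ := mem_maximalUnramifiedExtension_iff.1 a.2
    have haR : (a : SeparableClosure K) ∈ R :=
      hR.mem_of_isIntegral ((isIntegral_algHom_iff f hf).2 ha) hk hkx
    obtain ⟨θ, hθ⟩ := IsAlgClosed.exists_root (k := SeparableClosure K)
      (Polynomial.X ^ p - (Polynomial.X + Polynomial.C (a : SeparableClosure K))) (by
        have h1 : (Polynomial.X + Polynomial.C (a : SeparableClosure K)).degree <
            (Polynomial.X ^ p : Polynomial (SeparableClosure K)).degree := by
          rw [Polynomial.degree_X_add_C, Polynomial.degree_X_pow]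
          exact_mod_cast hp.one_lt
        rw [Polynomial.degree_sub_eq_left_of_degree_lt h1, Polynomial.degree_X_pow]
        exact_mod_cast hp.ne_zero)
    have hθ' : θ ^ p - θ = a := by
      rw [Polynomial.IsRoot, Polynomial.eval_sub, Polynomial.eval_add, Polynomial.eval_pow,
        Polynomial.eval_X, Polynomial.eval_C] at hθ
      linear_combination hθ
    obtain ⟨R', hR', hθR'⟩ := hR.exists_adjoin_root hp hpm haR hθ'
    exact ⟨⟨θ, mem_maximalUnramifiedExtension_iff.2 ⟨R', hR', Subalgebra.le_fractionSubfield hθR'⟩⟩,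
      Subtype.ext hθ'⟩

end SeparableClosure

end MaximalUnramified

/-! ### The integers of Ω: locality, π-adic valuation and residue field. -/

namespace IsUnramifiedClosed

open IsLocalRing

variable {O K Ω : Type*} [CommRing O] [Field K] [Algebra O K] [Field Ω] [Algebra K Ω]
  [Algebra O Ω] [IsScalarTower O K Ω] [IsDomain O] [IsFractionRing O K]
  [IsDiscreteValuationRing O] [IsAdicComplete (maximalIdeal O) O] [FaithfulSMul O Ω]
  {p : ℕ} {π : O}

theorem exists_mem (hΩ : IsUnramifiedClosed O Ω p) {x : Ω} (hx : IsIntegral O x) :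
    ∃ R : Subalgebra O Ω, R.IsUnramified ∧ x ∈ R := by
  obtain ⟨R, hR, k, hk, hkx⟩ := hΩ.exists_smul_mem x
  exact ⟨R, hR, hR.mem_of_isIntegral hx hk hkx⟩

theorem _root_.Subalgebra.IsUnramified.le_integralClosure {R : Subalgebra O Ω} (h : R.IsUnramified) :
    R ≤ integralClosure O Ω := fun x hx => by
  have := h.finite
  exact (Algebra.IsIntegral.isIntegral (R := O) (⟨x, hx⟩ : R)).algebraMap (B := Ω)

/-- Each integer lies in an unramified subalgebra, which is a discrete valuation ring with
uniformizer π. -/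
theorem isUnit_or_dvd (hΩ : IsUnramifiedClosed O Ω p) (hπ : Irreducible π)
    (b : integralClosure O Ω) : IsUnit b ∨ algebraMap O (integralClosure O Ω) π ∣ b := by
  obtain ⟨R, hR, hbR⟩ := hΩ.exists_mem b.2
  have := hR.isDiscreteValuationRing
  let i := Subalgebra.inclusion hR.le_integralClosure
  have hb : b = i ⟨b, hbR⟩ := rfl
  by_cases h : IsUnit (⟨b, hbR⟩ : R)
  · exact .inl (hb ▸ h.map i)
  · right
    have h1 : (⟨b, hbR⟩ : R) ∈ maximalIdeal R := h
    rw [(IsDiscreteValuationRing.irreducible_iff_uniformizer _).1 (hR.irreducible hπ),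
      Ideal.mem_span_singleton] at h1
    rw [hb, ← i.commutes]
    exact map_dvd i h1

theorem not_isUnit_algebraMap (hΩ : IsUnramifiedClosed O Ω p) (hπ : Irreducible π) :
    ¬ IsUnit (algebraMap O (integralClosure O Ω) π) := by
  intro h
  obtain ⟨b, hb⟩ := h.exists_right_inv
  obtain ⟨R, hR, hbR⟩ := hΩ.exists_mem b.2
  refine (hR.irreducible hπ).not_isUnit (IsUnit.of_mul_eq_one ⟨b, hbR⟩ ?_)
  exact Subtype.ext (congrArg (Subtype.val : integralClosure O Ω → Ω) hb)

theorem isLocalRing_integralClosure (hΩ : IsUnramifiedClosed O Ω p) :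
    IsLocalRing (integralClosure O Ω) := by
  obtain ⟨π, hπ⟩ := IsDiscreteValuationRing.exists_irreducible O
  refine .of_nonunits_add fun a b ha hb h => hΩ.not_isUnit_algebraMap hπ ?_
  exact isUnit_of_dvd_unit (dvd_add ((hΩ.isUnit_or_dvd hπ a).resolve_left ha)
    ((hΩ.isUnit_or_dvd hπ b).resolve_left hb)) h

theorem mem_maximalIdeal_iff (hΩ : IsUnramifiedClosed O Ω p) (hπ : Irreducible π)
    [IsLocalRing (integralClosure O Ω)] {b : integralClosure O Ω} :
    b ∈ maximalIdeal (integralClosure O Ω) ↔ algebraMap O (integralClosure O Ω) π ∣ b :=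
  ⟨fun h => (hΩ.isUnit_or_dvd hπ b).resolve_left h, fun ⟨c, hc⟩ => hc ▸ Ideal.mul_mem_right c _
    ((mem_maximalIdeal _).2 (hΩ.not_isUnit_algebraMap hπ))⟩

theorem algebraMap_ne_zero (hπ : Irreducible π) : algebraMap O Ω π ≠ 0 := by
  rw [ne_eq, map_eq_zero_iff _ (FaithfulSMul.algebraMap_injective O Ω)]
  exact hπ.ne_zero

/-- With `zpow_mul_unit_unique` this supplies the π-adic valuation of Ω. Its values are integers
even though π comes from the base: no ramification occurs. -/
theorem exists_zpow_mul_unit (hΩ : IsUnramifiedClosed O Ω p) (hπ : Irreducible π) {x : Ω}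
    (hx : x ≠ 0) : ∃ (n : ℤ) (u : (integralClosure O Ω)ˣ), x = algebraMap O Ω π ^ n * (u : integralClosure O Ω) := by
  obtain ⟨R, hR, k, hk, hkx⟩ := hΩ.exists_smul_mem x
  have := hR.isDiscreteValuationRing
  have hk' : algebraMap O Ω k ≠ 0 := by
    rwa [ne_eq, map_eq_zero_iff _ (FaithfulSMul.algebraMap_injective O Ω)]
  have hkx0 : (⟨k • x, hkx⟩ : R) ≠ 0 := by
    rw [ne_eq, Subtype.ext_iff]
    change ¬ k • x = 0
    rw [Algebra.smul_def]
    exact mul_ne_zero hk' hx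
  obtain ⟨n, u, hu⟩ := IsDiscreteValuationRing.eq_unit_mul_pow_irreducible hkx0 (hR.irreducible hπ)
  obtain ⟨m, w, hw⟩ := IsDiscreteValuationRing.eq_unit_mul_pow_irreducible hk hπ
  let i := Subalgebra.inclusion hR.le_integralClosure
  let w' : (integralClosure O Ω)ˣ := Units.map (algebraMap O (integralClosure O Ω)).toMonoidHom w
  refine ⟨n - m, Units.map i.toRingHom.toMonoidHom u * w'⁻¹, ?_⟩
  have h1 : k • x = ((u : R) : Ω) * algebraMap O Ω π ^ n := by
    simpa using congrArg Subtype.val hu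
  have h2 : algebraMap O Ω k = algebraMap O Ω w * algebraMap O Ω π ^ m := by
    rw [hw, map_mul, map_pow]
  have h3 : ((↑w'⁻¹ : integralClosure O Ω) : Ω) * algebraMap O Ω w = 1 := by
    have := congrArg (Subtype.val : integralClosure O Ω → Ω) w'.inv_mul
    exact this
  have hπ0 : algebraMap O Ω π ≠ 0 := algebraMap_ne_zero hπ
  have h4 : x = (algebraMap O Ω k)⁻¹ * (k • x) := by
    rw [Algebra.smul_def, inv_mul_cancel_left₀ hk']
  have h5 : algebraMap O Ω w ≠ 0 := right_ne_zero_of_mul_eq_one h3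
  have h6 : ((↑w'⁻¹ : integralClosure O Ω) : Ω) = (algebraMap O Ω w)⁻¹ := eq_inv_of_mul_eq_one_left h3
  rw [h4, h1, h2, Units.val_mul, MulMemClass.coe_mul, h6, zpow_sub₀ hπ0, zpow_natCast, zpow_natCast]
  change _ = _ * (((u : R) : Ω) * _)
  field_simp

theorem zpow_mul_unit_unique (hΩ : IsUnramifiedClosed O Ω p) (hπ : Irreducible π) {n m : ℤ}
    {u w : (integralClosure O Ω)ˣ}
    (h : algebraMap O Ω π ^ n * (u : integralClosure O Ω) = algebraMap O Ω π ^ m * (w : integralClosure O Ω)) :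
    n = m := by
  have key : ∀ (n m : ℤ) (u w : (integralClosure O Ω)ˣ), algebraMap O Ω π ^ n *
      (u : integralClosure O Ω) = algebraMap O Ω π ^ m * (w : integralClosure O Ω) → n ≤ m := by
    intro n m u w h
    by_contra! hlt
    obtain ⟨k, hk⟩ := Int.eq_ofNat_of_zero_le (sub_nonneg.2 (Int.add_one_le_of_lt hlt))
    have hπ0 : algebraMap O Ω π ≠ 0 := algebraMap_ne_zero hπ
    have h1 : algebraMap O (integralClosure O Ω) π * (algebraMap O (integralClosure O Ω) π ^ k * u) =
        w := by
      refine Subtype.ext ?_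
      change algebraMap O Ω π * (algebraMap O Ω π ^ k * (u : integralClosure O Ω)) = (w : integralClosure O Ω)
      refine mul_left_cancel₀ (zpow_ne_zero m hπ0) ?_
      rw [← h, ← mul_assoc, ← mul_assoc, ← zpow_natCast, ← zpow_add_one₀ hπ0, ← zpow_add₀ hπ0]
      congr 2
      lia
    exact hΩ.not_isUnit_algebraMap hπ (isUnit_of_dvd_unit (Dvd.intro _ h1) w.isUnit)
  exact le_antisymm (key _ _ _ _ h) (key _ _ _ _ h.symm)

/-- Separatedness makes homomorphisms out of an unramified algebra determined by their residues. It
holds because an element of valuation n is not divisible by π^(n+1). -/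
theorem iInf_pow_maximalIdeal (hΩ : IsUnramifiedClosed O Ω p) [IsLocalRing (integralClosure O Ω)] :
    ⨅ i : ℕ, maximalIdeal (integralClosure O Ω) ^ i = ⊥ := by
  obtain ⟨π, hπ⟩ := IsDiscreteValuationRing.exists_irreducible O
  rw [eq_bot_iff]
  intro x hx
  by_contra hx0
  have hx0' : (x : Ω) ≠ 0 := fun h => hx0 (Subtype.ext h)
  obtain ⟨n, u, hu⟩ := hΩ.exists_zpow_mul_unit hπ hx0'
  have hm : maximalIdeal (integralClosure O Ω) =
      Ideal.span {algebraMap O (integralClosure O Ω) π} := by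
    ext b
    rw [hΩ.mem_maximalIdeal_iff hπ, Ideal.mem_span_singleton]
  have h1 := (Submodule.mem_iInf _).1 hx (n.toNat + 1)
  rw [hm, Ideal.span_singleton_pow, Ideal.mem_span_singleton] at h1
  obtain ⟨y, hy⟩ := h1
  have hy0 : (y : Ω) ≠ 0 := by
    intro h
    rw [show y = 0 from Subtype.ext h, mul_zero] at hy
    exact hx0 hy
  have hpow : ∀ b : integralClosure O Ω, b ≠ 0 → ∃ (k : ℕ) (w : (integralClosure O Ω)ˣ),
      (b : Ω) = algebraMap O Ω π ^ (k : ℤ) * (w : integralClosure O Ω) := by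
    intro b hb
    obtain ⟨m, w, hw⟩ := hΩ.exists_zpow_mul_unit hπ (x := b) fun h => hb (Subtype.ext h)
    rcases le_or_gt 0 m with h | h
    · obtain ⟨k, rfl⟩ := Int.eq_ofNat_of_zero_le h
      exact ⟨k, w, hw⟩
    · exfalso
      obtain ⟨k, hk⟩ := Int.eq_ofNat_of_zero_le (a := -m - 1) (by lia)
      have hπ0 : algebraMap O Ω π ≠ 0 := algebraMap_ne_zero hπ
      refine hΩ.not_isUnit_algebraMap hπ (isUnit_of_dvd_unit
        (Dvd.intro (algebraMap O (integralClosure O Ω) π ^ k * b) ?_) w.isUnit)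
      refine Subtype.ext ?_
      change algebraMap O Ω π * (algebraMap O Ω π ^ k * (b : Ω)) = (w : integralClosure O Ω)
      rw [hw, ← mul_assoc, ← mul_assoc, ← zpow_natCast, ← zpow_one_add₀ hπ0, ← zpow_add₀ hπ0]
      rw [show 1 + (k : ℤ) + m = 0 by lia, zpow_zero, one_mul]
  obtain ⟨k, w, hw⟩ := hpow y fun h => hy0 (congrArg Subtype.val h)
  have h2 : (x : Ω) = algebraMap O Ω π ^ (n.toNat + 1 + k : ℤ) * (w : integralClosure O Ω) := by
    rw [hy]
    change algebraMap O Ω π ^ (n.toNat + 1) * (y : Ω) = _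
    rw [hw, ← mul_assoc, ← zpow_natCast, ← zpow_add₀ (algebraMap_ne_zero hπ)]
    push_cast
    rfl
  have := hΩ.zpow_mul_unit_unique hπ (hu.symm.trans h2)
  lia

theorem charP_residueField (hΩ : IsUnramifiedClosed O Ω p) (hp : p.Prime)
    (hpm : (p : O) ∈ maximalIdeal O) [IsLocalRing (integralClosure O Ω)] :
    CharP (ResidueField (integralClosure O Ω)) p := by
  obtain ⟨π, hπ⟩ := IsDiscreteValuationRing.exists_irreducible O
  rw [CharP.charP_iff_prime_eq_zero hp, ← map_natCast (residue (integralClosure O Ω)),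
    residue_eq_zero_iff, hΩ.mem_maximalIdeal_iff hπ,
    ← map_natCast (algebraMap O (integralClosure O Ω))]
  rw [(IsDiscreteValuationRing.irreducible_iff_uniformizer _).1 hπ, Ideal.mem_span_singleton] at hpm
  exact map_dvd _ hpm

theorem exists_pow_sub_eq (hΩ : IsUnramifiedClosed O Ω p) (hp : p.Prime)
    [IsLocalRing (integralClosure O Ω)] (a : ResidueField (integralClosure O Ω)) :
    ∃ x, x ^ p - x = a := by
  obtain ⟨b, rfl⟩ := residue_surjective a
  obtain ⟨θ, hθ⟩ := hΩ.exists_root b b.2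
  have hi : IsIntegral (integralClosure O Ω) θ := by
    refine ⟨Polynomial.X ^ p - (Polynomial.X + Polynomial.C b), ?_, ?_⟩
    · refine Polynomial.monic_X_pow_sub ?_
      rw [Polynomial.degree_X_add_C]
      exact_mod_cast hp.one_lt
    · rw [Polynomial.eval₂_sub, Polynomial.eval₂_add, Polynomial.eval₂_pow, Polynomial.eval₂_X,
        Polynomial.eval₂_C]
      change θ ^ p - (θ + (b : Ω)) = 0
      rw [← hθ]
      ring
  refine ⟨residue _ ⟨θ, isIntegral_trans (R := O) θ hi⟩, ?_⟩
  rw [← map_pow, ← map_sub]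
  exact congrArg _ (Subtype.ext hθ)

end IsUnramifiedClosed

/-- An element of the subfield generated by `S ∪ T` involves finitely many elements of `T`. -/
theorem Subfield.exists_finset_mem_closure {F : Type*} [Field F] (S T : Set F) {x : F}
    (hx : x ∈ Subfield.closure (S ∪ T)) :
    ∃ B : Finset F, (∀ b ∈ B, b ∈ T) ∧ x ∈ Subfield.closure (S ∪ B : Set F) := by
  classical
  have hmono : ∀ {B B' : Finset F}, B ⊆ B' →
      Subfield.closure (S ∪ B : Set F) ≤ Subfield.closure (S ∪ B' : Set F) := fun h =>
    Subfield.closure_mono (Set.union_subset_union_right _ (Finset.coe_subset.2 h))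
  induction hx using Subfield.closure_induction with
  | mem x hx =>
    rcases hx with hx | hx
    · exact ⟨∅, by simp, Subfield.subset_closure (.inl hx)⟩
    · exact ⟨{x}, by simpa using hx, Subfield.subset_closure (.inr (by simp))⟩
  | one => exact ⟨∅, by simp, one_mem _⟩
  | add x y _ _ hx hy =>
    obtain ⟨B, hB, hx⟩ := hx
    obtain ⟨B', hB', hy⟩ := hy
    exact ⟨B ∪ B', fun b hb => (Finset.mem_union.1 hb).elim (hB b) (hB' b),
      add_mem (hmono Finset.subset_union_left hx) (hmono Finset.subset_union_right hy)⟩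
  | neg x _ hx =>
    obtain ⟨B, hB, hx⟩ := hx
    exact ⟨B, hB, neg_mem hx⟩
  | inv x _ hx =>
    obtain ⟨B, hB, hx⟩ := hx
    exact ⟨B, hB, inv_mem hx⟩
  | mul x y _ _ hx hy =>
    obtain ⟨B, hB, hx⟩ := hx
    obtain ⟨B', hB', hy⟩ := hy
    exact ⟨B ∪ B', fun b hb => (Finset.mem_union.1 hb).elim (hB b) (hB' b),
      mul_mem (hmono Finset.subset_union_left hx) (hmono Finset.subset_union_right hy)⟩

/-- Transitivity of traces: an element whose sum of conjugates under `Γ ⧸ N'` is one yields such an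
element for every larger subgroup `N`. -/
theorem exists_sum_smul_eq_one_of_le {Γ B : Type*} [Group Γ] [CommRing B] [MulSemiringAction Γ B]
    {N' N : Subgroup Γ} (hle : N' ≤ N) [Fintype (Γ ⧸ N')] [Fintype (Γ ⧸ N)] {t : B}
    (ht : ∀ n ∈ N', n • t = t) (h1 : ∑ q : Γ ⧸ N', q.out • t = 1) :
    ∃ t' : B, (∀ n ∈ N, n • t' = t') ∧ ∑ q : Γ ⧸ N, q.out • t' = 1 := by
  classical
  let F : Γ ⧸ N' → B := fun q => q.out • t
  have hF : ∀ (g : Γ) q, g • F q = F (g • q) := by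
    intro g q
    obtain ⟨n, hn⟩ := QuotientGroup.mk_out_eq_mul N' (g * q.out)
    have h : g • q = ((g * q.out : Γ) : Γ ⧸ N') := by
      conv_lhs => rw [← QuotientGroup.out_eq' q]
      rfl
    change g • q.out • t = (g • q).out • t
    rw [h, hn, mul_smul, ht _ n.2, mul_smul]
  let f : Γ ⧸ N' → Γ ⧸ N := Subgroup.quotientMapOfLE hle
  have hf : ∀ (g : Γ) q, f (g • q) = g • f q := by
    intro g q
    induction q using QuotientGroup.induction_on with | H q => rfl
  have hfib : ∀ (g : Γ) q₀, g • ∑ q with f q = q₀, F q = ∑ q with f q = g • q₀, F q := by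
    intro g q₀
    rw [Finset.smul_sum]
    refine Finset.sum_equiv (MulAction.toPerm g) (fun q => ?_) fun q _ => hF g q
    simp [hf]
  -- The relative trace of t from `N'` to `N`: the sum over the fibre of Γ/N' → Γ/N above the
  -- identity coset. Its conjugates are the sums over the other fibres.
  refine ⟨∑ q with f q = (1 : Γ), F q, fun n hn => ?_, ?_⟩
  · rw [hfib]
    have : n • ((1 : Γ) : Γ ⧸ N) = (1 : Γ) := by
      change ((n * 1 : Γ) : Γ ⧸ N) = _
      rw [QuotientGroup.eq]
      simpa using hn
    rw [this]
  · rw [← h1, ← Finset.sum_fiberwise Finset.univ f F]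
    refine Finset.sum_congr rfl fun q _ => ?_
    rw [hfib]
    have : q.out • ((1 : Γ) : Γ ⧸ N) = q := by
      change ((q.out * 1 : Γ) : Γ ⧸ N) = _
      rw [mul_one, QuotientGroup.out_eq']
    rw [this]

instance locallyConstantSMul_integralClosure {O K Ω : Type*} [CommRing O] [Field K] [Algebra O K]
    [Field Ω] [Algebra K Ω] [Algebra O Ω] [IsScalarTower O K Ω] [IsGalois K Ω] :
    LocallyConstantSMul (Ω ≃ₐ[K] Ω) (integralClosure O Ω) where
  isLocallyConstant_smul x := by
    have h := LocallyConstantSMul.isLocallyConstant_smul (Γ := Ω ≃ₐ[K] Ω) (x : Ω)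
    rw [IsLocallyConstant.iff_eventually_eq] at h ⊢
    exact fun g => (h g).mono fun g' hg' => Subtype.ext hg'

instance locallyConstantSMul_residueField {Γ B : Type*} [Group Γ] [TopologicalSpace Γ] [CommRing B]
    [IsLocalRing B] [MulSemiringAction Γ B] [LocallyConstantSMul Γ B] :
    LocallyConstantSMul Γ (IsLocalRing.ResidueField B) where
  isLocallyConstant_smul x := by
    obtain ⟨b, rfl⟩ := IsLocalRing.residue_surjective x
    exact (LocallyConstantSMul.isLocallyConstant_smul (Γ := Γ) b).comp (IsLocalRing.residue B)

/-! ### Integers of trace one, and generation of the residue field by invariants and p-th powers. -/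

namespace IsUnramifiedClosed

open IsLocalRing

variable {O K Ω : Type*} [CommRing O] [Field K] [Algebra O K] [Field Ω] [Algebra K Ω]
  [Algebra O Ω] [IsScalarTower O K Ω] [IsDomain O] [IsFractionRing O K]
  [IsDiscreteValuationRing O] [IsAdicComplete (maximalIdeal O) O] [FaithfulSMul O Ω]
  {p : ℕ} {π : O} [IsGalois K Ω]

theorem exists_le_fractionSubfield (hΩ : IsUnramifiedClosed O Ω p) (L : IntermediateField K Ω)
    [FiniteDimensional K L] :
    ∃ R : Subalgebra O Ω, R.IsUnramified ∧ L ≤ R.fractionSubfield K := by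
  classical
  have h : ∀ s : Finset Ω, ∃ R : Subalgebra O Ω, R.IsUnramified ∧
      ∀ x ∈ s, x ∈ R.fractionSubfield K := by
    intro s
    induction s using Finset.induction_on with
    | empty => exact ⟨⊥, .bot, by simp⟩
    | insert x s _ ih =>
      obtain ⟨R, hR, hs⟩ := ih
      obtain ⟨R', hR', hx⟩ := hΩ.exists_smul_mem x
      refine ⟨R ⊔ R', hR.sup hR', fun y hy => ?_⟩
      rcases Finset.mem_insert.1 hy with rfl | hy
      · exact Subalgebra.fractionSubfield_mono le_sup_right hx
      · exact Subalgebra.fractionSubfield_mono le_sup_left (hs y hy)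
  obtain ⟨s, hs⟩ := (IntermediateField.essFiniteType_iff.1 inferInstance : L.FG)
  obtain ⟨R, hR, h⟩ := h s
  refine ⟨R, hR, ?_⟩
  rw [← hs, IntermediateField.adjoin_le_iff]
  exact h

/-- The restriction of an automorphism to an unramified subalgebra, with values in the ring of
integers. -/
noncomputable def conj {R : Subalgebra O Ω} (hR : R.IsUnramified) (g : Ω ≃ₐ[K] Ω) :
    R →ₐ[O] integralClosure O Ω :=
  ((g.restrictScalars O : Ω →ₐ[O] Ω).comp R.val).codRestrict _ fun x =>
    (hR.le_integralClosure x.2 : IsIntegral O (x : Ω)).map (g.restrictScalars O)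

/-- The elements of trace one in the ring of integers of an unramified extension. -/
theorem exists_sum_smul_eq_one (hΩ : IsUnramifiedClosed O Ω p) (N : Subgroup (Ω ≃ₐ[K] Ω))
    (hN : IsOpen (N : Set (Ω ≃ₐ[K] Ω))) [Fintype ((Ω ≃ₐ[K] Ω) ⧸ N)] :
    ∃ t : integralClosure O Ω, (∀ n ∈ N, n • t = t) ∧
      ∑ q : (Ω ≃ₐ[K] Ω) ⧸ N, q.out • t = 1 := by
  have := hΩ.isLocalRing_integralClosure
  let L := IntermediateField.fixedField N
  have hLN : L.fixingSubgroup = N := InfiniteGalois.fixingSubgroup_fixedField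
    (⟨N, N.isClosed_of_isOpen hN⟩ : ClosedSubgroup (Ω ≃ₐ[K] Ω))
  have hL : FiniteDimensional K L := by
    refine (InfiniteGalois.isOpen_iff_finite L).1 ?_
    change IsOpen (L.fixingSubgroup : Set (Ω ≃ₐ[K] Ω))
    rwa [hLN]
  obtain ⟨R, hR, hLR⟩ := hΩ.exists_le_fractionSubfield L
  have := hR.finite
  have := hR.formallyUnramified
  have := R.finiteDimensional_fractionSubfield (K := K)
  let N' := (R.fractionSubfield K).fixingSubgroup
  have hN' : IsOpen (N' : Set (Ω ≃ₐ[K] Ω)) := IntermediateField.fixingSubgroup_isOpen _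
  have hle : N' ≤ N := by
    rw [← hLN]
    exact IntermediateField.fixingSubgroup_le hLR
  have := finite_quotient_of_isOpen N' hN'
  have := Fintype.ofFinite ((Ω ≃ₐ[K] Ω) ⧸ N')
  -- The conjugate embeddings of `R` stay distinct modulo the maximal ideal, by unramifiedness.
  -- Dedekind's independence then gives an a in `R` whose trace is a unit; dividing by this
  -- invariant unit yields trace one.
  let φ : (Ω ≃ₐ[K] Ω) ⧸ N' → (R →* ResidueField (integralClosure O Ω)) := fun q =>
    ((residue _).comp (conj hR q.out).toRingHom : R →+* ResidueField (integralClosure O Ω))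
  have hφ : Function.Injective φ := by
    intro q q' h
    have h1 : conj hR q.out = conj hR q'.out :=
      Algebra.FormallyUnramified.ext_of_iInf (maximalIdeal (integralClosure O Ω))
        hΩ.iInf_pow_maximalIdeal fun x => DFunLike.congr_fun h x
    have h2 : ∀ x ∈ R, q.out x = q'.out x := fun x hx => by
      have h := DFunLike.congr_fun h1 (⟨x, hx⟩ : R)
      exact congrArg (Subtype.val : integralClosure O Ω → Ω) h
    rw [← q.out_eq', ← q'.out_eq']
    refine QuotientGroup.eq.2 ?_
    refine (IntermediateField.mem_fixingSubgroup_iff _ _).2 fun x hx => ?_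
    obtain ⟨k, hk, hkx⟩ := hx
    have hk0 : algebraMap O Ω k ≠ 0 := by
      rwa [ne_eq, map_eq_zero_iff _ (FaithfulSMul.algebraMap_injective O Ω)]
    have h3 : q.out x = q'.out x := by
      refine mul_left_cancel₀ hk0 ?_
      have h4 : ∀ g : Ω ≃ₐ[K] Ω, algebraMap O Ω k * g x = g (k • x) := fun g => by
        rw [Algebra.smul_def, map_mul, IsScalarTower.algebraMap_apply O K Ω, g.commutes]
      rw [h4, h4, h2 _ hkx]
    change (q.out⁻¹ * q'.out) x = x
    rw [AlgEquiv.mul_apply, ← h3, ← AlgEquiv.mul_apply, inv_mul_cancel, AlgEquiv.one_apply]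
  obtain ⟨a, ha⟩ : ∃ a : R, ∑ q, φ q a ≠ 0 := by
    by_contra! h
    have hli := (linearIndependent_monoidHom R (ResidueField (integralClosure O Ω))).comp φ hφ
    rw [Fintype.linearIndependent_iff] at hli
    refine one_ne_zero (α := ResidueField (integralClosure O Ω))
      (hli (fun _ => 1) (funext fun a => ?_) ((1 : Ω ≃ₐ[K] Ω) : (Ω ≃ₐ[K] Ω) ⧸ N'))
    simpa using h a
  let b : integralClosure O Ω := Subalgebra.inclusion hR.le_integralClosure a
  have hbfix : ∀ n ∈ N', n • b = b := fun n hn => Subtype.ext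
    ((IntermediateField.mem_fixingSubgroup_iff _ _).1 hn _ (Subalgebra.le_fractionSubfield a.2))
  have hu : IsUnit (∑ q : (Ω ≃ₐ[K] Ω) ⧸ N', q.out • b) := by
    rw [← residue_ne_zero_iff_isUnit, map_sum]
    exact ha
  obtain ⟨c, hc⟩ := hu
  have hcfix : ∀ g : Ω ≃ₐ[K] Ω, g • (c : integralClosure O Ω) = c := by
    intro g
    rw [hc, Finset.smul_sum]
    simp_rw [smul_smul]
    exact sum_out_mul_left N' (fun g => g • b) (fun g n hn => by
      rw [mul_smul, hbfix n hn]) g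
  have hcfix' : ∀ g : Ω ≃ₐ[K] Ω, g • (↑c⁻¹ : integralClosure O Ω) = ↑c⁻¹ := by
    intro g
    have h1 : (c : integralClosure O Ω) * g • (↑c⁻¹ : integralClosure O Ω) = 1 := by
      conv_lhs => rw [← hcfix g]
      rw [← smul_mul', c.mul_inv, smul_one]
    rw [← c.inv_mul_cancel_left (g • (↑c⁻¹ : integralClosure O Ω)), h1, mul_one]
  refine exists_sum_smul_eq_one_of_le hle (t := ↑c⁻¹ * b) (fun n hn => ?_) ?_
  · rw [smul_mul', hcfix', hbfix n hn]
  · simp_rw [smul_mul', hcfix']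
    rw [← Finset.mul_sum, ← hc, c.inv_mul]

theorem hasTraceOne_residueField (hΩ : IsUnramifiedClosed O Ω p)
    [IsLocalRing (integralClosure O Ω)] :
    HasTraceOne (Ω ≃ₐ[K] Ω) (⊤ : Subfield (ResidueField (integralClosure O Ω))) := by
  intro N hN
  have := finite_quotient_of_isOpen N hN
  have := Fintype.ofFinite ((Ω ≃ₐ[K] Ω) ⧸ N)
  obtain ⟨t, ht, h1⟩ := hΩ.exists_sum_smul_eq_one N hN
  refine ⟨residue _ t, trivial, fun n hn => ?_, ?_⟩
  · rw [← ResidueField.residue_smul, ht n hn]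
  · rw [finsum_eq_sum_of_fintype, ← map_one (residue _), ← h1, map_sum]
    exact Finset.sum_congr rfl fun q _ => (ResidueField.residue_smul _ _ _).symm

/-- Fixed elements of the residue field lift to fixed integers. -/
theorem exists_residue_eq_of_fixed (hΩ : IsUnramifiedClosed O Ω p)
    [IsLocalRing (integralClosure O Ω)] {c : ResidueField (integralClosure O Ω)}
    (hc : ∀ s : Ω ≃ₐ[K] Ω, s • c = c) :
    ∃ b : integralClosure O Ω, (∀ s : Ω ≃ₐ[K] Ω, s • b = b) ∧ residue _ b = c := by
  obtain ⟨b, rfl⟩ := residue_surjective c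
  obtain ⟨N, hN, hb⟩ := IsLocallyConstant.exists_open_subgroup (Y := Unit)
    (f := fun z : Unit × (Ω ≃ₐ[K] Ω) => z.2 • b)
    ((LocallyConstantSMul.isLocallyConstant_smul b).comp_continuous continuous_snd)
  replace hb : ∀ n ∈ N, n • b = b := fun n hn => by simpa using hb () 1 n hn
  have := finite_quotient_of_isOpen N hN
  have := Fintype.ofFinite ((Ω ≃ₐ[K] Ω) ⧸ N)
  obtain ⟨t, ht, h1⟩ := hΩ.exists_sum_smul_eq_one N hN
  -- The trace of t b is invariant, and since every conjugate of b has the same residue, its residue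
  -- is that of b times the trace of t, which is one.
  refine ⟨∑ q : (Ω ≃ₐ[K] Ω) ⧸ N, q.out • (t * b), fun s => ?_, ?_⟩
  · rw [Finset.smul_sum]
    simp_rw [smul_smul]
    exact sum_out_mul_left N (fun g => g • (t * b)) (fun g n hn => by
      rw [mul_smul, smul_mul', ht n hn, hb n hn]) s
  · have h2 : ∀ q : (Ω ≃ₐ[K] Ω) ⧸ N, residue _ (q.out • (t * b)) =
        residue _ (q.out • t) * residue _ b := fun q => by
      rw [smul_mul', map_mul, ResidueField.residue_smul _ _ b, hc]
    rw [map_sum, Finset.sum_congr rfl fun q _ => h2 q, ← Finset.sum_mul, ← map_sum, h1, map_one,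
      one_mul]

/-- The residue field of an unramified subalgebra is separable over the residue field k of `O`, so y
∈ k(y^p) for every y in it. Elements of k are invariant, so they can serve as generators over the
p-th powers. -/
theorem exists_finset_mem_closure (hΩ : IsUnramifiedClosed O Ω p) (hp : p.Prime)
    [CharP (ResidueField O) p] [IsLocalRing (integralClosure O Ω)]
    [CharP (ResidueField (integralClosure O Ω)) p] [ExpChar (ResidueField (integralClosure O Ω)) p]
    (x : ResidueField (integralClosure O Ω)) :
    ∃ B : Finset (ResidueField (integralClosure O Ω)),
      (∀ b ∈ B, ∀ s : Ω ≃ₐ[K] Ω, s • b = b) ∧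
      x ∈ Subfield.closure (Set.range (frobenius (ResidueField (integralClosure O Ω)) p) ∪ B :
        Set (ResidueField (integralClosure O Ω))) := by
  obtain ⟨π, hπ⟩ := IsDiscreteValuationRing.exists_irreducible O
  obtain ⟨b, rfl⟩ := residue_surjective x
  obtain ⟨R, hR, hbR⟩ := hΩ.exists_mem b.2
  have := hR.isDiscreteValuationRing
  have := hR.finite
  have := hR.formallyUnramified
  have hlocal : IsLocalHom (algebraMap O R) := by
    exact ((local_hom_TFAE (algebraMap O R)).out 0 2).2 (le_maximalIdeal map_maximalIdeal_ne_top)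
  let i : R →ₐ[O] integralClosure O Ω := Subalgebra.inclusion hR.le_integralClosure
  have hlocal' : IsLocalHom i.toRingHom := by
    constructor
    intro a ha
    by_contra ha'
    have h1 : a ∈ maximalIdeal R := ha'
    rw [(IsDiscreteValuationRing.irreducible_iff_uniformizer _).1 (hR.irreducible hπ),
      Ideal.mem_span_singleton] at h1
    refine hΩ.not_isUnit_algebraMap hπ (isUnit_of_dvd_unit ?_ ha)
    rw [← i.commutes]
    exact map_dvd i h1
  let f := ResidueField.map i.toRingHom
  have hexp : ExpChar (ResidueField O) p := .prime hp
  let y : ResidueField R := residue R ⟨b, hbR⟩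
  have hy : y ∈ IntermediateField.adjoin (ResidueField O) {y ^ p} := by
    have := IntermediateField.adjoin_eq_adjoin_pow_expChar_of_isSeparable' (ResidueField O)
      (ResidueField R) {y} p
    rw [Set.image_singleton] at this
    rw [← this]
    exact IntermediateField.mem_adjoin_simple_self _ _
  have h1 : y ∈ Subfield.closure (Set.range (algebraMap (ResidueField O) (ResidueField R)) ∪
    {y ^ p}) := hy
  have h2 := Subfield.exists_finset_mem_closure
    (Set.range (frobenius (ResidueField (integralClosure O Ω)) p))
    (Set.range (f.comp (algebraMap (ResidueField O) (ResidueField R)))) (x := f y) (by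
      have h3 : f y ∈ (Subfield.closure (Set.range (algebraMap (ResidueField O) (ResidueField R)) ∪
        {y ^ p})).map f := ⟨y, h1, rfl⟩
      rw [RingHom.map_field_closure] at h3
      refine Subfield.closure_mono ?_ h3
      rintro _ ⟨z, ⟨w, rfl⟩ | rfl, rfl⟩
      · exact .inr ⟨w, rfl⟩
      · exact .inl ⟨f y, by rw [frobenius_def, map_pow]⟩)
  obtain ⟨B, hB, hx⟩ := h2
  refine ⟨B, fun b hb s => ?_, hx⟩
  obtain ⟨w, rfl⟩ := hB b hb
  obtain ⟨o, rfl⟩ := residue_surjective w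
  have h4 : f.comp (algebraMap (ResidueField O) (ResidueField R)) (residue O o) =
      residue _ (algebraMap O (integralClosure O Ω) o) := rfl
  rw [h4, ← ResidueField.residue_smul]
  congr 1
  refine Subtype.ext ?_
  change s (algebraMap O Ω o) = algebraMap O Ω o
  rw [IsScalarTower.algebraMap_apply O K Ω, s.commutes]

end IsUnramifiedClosed

/-! ### Successive approximation for cocycles of principal units. -/

section AdicCocycles

variable {R : Type*} [CommRing R] {π : R}

theorem isUnit_of_dvd_sub_one [IsAdicComplete (Ideal.span {π}) R] {a : R} (ha : π ∣ a - 1) :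
    IsUnit a := by
  have h := Ideal.mem_jacobson_bot.1 (IsAdicComplete.le_jacobson_bot (Ideal.span {π})
    (Ideal.mem_span_singleton.2 ha)) 1
  rwa [mul_one, sub_add_cancel] at h

variable {G : Type*} [Group G] [Fintype G] [MulSemiringAction G R] [IsDomain R]

/-- A multiplicative two-cocycle which is trivial modulo `π ^ (k + 1)` becomes trivial modulo
`π ^ (k + 2)` after division by a coboundary, in the presence of an element of trace one. -/
theorem exists_refine_two_cocycle (hπ : ∀ g : G, g • π = π) (hπ0 : π ≠ 0) {t : R}
    (ht : ∑ g : G, g • t = 1) {γ c : G → G → R} {k : ℕ}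
    (hc : ∀ s r, γ s r = 1 + π ^ (k + 1) * c s r)
    (hγ : ∀ s r q, s • γ r q * γ s (r * q) = γ (s * r) q * γ s r) :
    ∃ m : G → R, ∀ s r, π ^ (k + 2) ∣ γ s r * (1 + π ^ (k + 1) * m (s * r)) -
      (1 + π ^ (k + 1) * m s) * s • (1 + π ^ (k + 1) * m r) := by
  have hπn : ∀ (g : G) (k : ℕ), g • π ^ k = π ^ k := fun g k => by rw [smul_pow', hπ]
  have hadd : ∀ s r q, π ∣ c s (r * q) + s • c r q - c (s * r) q - c s r := by
    intro s r q
    have h := hγ s r q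
    simp only [hc, smul_add, smul_one, smul_mul', hπn] at h
    refine ⟨π ^ k * (c (s * r) q * c s r - s • c r q * c s (r * q)), ?_⟩
    refine mul_left_cancel₀ (pow_ne_zero (k + 1) hπ0) ?_
    linear_combination h
  let m : G → R := fun s => ∑ g, c s g * (s * g) • t
  have hm : ∀ s r, π ∣ m s + s • m r - m (s * r) - c s r := by
    intro s r
    have h1 : m s = ∑ g, c s (r * g) * (s * r * g) • t := by
      change ∑ g, c s g * (s * g) • t = _
      rw [← Equiv.sum_comp (Equiv.mulLeft r)]
      simp only [Equiv.coe_mulLeft, mul_assoc]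
    have h2 : s • m r = ∑ g, s • c r g * (s * r * g) • t := by
      rw [Finset.smul_sum]
      exact Finset.sum_congr rfl fun g _ => by rw [smul_mul', smul_smul, mul_assoc]
    have h3 : c s r = ∑ g, c s r * (s * r * g) • t := by
      rw [← Finset.mul_sum]
      have := Equiv.sum_comp (Equiv.mulLeft (s * r)) fun g => g • t
      simp only [Equiv.coe_mulLeft] at this
      rw [this, ht, mul_one]
    rw [h1, h2, h3]
    change _ ∣ _ + _ - ∑ g, c (s * r) g * (s * r * g) • t - _
    rw [← Finset.sum_add_distrib, ← Finset.sum_sub_distrib, ← Finset.sum_sub_distrib]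
    refine Finset.dvd_sum fun g _ => ?_
    rw [← add_mul, ← sub_mul, ← sub_mul]
    exact Dvd.dvd.mul_right (hadd s r g) _
  refine ⟨m, fun s r => ?_⟩
  obtain ⟨d, hd⟩ := hm s r
  rw [hc]
  simp only [smul_add, smul_one, smul_mul', hπn]
  exact ⟨π ^ k * (c s r * m (s * r) - m s * s • m r) - d, by linear_combination (-π ^ (k + 1)) * hd⟩

/-- Multiplicative two-cocycles congruent to one are coboundaries, over a complete ring with an
element of trace one. -/
theorem exists_coboundary_of_two_cocycle_dvd_sub_one [IsAdicComplete (Ideal.span {π}) R]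
    (hπ : ∀ g : G, g • π = π) (hπ0 : π ≠ 0) {t : R} (ht : ∑ g : G, g • t = 1) {β : G → G → R}
    (hβ1 : ∀ s r, π ∣ β s r - 1)
    (hβ : ∀ s r q, s • β r q * β s (r * q) = β (s * r) q * β s r) :
    ∃ h : G → R, (∀ s, π ∣ h s - 1) ∧ ∀ s r, β s r * h (s * r) = h s * s • h r := by
  have hdvd : ∀ (g : G) {k : ℕ} {a : R}, π ^ k ∣ a → π ^ k ∣ g • a := by
    rintro g k _ ⟨a, rfl⟩
    exact ⟨g • a, by rw [smul_mul', smul_pow', hπ]⟩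
  -- `P n h` says that h trivialises β modulo π^(n+1). Each step multiplies h by factors 1 + π^(n+1)
  -- m(s), so the successive cochains converge, and separatedness gives equality in the limit.
  let P : ℕ → (G → R) → Prop := fun n h => (∀ s, π ∣ h s - 1) ∧
    ∀ s r, π ^ (n + 1) ∣ β s r * h (s * r) - h s * s • h r
  have hstep : ∀ (n : ℕ) (h : {h // P n h}), ∃ h' : {h // P (n + 1) h},
      ∀ s, π ^ (n + 1) ∣ h'.1 s - h.1 s := by
    rintro n ⟨h, h1, h2⟩
    have hu : ∀ s, IsUnit (h s) := fun s => isUnit_of_dvd_sub_one (h1 s)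
    have hu' : ∀ g s, IsUnit (g • h s) := fun g s => (hu s).map (MulSemiringAction.toRingHom G R g)
    have hex : ∀ s r, ∃ c, β s r * h (s * r) = h s * s • h r * (1 + π ^ (n + 1) * c) := by
      intro s r
      obtain ⟨d, hd⟩ := h2 s r
      obtain ⟨e, he⟩ := ((hu s).mul (hu' s r)).exists_right_inv
      exact ⟨d * e, by linear_combination hd - π ^ (n + 1) * d * he⟩
    choose c hc using hex
    obtain ⟨m, hm⟩ := exists_refine_two_cocycle hπ hπ0 ht (k := n)
      (γ := fun s r => 1 + π ^ (n + 1) * c s r) (c := c) (fun _ _ => rfl) (by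
        intro s r q
        have e1 := congrArg (s • ·) (hc r q)
        simp only [smul_mul', smul_smul] at e1
        have e2 := hc s (r * q)
        have e3 := hc (s * r) q
        have e4 := hc s r
        rw [← mul_assoc s r q] at e2
        have e5 := hβ s r q
        generalize s • (1 + π ^ (n + 1) * c r q) = a1 at *
        generalize 1 + π ^ (n + 1) * c s (r * q) = a2 at *
        generalize 1 + π ^ (n + 1) * c (s * r) q = a3 at *
        generalize 1 + π ^ (n + 1) * c s r = a4 at *
        -- The remaining cocycle 1 + π^(n+1) c is β divided by ∂h; its cocycle identity follows from
        -- that of β after multiplication by these units.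
        have hne : s • h (r * q) * h (s * r) * h s * s • h r * (s * r) • h q ≠ 0 :=
          ((((hu' s _).mul (hu _)).mul (hu _)).mul (hu' _ _) |>.mul (hu' _ _)).ne_zero
        refine mul_left_cancel₀ hne ?_
        linear_combination (-h (s * r) * β s (r * q) * h (s * r * q)) * e1
          - (h (s * r) * s • h r * (s * r) • h q * a1) * e2
          + (s • h (r * q) * β s r * h (s * r)) * e3
          + (s • h (r * q) * h (s * r) * (s * r) • h q * a3) * e4
          + (h (s * r) * s • h (r * q) * h (s * r * q)) * e5)
    refine ⟨⟨fun s => h s * (1 + π ^ (n + 1) * m s), fun s => ?_, fun s r => ?_⟩, fun s => ?_⟩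
    · obtain ⟨d, hd⟩ := h1 s
      exact ⟨d + h s * π ^ n * m s, by linear_combination hd⟩
    · obtain ⟨d, hd⟩ := hm s r
      refine ⟨h s * s • h r * d, ?_⟩
      rw [smul_mul']
      linear_combination (1 + π ^ (n + 1) * m (s * r)) * hc s r + (h s * s • h r) * hd
    · exact ⟨h s * m s, by ring⟩
  have h0 : P 0 fun _ => 1 := ⟨fun s => by simp, fun s r => by simpa using hβ1 s r⟩
  choose next hnext using hstep
  let seq : ∀ n, {h // P n h} := fun n => Nat.rec ⟨fun _ => 1, h0⟩ (fun n h => next n h) n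
  have hseq : ∀ n s, π ^ (n + 1) ∣ (seq (n + 1)).1 s - (seq n).1 s := fun n s => hnext n (seq n) s
  have hcauchy : ∀ s {m n}, m ≤ n → π ^ m ∣ (seq m).1 s - (seq n).1 s := by
    intro s m n hmn
    induction n, hmn using Nat.le_induction with
    | base => simp
    | succ n hmn ih =>
      have := dvd_sub ih ((pow_dvd_pow π (hmn.trans n.le_succ)).trans (hseq n s))
      convert this using 1
      ring
  have hlim : ∀ s, ∃ L, ∀ n, π ^ n ∣ (seq n).1 s - L := by
    intro s
    obtain ⟨L, hL⟩ := IsPrecomplete.prec (I := Ideal.span {π}) (M := R) inferInstance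
      (f := fun n => (seq n).1 s) (fun {m n} hmn => by
        rw [SModEq.sub_mem, smul_eq_mul, Ideal.mul_top, Ideal.span_singleton_pow,
          Ideal.mem_span_singleton]
        exact hcauchy s hmn)
    refine ⟨L, fun n => ?_⟩
    have := hL n
    rwa [SModEq.sub_mem, smul_eq_mul, Ideal.mul_top, Ideal.span_singleton_pow,
          Ideal.mem_span_singleton] at this
  choose h hh using hlim
  refine ⟨h, fun s => ?_, fun s r => ?_⟩
  · have := dvd_sub ((seq 1).2.1 s) (by simpa using hh s 1)
    simpa using this
  · rw [← sub_eq_zero]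
    refine IsHausdorff.haus (I := Ideal.span {π}) (M := R) inferInstance _ fun n => ?_
    rw [SModEq.zero, smul_eq_mul, Ideal.mul_top, Ideal.span_singleton_pow,
          Ideal.mem_span_singleton]
    obtain ⟨a, ha⟩ := (pow_dvd_pow π n.le_succ).trans ((seq n).2.2 s r)
    obtain ⟨b, hb⟩ := hh (s * r) n
    obtain ⟨d, hd⟩ := hh s n
    obtain ⟨e, he⟩ := hdvd s (hh r n)
    rw [smul_sub] at he
    refine ⟨a - β s r * b + d * s • (seq n).1 r + h s * e, ?_⟩
    linear_combination ha - β s r * hb + s • (seq n).1 r * hd + h s * he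

end AdicCocycles

theorem IsLocallyConstant.of_mul_right {Γ X : Type*} [Group Γ] [TopologicalSpace Γ]
    [ContinuousMul Γ] {N : Subgroup Γ} (hN : IsOpen (N : Set Γ)) {f : Γ → X}
    (hf : ∀ g, ∀ n ∈ N, f (g * n) = f g) : IsLocallyConstant f := by
  rw [IsLocallyConstant.iff_exists_open]
  intro g
  refine ⟨(fun h => g⁻¹ * h) ⁻¹' (N : Set Γ), hN.preimage (continuous_const_mul g⁻¹), ?_,
    fun h hh => ?_⟩
  · simp [N.one_mem]
  · rw [← hf g _ hh, mul_inv_cancel_left]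

/-! ### Passage to a complete finite level. -/

namespace IsUnramifiedClosed

open IsLocalRing

variable {O K Ω : Type*} [CommRing O] [Field K] [Algebra O K] [Field Ω] [Algebra K Ω]
  [Algebra O Ω] [IsScalarTower O K Ω] [IsDomain O] [IsFractionRing O K]
  [IsDiscreteValuationRing O] [IsAdicComplete (maximalIdeal O) O] [FaithfulSMul O Ω]
  {p : ℕ} {π : O} [IsGalois K Ω] [CharZero K]

/-- The trace-one integer attached to the fixing subgroup of `L` is fixed by it, hence lies in `L`;
coset representatives restrict bijectively to Gal(L/K). -/
theorem exists_sum_smul_eq_one_of_finite (hΩ : IsUnramifiedClosed O Ω p) (L : IntermediateField K Ω)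
    [FiniteDimensional K L] [Normal K L] :
    ∃ t : integralClosure O L, ∑ g : L ≃ₐ[K] L, g • t = 1 := by
  have hN : IsOpen (L.fixingSubgroup : Set (Ω ≃ₐ[K] Ω)) := L.fixingSubgroup_isOpen
  have := finite_quotient_of_isOpen _ hN
  have := Fintype.ofFinite ((Ω ≃ₐ[K] Ω) ⧸ L.fixingSubgroup)
  obtain ⟨t, ht, h1⟩ := hΩ.exists_sum_smul_eq_one L.fixingSubgroup hN
  have htL : (t : Ω) ∈ L := by
    rw [← InfiniteGalois.fixedField_fixingSubgroup L]
    exact fun n => congrArg Subtype.val (ht n n.2)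
  let t₀ : integralClosure O L := ⟨⟨t, htL⟩,
    (isIntegral_algHom_iff (L.val.restrictScalars O) L.val.toRingHom.injective).1 t.2⟩
  let e : (Ω ≃ₐ[K] Ω) ⧸ L.fixingSubgroup → (L ≃ₐ[K] L) := fun q => q.out.restrictNormal L
  have he : Function.Bijective e := by
    constructor
    · intro q q' h
      rw [← q.out_eq', ← q'.out_eq']
      refine QuotientGroup.eq.2 ((IntermediateField.mem_fixingSubgroup_iff _ _).2 fun x hx => ?_)
      have h3 : q.out x = q'.out x := by
        have := congrArg Subtype.val (DFunLike.congr_fun h ⟨x, hx⟩)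
        simpa [e, AlgEquiv.restrictNormal_apply] using this
      change (q.out⁻¹ * q'.out) x = x
      rw [AlgEquiv.mul_apply, ← h3, ← AlgEquiv.mul_apply, inv_mul_cancel, AlgEquiv.one_apply]
    · intro g
      obtain ⟨s, rfl⟩ := AlgEquiv.restrictNormalHom_surjective (F := K) (K₁ := L) Ω g
      refine ⟨s, AlgEquiv.ext fun x => Subtype.ext ?_⟩
      obtain ⟨n, hn⟩ := QuotientGroup.mk_out_eq_mul L.fixingSubgroup s
      change ((((s : (Ω ≃ₐ[K] Ω) ⧸ L.fixingSubgroup).out.restrictNormal L) x : L) : Ω) =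
        ((s.restrictNormal L x : L) : Ω)
      rw [AlgEquiv.restrictNormal_apply, AlgEquiv.restrictNormal_apply, hn, AlgEquiv.mul_apply,
        (IntermediateField.mem_fixingSubgroup_iff _ _).1 n.2 x x.2]
  refine ⟨t₀, ?_⟩
  rw [← Equiv.sum_comp (Equiv.ofBijective e he)]
  refine Subtype.ext (Subtype.ext ?_)
  have h2 := congrArg (Subtype.val : integralClosure O Ω → Ω) h1
  rw [AddSubmonoidClass.coe_finsetSum] at h2 ⊢
  rw [AddSubmonoidClass.coe_finsetSum]
  refine Eq.trans (Finset.sum_congr rfl fun q _ => ?_) h2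
  exact AlgEquiv.restrictNormal_apply L q.out _

theorem isAdicComplete_integralClosure (L : IntermediateField K Ω) [FiniteDimensional K L]
    (hπ : Irreducible π) :
    IsAdicComplete (Ideal.span {algebraMap O (integralClosure O L) π}) (integralClosure O L) := by
  have : FaithfulSMul O L := faithfulSMul_of_isFractionRing (K := K)
  have := L.finite_integralClosure (O := O)
  have h := isAdicComplete_map_maximalIdeal (O := O) (S := integralClosure O L)
  rwa [(IsDiscreteValuationRing.irreducible_iff_uniformizer _).1 hπ, Ideal.map_span,
    Set.image_singleton] at h

theorem exists_finite_normal_le {N : Subgroup (Ω ≃ₐ[K] Ω)} (hN : IsOpen (N : Set (Ω ≃ₐ[K] Ω))) :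
    ∃ L : IntermediateField K Ω, FiniteDimensional K L ∧ Normal K L ∧ L.fixingSubgroup ≤ N :=
  (krullTopology_mem_nhds_one_iff_of_normal K Ω _).1 (hN.mem_nhds N.one_mem)

/-- Two-cocycles of principal units are coboundaries. -/
theorem exists_coboundary_of_principal_units (hΩ : IsUnramifiedClosed O Ω p) (hπ : Irreducible π)
    {β : (Ω ≃ₐ[K] Ω) → (Ω ≃ₐ[K] Ω) → Ω}
    (hlc : IsLocallyConstant fun z : (Ω ≃ₐ[K] Ω) × (Ω ≃ₐ[K] Ω) => β z.1 z.2)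
    (hβ : ∀ s t r, s (β t r) * β s (t * r) = β (s * t) r * β s t)
    (hβ1 : ∀ s t, ∃ b : integralClosure O Ω, β s t = 1 + algebraMap O Ω π * b) :
    ∃ h : (Ω ≃ₐ[K] Ω) → Ω, IsLocallyConstant h ∧ (∀ s, h s ≠ 0) ∧ β = mulCoboundary h := by
  have hπ0 : algebraMap O Ω π ≠ 0 := algebraMap_ne_zero hπ
  -- Completeness is available for the integers of a finite extension. The three subgroups make β
  -- inflated from Gal(L/K) in each variable and valued in `L`, for a finite normal `L`.
  obtain ⟨N₁, hN₁, h₁⟩ := hlc.exists_open_subgroup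
  obtain ⟨N₂, hN₂, h₂⟩ := (hlc.comp_continuous continuous_swap).exists_open_subgroup
  obtain ⟨N₃, hN₃, h₃⟩ := IsLocallyConstant.exists_open_subgroup
    (Y := (Ω ≃ₐ[K] Ω) × (Ω ≃ₐ[K] Ω)) (Γ := Ω ≃ₐ[K] Ω) (f := fun z => z.2 • β z.1.1 z.1.2)
    (IsLocallyConstant.smul_of_continuous continuous_snd (hlc.comp_continuous continuous_fst))
  obtain ⟨L, hL, hLn, hLN⟩ := exists_finite_normal_le (K := K) (Ω := Ω) (N := N₁ ⊓ N₂ ⊓ N₃)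
    ((hN₁.inter hN₂).inter hN₃)
  replace h₁ : ∀ s t, ∀ n ∈ L.fixingSubgroup, β s (t * n) = β s t := fun s t n hn =>
    h₁ s t n (hLN hn).1.1
  replace h₂ : ∀ s t, ∀ n ∈ L.fixingSubgroup, β (s * n) t = β s t := fun s t n hn =>
    h₂ t s n (hLN hn).1.2
  have hmem : ∀ s t, β s t ∈ L := by
    intro s t
    rw [← InfiniteGalois.fixedField_fixingSubgroup L]
    intro n
    have h4 := h₃ (s, t) 1 n (hLN n.2).2
    rwa [one_mul, one_smul] at h4
  have hsurj := AlgEquiv.restrictNormalHom_surjective (F := K) (K₁ := L) Ω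
  choose lift hlift using hsurj
  have hrestr : ∀ s, ∃ n ∈ L.fixingSubgroup, lift (s.restrictNormal L) = s * n := by
    intro s
    refine ⟨s⁻¹ * lift (s.restrictNormal L), ?_, by rw [mul_inv_cancel_left]⟩
    refine (IntermediateField.mem_fixingSubgroup_iff _ _).2 fun x hx => ?_
    have h3 : lift (s.restrictNormal L) x = s x := by
      have := congrArg Subtype.val (DFunLike.congr_fun (hlift (s.restrictNormal L)) ⟨x, hx⟩)
      have h4 := AlgEquiv.restrictNormal_apply L s ⟨x, hx⟩
      have h5 := AlgEquiv.restrictNormal_apply L (lift (s.restrictNormal L)) ⟨x, hx⟩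
      exact h5.symm.trans (this.trans h4)
    change (s⁻¹ * lift (s.restrictNormal L)) x = x
    rw [AlgEquiv.mul_apply, h3, ← AlgEquiv.mul_apply, inv_mul_cancel, AlgEquiv.one_apply]
  have hinj : Function.Injective (L.val.restrictScalars O) := L.val.toRingHom.injective
  have hdvd : ∀ s t, ∃ c : integralClosure O L,
      β s t = 1 + algebraMap O Ω π * ((c : L) : Ω) := by
    intro s t
    obtain ⟨b, hb⟩ := hβ1 s t
    have hbL : (b : Ω) ∈ L := by
      have h4 : (b : Ω) = (β s t - 1) / algebraMap O Ω π := by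
        rw [hb]; field_simp; ring
      rw [h4, IsScalarTower.algebraMap_apply O K Ω]
      exact L.div_mem (L.sub_mem (hmem s t) L.one_mem) (L.algebraMap_mem _)
    exact ⟨⟨⟨b, hbL⟩, (isIntegral_algHom_iff (L.val.restrictScalars O) hinj).1 b.2⟩, hb⟩
  choose c hc using hdvd
  let β' : (L ≃ₐ[K] L) → (L ≃ₐ[K] L) → integralClosure O L := fun g g' =>
    1 + algebraMap O (integralClosure O L) π * c (lift g) (lift g')
  have hβ' : ∀ s t : Ω ≃ₐ[K] Ω,
      ((β' (s.restrictNormal L) (t.restrictNormal L) : L) : Ω) = β s t := by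
    intro s t
    obtain ⟨n, hn, hn'⟩ := hrestr s
    obtain ⟨m, hm, hm'⟩ := hrestr t
    rw [← h₂ s t n hn, ← h₁ _ t m hm, ← hn', ← hm', hc]
    rfl
  have hsmul : ∀ (s : Ω ≃ₐ[K] Ω) (a : integralClosure O L),
      (((s.restrictNormal L • a : integralClosure O L) : L) : Ω) = s ((a : L) : Ω) := fun s a =>
    AlgEquiv.restrictNormal_apply L s (a : L)
  have hmul : ∀ s t : Ω ≃ₐ[K] Ω, s.restrictNormal L * t.restrictNormal L =
      (s * t).restrictNormal L := fun s t => (map_mul (AlgEquiv.restrictNormalHom L) s t).symm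
  have := isAdicComplete_integralClosure L hπ
  have hπL : algebraMap O (integralClosure O L) π ≠ 0 := fun h =>
    hπ0 (congrArg (fun a : integralClosure O L => ((a : L) : Ω)) h)
  obtain ⟨t, ht⟩ := hΩ.exists_sum_smul_eq_one_of_finite L
  obtain ⟨h, h1, hh⟩ := exists_coboundary_of_two_cocycle_dvd_sub_one
    (G := L ≃ₐ[K] L) (R := integralClosure O L) (π := algebraMap O (integralClosure O L) π)
    (fun g => Subtype.ext (by
      change g (algebraMap O L π) = algebraMap O L π
      rw [IsScalarTower.algebraMap_apply O K L, g.commutes])) hπL ht (β := β')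
    (fun g g' => ⟨c (lift g) (lift g'), by simp [β']⟩) (by
      intro g g' g''
      obtain ⟨s, rfl⟩ := AlgEquiv.restrictNormalHom_surjective (F := K) (K₁ := L) Ω g
      obtain ⟨r, rfl⟩ := AlgEquiv.restrictNormalHom_surjective (F := K) (K₁ := L) Ω g'
      obtain ⟨q, rfl⟩ := AlgEquiv.restrictNormalHom_surjective (F := K) (K₁ := L) Ω g''
      change s.restrictNormal L • β' (r.restrictNormal L) (q.restrictNormal L) *
        β' (s.restrictNormal L) (r.restrictNormal L * q.restrictNormal L) =
        β' (s.restrictNormal L * r.restrictNormal L) (q.restrictNormal L) *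
        β' (s.restrictNormal L) (r.restrictNormal L)
      rw [hmul, hmul]
      refine Subtype.ext (Subtype.ext ?_)
      change (((_ • _ : integralClosure O L) : L) : Ω) * ((β' _ _ : L) : Ω) =
        ((β' _ _ : L) : Ω) * ((β' _ _ : L) : Ω)
      rw [hsmul, hβ', hβ', hβ', hβ', hβ])
  have h0 : ∀ g, ((h g : L) : Ω) ≠ 0 := fun g hg =>
    (isUnit_of_dvd_sub_one (h1 g)).ne_zero (Subtype.ext (Subtype.ext hg))
  refine ⟨fun s => ((h (s.restrictNormal L) : L) : Ω), ?_, fun s => h0 _, ?_⟩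
  · refine IsLocallyConstant.of_mul_right L.fixingSubgroup_isOpen fun g n hn => ?_
    have h4 : n.restrictNormal L = 1 := (AlgEquiv.restrictNormal_eq_one_iff L n).2
      ((IntermediateField.mem_fixingSubgroup_iff _ _).1 hn)
    rw [← hmul, h4, mul_one]
  · funext s r
    have h5 := congrArg (fun a : integralClosure O L => ((a : L) : Ω))
      (hh (s.restrictNormal L) (r.restrictNormal L))
    change ((β' _ _ : L) : Ω) * ((h _ : L) : Ω) =
      ((h _ : L) : Ω) * (((_ • _ : integralClosure O L) : L) : Ω) at h5
    rw [hsmul, hβ', hmul] at h5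
    rw [mulCoboundary, eq_div_iff (h0 _)]
    exact h5

end IsUnramifiedClosed

open IsLocalRing

/-! ### Units together with their residues. -/

section UnitResidue

variable {O K Ω : Type*} [CommRing O] [Field K] [Field Ω] [Algebra K Ω]
  [Algebra O Ω] [IsLocalRing (integralClosure O Ω)]

/-- `x` is a unit of the ring of integers with residue `r`. -/
def HasUnitResidue (O : Type*) [CommRing O] [Algebra O Ω] [IsLocalRing (integralClosure O Ω)]
    (x : Ω) (r : ResidueField (integralClosure O Ω)) : Prop :=
  ∃ u : (integralClosure O Ω)ˣ, ((u : integralClosure O Ω) : Ω) = x ∧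
    residue (integralClosure O Ω) u = r

namespace HasUnitResidue

variable {x y : Ω} {r q : ResidueField (integralClosure O Ω)}

theorem ne_zero (hx : HasUnitResidue O x r) : x ≠ 0 := by
  obtain ⟨u, rfl, -⟩ := hx
  exact fun h => u.ne_zero (Subtype.ext h)

theorem mul (hx : HasUnitResidue O x r) (hy : HasUnitResidue O y q) :
    HasUnitResidue O (x * y) (r * q) := by
  obtain ⟨u, rfl, rfl⟩ := hx
  obtain ⟨w, rfl, rfl⟩ := hy
  exact ⟨u * w, rfl, by rw [Units.val_mul, map_mul]⟩

theorem inv (hx : HasUnitResidue O x r) : HasUnitResidue O x⁻¹ r⁻¹ := by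
  obtain ⟨u, rfl, rfl⟩ := hx
  refine ⟨u⁻¹, eq_inv_of_mul_eq_one_left ?_, eq_inv_of_mul_eq_one_left ?_⟩
  · exact congrArg (Subtype.val : integralClosure O Ω → Ω) u.inv_mul
  · rw [← map_mul, u.inv_mul, map_one]

theorem div (hx : HasUnitResidue O x r) (hy : HasUnitResidue O y q) :
    HasUnitResidue O (x / y) (r / q) := by
  simpa only [div_eq_mul_inv] using hx.mul hy.inv

theorem one : HasUnitResidue O (1 : Ω) 1 := ⟨1, rfl, by simp⟩

theorem pow (hx : HasUnitResidue O x r) (n : ℕ) : HasUnitResidue O (x ^ n) (r ^ n) := by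
  induction n with
  | zero => simpa using one
  | succ n ih => simpa only [pow_succ] using ih.mul hx

theorem zpow (hx : HasUnitResidue O x r) (n : ℤ) : HasUnitResidue O (x ^ n) (r ^ n) := by
  cases n with
  | ofNat n => simpa using hx.pow n
  | negSucc n => simpa only [zpow_negSucc] using (hx.pow (n + 1)).inv

theorem smul [Algebra O K] [IsScalarTower O K Ω] (hx : HasUnitResidue O x r) (s : Ω ≃ₐ[K] Ω) :
    HasUnitResidue O (s • x) (s • r) := by
  obtain ⟨u, rfl, rfl⟩ := hx
  exact ⟨Units.map (MulSemiringAction.toRingHom _ (integralClosure O Ω) s).toMonoidHom u, rfl,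
    ResidueField.residue_smul _ _ _⟩

theorem mulCoboundary [Algebra O K] [IsScalarTower O K Ω] {h : (Ω ≃ₐ[K] Ω) → Ω}
    {k : (Ω ≃ₐ[K] Ω) → ResidueField (integralClosure O Ω)}
    (hh : ∀ s, HasUnitResidue O (h s) (k s)) (s t : Ω ≃ₐ[K] Ω) :
    HasUnitResidue O (mulCoboundary h s t) (_root_.mulCoboundary k s t) :=
  ((hh s).mul ((hh t).smul s)).div (hh _)

theorem eq_residue (hx : HasUnitResidue O x r) (hy : HasUnitResidue O x q) : r = q := by
  obtain ⟨u, rfl, rfl⟩ := hx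
  obtain ⟨w, hw, rfl⟩ := hy
  exact congrArg _ (Subtype.ext hw.symm)

theorem of_residue_ne_zero {b : integralClosure O Ω} (hb : residue _ b ≠ 0) :
    HasUnitResidue O (b : Ω) (residue _ b) := by
  obtain ⟨u, rfl⟩ := (residue_ne_zero_iff_isUnit b).1 hb
  exact ⟨u, rfl, rfl⟩

end HasUnitResidue

end UnitResidue

/-! ### Multiplicative 2-cocycles. -/

section TwoCocycles

variable {Γ l : Type*} [Group Γ] [Field l] [MulSemiringAction Γ l]

/-- Multiplicative two-cocycles. -/
structure IsTwoCocycle (α : Γ → Γ → l) : Prop where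
  ne_zero : ∀ s t, α s t ≠ 0
  eq : ∀ s t r, s • α t r * α s (t * r) = α (s * t) r * α s t

namespace IsTwoCocycle

theorem mul {α β : Γ → Γ → l} (hα : IsTwoCocycle α) (hβ : IsTwoCocycle β) :
    IsTwoCocycle fun s t => α s t * β s t where
  ne_zero s t := mul_ne_zero (hα.ne_zero s t) (hβ.ne_zero s t)
  eq s t r := by
    rw [smul_mul']
    linear_combination (s • β t r * β s (t * r)) * hα.eq s t r +
      (α (s * t) r * α s t) * hβ.eq s t r

theorem inv {α : Γ → Γ → l} (hα : IsTwoCocycle α) : IsTwoCocycle fun s t => (α s t)⁻¹ where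
  ne_zero s t := inv_ne_zero (hα.ne_zero s t)
  eq s t r := by rw [smul_inv'', ← mul_inv, ← mul_inv, hα.eq]

theorem mulCoboundary {h : Γ → l} (h0 : ∀ s, h s ≠ 0) : IsTwoCocycle (mulCoboundary h) where
  ne_zero s t := div_ne_zero (mul_ne_zero (h0 s) ((smul_ne_zero_iff_ne s).2 (h0 t))) (h0 _)
  eq s t r := by
    have h1 := (smul_ne_zero_iff_ne s).2 (h0 (t * r))
    have h2 := h0 (s * t)
    have h3 := h0 (s * t * r)
    simp only [_root_.mulCoboundary, smul_div₀', smul_mul', smul_smul, ← mul_assoc]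
    field_simp

end IsTwoCocycle

theorem IsCarry.isTwoCocycle {q : ℕ} {x : Γ → ℤ} {y : Γ → Γ → ℤ} (h : IsCarry q x y) (hq : q ≠ 0)
    {c : l} (hc0 : c ≠ 0) (hc : ∀ s : Γ, s • c = c) : IsTwoCocycle fun s t => c ^ y s t where
  ne_zero s t := zpow_ne_zero _ hc0
  eq s t r := by
    have h1 : s • c ^ y t r = c ^ y t r := by simp [smul_zpow₀', hc]
    rw [h1, ← zpow_add₀ hc0, ← zpow_add₀ hc0]
    congr 1
    have := h.cocycle hq s t r
    linarith

end TwoCocycles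

open IsLocalRing

theorem IsLocallyConstant.mulCoboundary {Γ l : Type*} [Group Γ] [TopologicalSpace Γ]
    [IsTopologicalGroup Γ] [Field l] [MulSemiringAction Γ l] [LocallyConstantSMul Γ l] {h : Γ → l}
    (hh : IsLocallyConstant h) :
    IsLocallyConstant fun z : Γ × Γ => mulCoboundary h z.1 z.2 := by
  have h1 : IsLocallyConstant fun z : Γ × Γ => h z.1 := hh.comp_continuous continuous_fst
  have h2 : IsLocallyConstant fun z : Γ × Γ => h z.2 := hh.comp_continuous continuous_snd
  have h3 : IsLocallyConstant fun z : Γ × Γ => h (z.1 * z.2) := hh.comp_continuous continuous_mul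
  have h4 := IsLocallyConstant.smul_of_continuous (l := l) continuous_fst h2
  exact ((h1.prodMk h4).prodMk h3).comp fun w => w.1.1 * w.1.2 / w.2

/-! ### Decomposition of a p-torsion cocycle into two symbols. -/

namespace IsUnramifiedClosed

variable {O K Ω : Type*} [CommRing O] [Field K] [Algebra O K] [Field Ω] [Algebra K Ω]
  [Algebra O Ω] [IsScalarTower O K Ω] [IsDomain O] [IsFractionRing O K]
  [IsDiscreteValuationRing O] [IsAdicComplete (maximalIdeal O) O] [FaithfulSMul O Ω]
  {p : ℕ} {π : O} [IsGalois K Ω] [CharZero K]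

/-- A two-cocycle of residue one is a coboundary. -/
theorem exists_coboundary_of_hasUnitResidue_one (hΩ : IsUnramifiedClosed O Ω p)
    [IsLocalRing (integralClosure O Ω)]
    {β : (Ω ≃ₐ[K] Ω) → (Ω ≃ₐ[K] Ω) → Ω}
    (hlc : IsLocallyConstant fun z : (Ω ≃ₐ[K] Ω) × (Ω ≃ₐ[K] Ω) => β z.1 z.2)
    (hβ : IsTwoCocycle β) (hβ1 : ∀ s t, HasUnitResidue O (β s t) 1) :
    ∃ h : (Ω ≃ₐ[K] Ω) → Ω, IsLocallyConstant h ∧ (∀ s, h s ≠ 0) ∧ β = mulCoboundary h := by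
  obtain ⟨π, hπ⟩ := IsDiscreteValuationRing.exists_irreducible O
  refine hΩ.exists_coboundary_of_principal_units hπ hlc hβ.eq fun s t => ?_
  obtain ⟨u, hu, hu1⟩ := hβ1 s t
  obtain ⟨b, hb⟩ := (hΩ.mem_maximalIdeal_iff hπ (b := (u : integralClosure O Ω) - 1)).1 (by
    rw [← residue_eq_zero_iff, map_sub, hu1, map_one, sub_self])
  refine ⟨b, ?_⟩
  have h1 : ((u : integralClosure O Ω) : Ω) - 1 = algebraMap O Ω π * b :=
    congrArg (Subtype.val : integralClosure O Ω → Ω) hb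
  rw [← hu, ← h1]
  ring

theorem algEquiv_algebraMap (s : Ω ≃ₐ[K] Ω) (π : O) : s • algebraMap O Ω π = algebraMap O Ω π := by
  rw [IsScalarTower.algebraMap_apply O K Ω]
  exact s.commutes _

/-- The unit cocycles that are killed by `p` are cocycles of symbols. -/
theorem exists_symbol_of_hasUnitResidue [Fact p.Prime] (hΩ : IsUnramifiedClosed O Ω p)
    [CharP (ResidueField O) p] (hpm : (p : O) ∈ maximalIdeal O)
    [IsLocalRing (integralClosure O Ω)] {α : (Ω ≃ₐ[K] Ω) → (Ω ≃ₐ[K] Ω) → Ω}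
    {a : (Ω ≃ₐ[K] Ω) → (Ω ≃ₐ[K] Ω) → ResidueField (integralClosure O Ω)}
    (hα : IsTwoCocycle α)
    (hαlc : IsLocallyConstant fun z : (Ω ≃ₐ[K] Ω) × (Ω ≃ₐ[K] Ω) => α z.1 z.2)
    (hαa : ∀ s t, HasUnitResidue O (α s t) (a s t))
    {g : (Ω ≃ₐ[K] Ω) → ResidueField (integralClosure O Ω)} (hg : IsLocallyConstant g)
    (hg0 : ∀ s, g s ≠ 0) (hag : ∀ s t, a s t ^ p = mulCoboundary g s t) :
    ∃ (n : ℕ) (x : (Ω ≃ₐ[K] Ω) → ℤ) (y : (Ω ≃ₐ[K] Ω) → (Ω ≃ₐ[K] Ω) → ℤ) (c : K)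
      (h : (Ω ≃ₐ[K] Ω) → Ω), IsLocallyConstant x ∧ IsCarry (p ^ n) x y ∧ c ≠ 0 ∧
      IsLocallyConstant h ∧ (∀ s, h s ≠ 0) ∧
      ∀ s t, α s t = algebraMap K Ω c ^ y s t * mulCoboundary h s t := by
  have hp : p.Prime := Fact.out
  have := hΩ.charP_residueField hp hpm
  have : ExpChar (ResidueField (integralClosure O Ω)) p := .prime hp
  obtain ⟨n, x, y, c, h, hx, hxy, -, hc0, hc, hh, -, hh0, ha⟩ := exists_symbol_of_pow_coboundary
    hΩ.hasTraceOne_residueField (hΩ.exists_pow_sub_eq hp)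
    (fun z => hΩ.exists_finset_mem_closure (K := K) hp z) hg hg0 hag
  obtain ⟨b, hb, rfl⟩ := hΩ.exists_residue_eq_of_fixed hc
  obtain ⟨c, hcb⟩ := (InfiniteGalois.mem_range_algebraMap_iff_fixed (k := K) (b : Ω)).2
    fun s : Ω ≃ₐ[K] Ω => congrArg (Subtype.val : integralClosure O Ω → Ω) (hb s)
  have hcb' : HasUnitResidue O (algebraMap K Ω c) (residue _ b) := by
    rw [hcb]
    exact .of_residue_ne_zero hc0
  choose lift hlift using residue_surjective (R := integralClosure O Ω)
  let h₁ : (Ω ≃ₐ[K] Ω) → Ω := fun s => (lift (h s) : Ω)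
  have hh₁ : ∀ s, HasUnitResidue O (h₁ s) (h s) := fun s => by
    have := HasUnitResidue.of_residue_ne_zero (b := lift (h s)) (by rw [hlift]; exact hh0 s)
    rwa [hlift] at this
  have hh₁lc : IsLocallyConstant h₁ := hh.comp fun z => (lift z : Ω)
  have hq : p ^ n ≠ 0 := pow_ne_zero n hp.ne_zero
  have hcK : ∀ s : Ω ≃ₐ[K] Ω, s • algebraMap K Ω c = algebraMap K Ω c := fun s => s.commutes c
  -- `D` lifts the symbol found over the residue field: its element lifts to an invariant integer,
  -- that is to `K`, and its cochain lifts through a fixed section of the residue map, hence locally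
  -- constantly. The quotient of α by `D` has residue one.
  let D : (Ω ≃ₐ[K] Ω) → (Ω ≃ₐ[K] Ω) → Ω := fun s t =>
    algebraMap K Ω c ^ y s t * mulCoboundary h₁ s t
  have hD : IsTwoCocycle D := (hxy.isTwoCocycle hq hcb'.ne_zero hcK).mul
    (.mulCoboundary fun s => (hh₁ s).ne_zero)
  have hDlc : IsLocallyConstant fun z : (Ω ≃ₐ[K] Ω) × (Ω ≃ₐ[K] Ω) => D z.1 z.2 :=
    ((hxy.isLocallyConstant hq hx).prodMk hh₁lc.mulCoboundary).comp
      fun w => algebraMap K Ω c ^ w.1 * w.2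
  obtain ⟨h₂, hh₂lc, hh₂, hβ⟩ := hΩ.exists_coboundary_of_hasUnitResidue_one
    (β := fun s t => α s t * (D s t)⁻¹)
    ((hαlc.prodMk hDlc).comp fun w => w.1 * w.2⁻¹) (hα.mul hD.inv) (fun s t => by
      have h3 : HasUnitResidue O (D s t) (a s t) := by
        rw [ha]
        exact (hcb'.zpow _).mul (.mulCoboundary hh₁ s t)
      have h4 := (hαa s t).mul h3.inv
      rwa [mul_inv_cancel₀] at h4
      intro h0
      obtain ⟨u, -, hu⟩ := hαa s t
      rw [h0] at hu
      exact (u.isUnit.map (residue _)).ne_zero hu)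
  refine ⟨n, x, y, c, fun s => h₁ s * h₂ s, hx, hxy, ?_, (hh₁lc.prodMk hh₂lc).comp fun w => w.1 * w.2,
    fun s => mul_ne_zero (hh₁ s).ne_zero (hh₂ s), fun s t => ?_⟩
  · rintro rfl
    exact hcb'.ne_zero (map_zero _)
  · have h5 := congrFun (congrFun hβ s) t
    rw [mulCoboundary_mul, ← h5, ← mul_assoc]
    change _ = D s t * _
    rw [mul_comm (α s t), mul_inv_cancel_left₀ (hD.ne_zero s t)]

/-- A two-cocycle killed by `p` is a product of the cocycles of two symbols, one of which is the
symbol of a character of order `p` and the uniformizer. -/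
theorem exists_symbols [Fact p.Prime] (hΩ : IsUnramifiedClosed O Ω p)
    [CharP (ResidueField O) p] (hpm : (p : O) ∈ maximalIdeal O) (hπ : Irreducible π)
    {α : (Ω ≃ₐ[K] Ω) → (Ω ≃ₐ[K] Ω) → Ω} (hα : IsTwoCocycle α)
    (hαlc : IsLocallyConstant fun z : (Ω ≃ₐ[K] Ω) × (Ω ≃ₐ[K] Ω) => α z.1 z.2)
    {g : (Ω ≃ₐ[K] Ω) → Ω} (hg : IsLocallyConstant g) (hg0 : ∀ s, g s ≠ 0)
    (hαg : ∀ s t, α s t ^ p = mulCoboundary g s t) :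
    ∃ (n : ℕ) (x x' : (Ω ≃ₐ[K] Ω) → ℤ) (y y' : (Ω ≃ₐ[K] Ω) → (Ω ≃ₐ[K] Ω) → ℤ) (c : K)
      (h : (Ω ≃ₐ[K] Ω) → Ω), IsLocallyConstant x ∧ IsCarry (p ^ n) x y ∧ c ≠ 0 ∧
      IsLocallyConstant x' ∧ IsCarry p x' y' ∧ IsLocallyConstant h ∧ (∀ s, h s ≠ 0) ∧
      ∀ s t, α s t = algebraMap K Ω c ^ y s t * algebraMap O Ω π ^ y' s t *
        mulCoboundary h s t := by
  have := hΩ.isLocalRing_integralClosure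
  have hp : p.Prime := Fact.out
  have hπ0 : algebraMap O Ω π ≠ 0 := algebraMap_ne_zero hπ
  -- The valuation and the residue of the unit part are chosen as functions of z alone, so their
  -- composites with cochains stay locally constant; nothing is required of them at z = 0.
  have hex : ∀ z : Ω, ∃ (n : ℤ) (r : ResidueField (integralClosure O Ω)),
      z ≠ 0 → HasUnitResidue O (z / algebraMap O Ω π ^ n) r := by
    intro z
    by_cases hz : z = 0
    · exact ⟨0, 0, fun h => (h hz).elim⟩
    · obtain ⟨n, u, hu⟩ := hΩ.exists_zpow_mul_unit hπ hz
      refine ⟨n, residue _ u, fun _ => ⟨u, ?_, rfl⟩⟩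
      rw [hu, mul_div_cancel_left₀ _ (zpow_ne_zero n hπ0)]
  choose v r hv using hex
  let U : Ω → Ω := fun z => z / algebraMap O Ω π ^ v z
  have hU : ∀ z, z ≠ 0 → HasUnitResidue O (U z) (r z) := hv
  have hzU : ∀ z, z = algebraMap O Ω π ^ v z * U z := fun z => by
    rw [mul_div_cancel₀ _ (zpow_ne_zero _ hπ0)]
  have hsU : ∀ (s : Ω ≃ₐ[K] Ω) z, s • z = algebraMap O Ω π ^ v z * s • U z := fun s z => by
    conv_lhs => rw [hzU z]
    rw [smul_mul', smul_zpow₀', algEquiv_algebraMap]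
  have huniq : ∀ {n m : ℤ} {z w : Ω} {a b}, HasUnitResidue O z a → HasUnitResidue O w b →
      algebraMap O Ω π ^ n * z = algebraMap O Ω π ^ m * w → n = m ∧ z = w := by
    rintro n m _ _ _ _ ⟨z, rfl, -⟩ ⟨w, rfl, -⟩ h
    have hnm := hΩ.zpow_mul_unit_unique hπ h
    subst hnm
    exact ⟨rfl, mul_left_cancel₀ (zpow_ne_zero n hπ0) h⟩
  -- Since π is invariant, the identity α^p = ∂g splits. On valuations it says that v ∘ g is a
  -- character modulo p with carries v ∘ α, and on unit parts that U(α)^p = ∂U(g).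
  have hkey : ∀ s t, v (g s) + v (g t) - v (g (s * t)) = p * v (α s t) ∧
      mulCoboundary (fun s => U (g s)) s t = U (α s t) ^ p := by
    intro s t
    refine huniq (.mulCoboundary (fun s => hU _ (hg0 s)) s t)
      ((hU _ (hα.ne_zero s t)).pow p) ?_
    have h1 := hαg s t
    rw [mulCoboundary, hsU] at h1
    conv_lhs at h1 => rw [hzU (α s t)]
    rw [mul_pow, ← zpow_natCast, ← zpow_mul, mul_comm (v (α s t))] at h1
    rw [h1, mulCoboundary, zpow_sub₀ hπ0, zpow_add₀ hπ0]
    conv_rhs => rw [hzU (g s), hzU (g (s * t))]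
    rw [mul_mul_mul_comm, mul_div_mul_comm]
  have hcarry : IsCarry p (fun s => v (g s)) fun s t => v (α s t) := fun s t => (hkey s t).1
  have hc : IsTwoCocycle fun s t => algebraMap O Ω π ^ v (α s t) :=
    hcarry.isTwoCocycle hp.ne_zero hπ0 fun s => algEquiv_algebraMap s π
  have hUα : IsTwoCocycle fun s t => U (α s t) := by
    simpa only [U, div_eq_mul_inv] using hα.mul hc.inv
  obtain ⟨n, x, y, c, h, hx, hxy, hc0, hh, hh0, hαh⟩ := hΩ.exists_symbol_of_hasUnitResidue hpm hUα
    (hαlc.comp U) (a := fun s t => r (α s t)) (fun s t => hU _ (hα.ne_zero s t))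
    (g := fun s => r (g s)) (hg.comp r) (fun s h0 => by
      obtain ⟨u, -, hu⟩ := hU _ (hg0 s)
      rw [h0] at hu
      exact (u.isUnit.map (residue _)).ne_zero hu) (fun s t => by
      have h1 : HasUnitResidue O (mulCoboundary (fun s => U (g s)) s t) _ :=
        .mulCoboundary (fun s => hU _ (hg0 s)) s t
      rw [(hkey s t).2] at h1
      exact ((hU _ (hα.ne_zero s t)).pow p).eq_residue h1)
  refine ⟨n, x, fun s => v (g s), y, fun s t => v (α s t), c, h, hx, hxy, hc0, hg.comp v, hcarry,
    hh, hh0, fun s t => ?_⟩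
  conv_lhs => rw [hzU (α s t), hαh s t]
  ring

end IsUnramifiedClosed

open IsLocalRing

/-! ### From symbols back to Brauer classes, and the main theorem. -/

namespace IsCarry

variable {K Ω : Type u} [Field K] [Field Ω] [Algebra K Ω] [IsGalois K Ω]

/-- A cyclic class is represented by the cocycle of a symbol, also for a character which is not
surjective. -/
theorem exists_isCyclicBrauerClass_of_prime_pow {p n : ℕ} [Fact p.Prime] {x : (Ω ≃ₐ[K] Ω) → ℤ}
    {y : (Ω ≃ₐ[K] Ω) → (Ω ≃ₐ[K] Ω) → ℤ} (h : IsCarry (p ^ n) x y) (hx : IsLocallyConstant x)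
    {b : K} (hb : b ≠ 0) :
    ∃ z, IsCyclicBrauerClass z ∧ IsRepresentedBy z fun s t => algebraMap K Ω b ^ y s t := by
  obtain ⟨m, d, x', σ, hx', h', hσ⟩ := h.exists_surjective
  have hx'lc : IsLocallyConstant x' := by
    have : x' = (· / (d : ℤ)) ∘ x := funext hx'
    rw [this]
    exact hx.comp _
  exact h'.exists_isCyclicBrauerClass (pow_ne_zero m (Fact.out : p.Prime).ne_zero) hx'lc hσ hb

end IsCarry

namespace IsUnramifiedClosed

/-- An element of order `p` split by the maximal unramified extension is a sum of two cyclic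
classes of order `p`. -/
theorem exists_cyclic_add_cyclic {O : Type*} {K Ω : Type u} [CommRing O] [Field K] [Algebra O K]
    [Field Ω] [Algebra K Ω] [Algebra O Ω] [IsScalarTower O K Ω] [IsDomain O] [IsFractionRing O K]
    [IsDiscreteValuationRing O] [IsAdicComplete (maximalIdeal O) O] [FaithfulSMul O Ω]
    [IsGalois K Ω] [CharZero K] {p : ℕ} [Fact p.Prime] [CharP (ResidueField O) p]
    (hΩ : IsUnramifiedClosed O Ω p) (hpm : (p : O) ∈ maximalIdeal O) {x : BrauerGroup.{u, u} K}
    (hx : x ∈ relativeBrauerTorsion K Ω p) :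
    ∃ z z', (z ∈ relativeBrauerTorsion K Ω p ∧ IsCyclicBrauerClass z) ∧
      (z' ∈ relativeBrauerTorsion K Ω p ∧ IsCyclicBrauerClass z') ∧ z + z' = x := by
  obtain ⟨π, hπ⟩ := IsDiscreteValuationRing.exists_irreducible O
  obtain ⟨hxr, hxp⟩ := hx
  replace hxp : p • x = 0 := hxp
  obtain ⟨α, hα⟩ := exists_isRepresentedBy hxr
  have hαp := hα.nsmul p
  rw [hxp] at hαp
  obtain ⟨g, hg, hg0, hαg⟩ := hαp.exists_coboundary
  obtain ⟨n, y₁, y₂, k₁, k₂, c, h, hy₁, hk₁, hc, hy₂, hk₂, hh, hh0, hαh⟩ :=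
    hΩ.exists_symbols hpm hπ ⟨hα.ne_zero, hα.cocycle⟩ hα.isLocallyConstant hg hg0
      fun s t => congrFun (congrFun hαg s) t
  have hπK : algebraMap O K π ≠ 0 := by
    rw [ne_eq, map_eq_zero_iff _ (IsFractionRing.injective O K)]
    exact hπ.ne_zero
  obtain ⟨z, hz, hzr⟩ := hk₁.exists_isCyclicBrauerClass_of_prime_pow hy₁ hc
  have hk₂' : IsCarry (p ^ 1) y₂ k₂ := by rwa [pow_one]
  obtain ⟨z', hz', hzr'⟩ := hk₂'.exists_isCyclicBrauerClass_of_prime_pow hy₂ hπK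
  -- The cochains of x and z + z' differ by ∂h. Adding a representative β of -x, with α β = ∂f,
  -- shows that z + z' - x is represented by the coboundary of f/h.
  have hsum : z + z' = x := by
    have hneg : -x ∈ relativeBrauerGroup K Ω := neg_mem hxr
    obtain ⟨β, hβ⟩ := exists_isRepresentedBy hneg
    have h0 := hα.add hβ
    rw [add_neg_cancel] at h0
    obtain ⟨f, hf, hf0, hαβ⟩ := h0.exists_coboundary
    have h1 := (hzr.add hzr').add hβ
    rw [← sub_eq_zero, sub_eq_add_neg]
    refine IsRepresentedBy.eq_zero (h := fun s => f s * (h s)⁻¹)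
      ((hf.prodMk hh).comp fun w => w.1 * w.2⁻¹)
      (fun s => mul_ne_zero (hf0 s) (inv_ne_zero (hh0 s))) ?_
    convert h1 using 1
    funext s t
    have h2 : α s t * β s t = mulCoboundary f s t := congrFun (congrFun hαβ s) t
    have h3 : mulCoboundary h s t ≠ 0 := (IsTwoCocycle.mulCoboundary hh0).ne_zero s t
    rw [mulCoboundary_mul, mulCoboundary_inv, ← h2, hαh, ← IsScalarTower.algebraMap_apply O K Ω]
    field_simp
  -- As p k₂ = ∂y₂, the p-th power of the cocycle π^k₂ is the coboundary of π^y₂. The other class is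
  -- then killed by p because x is.
  have hzp' : p • z' = 0 := by
    refine IsRepresentedBy.eq_zero (h := fun s => algebraMap O Ω π ^ y₂ s) (hy₂.comp _)
      (fun s => zpow_ne_zero _ (algebraMap_ne_zero hπ)) ?_
    convert hzr'.nsmul p using 1
    funext s t
    rw [mulCoboundary_zpow (algebraMap_ne_zero hπ) fun s => algEquiv_algebraMap s π, hk₂ s t,
      ← IsScalarTower.algebraMap_apply O K Ω, ← zpow_natCast, ← zpow_mul, mul_comm]
  have hzp : p • z = 0 := by
    have := hxp
    rwa [← hsum, smul_add, hzp', add_zero] at this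
  exact ⟨z, z', ⟨⟨hzr.mem_relativeBrauerGroup, hzp⟩, hz⟩,
    ⟨⟨hzr'.mem_relativeBrauerGroup, hzp'⟩, hz'⟩, hsum⟩

end IsUnramifiedClosed

theorem mainTheorem11 (O : Type*) (K : Type u) [CommRing O] [IsDomain O]
    [IsDiscreteValuationRing O] [IsAdicComplete (IsLocalRing.maximalIdeal O) O]
    [Field K] [Algebra O K] [IsFractionRing O K]
    (p : ℕ) [Fact p.Prime] [CharZero K] [CharP (IsLocalRing.ResidueField O) p]
    (hζ : ∃ ζ : K, IsPrimitiveRoot ζ p) :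
    AddSubgroup.closure {x : BrauerGroup.{u, u} K |
        x ∈ relativeBrauerTorsion K (maximalUnramifiedExtension O K) p ∧ IsCyclicBrauerClass x} =
      relativeBrauerTorsion K (maximalUnramifiedExtension O K) p ∧
    ∀ x ∈ relativeBrauerTorsion K (maximalUnramifiedExtension O K) p,
      ∃ l : List (BrauerGroup.{u, u} K), l.length ≤ 2 ∧
        (∀ y ∈ l, y ∈ relativeBrauerTorsion K (maximalUnramifiedExtension O K) p ∧
          IsCyclicBrauerClass y) ∧
        l.sum = x := by
  have hp : p.Prime := Fact.out
  have hpm : (p : O) ∈ maximalIdeal O := by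
    rw [← residue_eq_zero_iff, map_natCast, CharP.cast_eq_zero]
  have : FaithfulSMul O (maximalUnramifiedExtension O K) := faithfulSMul_of_isFractionRing (K := K)
  have hΩ := isUnramifiedClosed_maximalUnramifiedExtension (K := K) hp hpm
  refine ⟨le_antisymm ((AddSubgroup.closure_le _).2 fun x hx => hx.1) fun x hx => ?_,
    fun x hx => ?_⟩
  · obtain ⟨z, z', hz, hz', rfl⟩ := hΩ.exists_cyclic_add_cyclic hpm hx
    exact add_mem (AddSubgroup.subset_closure hz) (AddSubgroup.subset_closure hz')
  · obtain ⟨z, z', hz, hz', rfl⟩ := hΩ.exists_cyclic_add_cyclic hpm hx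
    exact ⟨[z, z'], by simp, by simp [hz, hz'], by simp⟩
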